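/- Let $(G,\{\cdot,\cdot\}_G)$ be a (finite-dimensional, real) Poisson-Lie group with Lie algebra $\mathfrak g$, and equip $\mathfrak g^*$ with the Lie bracket $[d_ef,d_eg]_*=d_e\{f,g\}_G$. Let $G^*$ be a connected and simply connected Lie group with Lie algebra $\mathfrak g^*$. Let $D\mathfrak g=\mathfrak g\oplus\mathfrak g^*$ be the Drinfel'd double, with embeddings $\iota,\iota^*$ of $\mathfrak g,\mathfrak g^*$: its Lie bracket is the unique one for which $\iota$ and $\iota^*$ are Lie homomorphisms and the pairing $\langle (X,\lambda)|(Y,\mu)\rangle=\mu(X)+\lambda(Y)$ is ad-invariant. Let $DG$ be a Lie group with Lie algebra $D\mathfrak g$, and let $\iota^*:G^*\to DG$ also denote the smooth group homomorphism with differential $\iota^*$ at the identity. For a basis $(T^a)$ of $\mathfrak g$ with dual basis $(T_a)$ of $\mathfrak g^*$ put $$\mathcal R^D_{12}=\sum_a \iota(T^a)\otimes\iota^*(T_a)-\iota^*(T_a)\otimes\iota(T^a)\in D\mathfrak g\otimes D\mathfrak g .$$ Let $(M,\{\cdot,\cdot\})$ be a finite-dimensional Poisson manifold, let $\Gamma:M\to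 G^*$ be a smooth map, and for $\epsilon\in\mathfrak g$ and $f\in C^\infty(M)$ let $$\delta_\epsilon f=-\langle\epsilon,\Gamma^{-1}\{\Gamma,f\}\rangle ,$$ where $\{\Gamma,f\}(x)=(d_x\Gamma\otimes d_xf)(\pi_x)\in T_{\Gamma(x)}G^*$ for the Poisson bivector $\pi$ of $M$, and $\Gamma^{-1}$ is left translation to the identity. (When $\delta$ is the infinitesimal action of $G$ on $M$, $\Gamma$ is a non-abelian moment map of the action.) For smooth $N:M\to\mathfrak g^*\otimes\mathfrak g^*$ consider the relation $$\{\iota^*(\Gamma)_1,\iota^*(\Gamma)_2\}=-\tfrac12\big[\mathcal R^D_{12},\iota^*(\Gamma)_1\iota^*(\Gamma)_2\big]+N_{12}\,\iota^*(\Gamma)_1\iota^*(\Gamma)_2 ,\qquad(\ast)$$ an equality in $T_{\iota^*(\Gamma(x))}DG^{\otimes 2}$ for every $x\in M$: the left side is the image of $\pi_x$ under $d_x(\iota^*\circ\Gamma)^{\otimes2}$, and multiplication by $\iota^*(\Gamma)_1\iota^*(\Gamma)_2$ on the right (left) is right (left) translation; $N$ is seen in $D\mathfrak g\otimes D\mathfrak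 g$ through $\iota^*\otimes\iota^*$. Then: 1. If $\delta$ is a Lie algebra action, that is $[\delta_\epsilon,\delta_{\epsilon'}]f=\delta_{[\epsilon,\epsilon']}f$ for all $\epsilon,\epsilon'\in\mathfrak g$ and $f\in C^\infty(M)$, then $(\ast)$ holds for some smooth $N:M\to\mathfrak g^*\otimes\mathfrak g^*$ that is skew-symmetric and central (the coefficients of $N$ Poisson commute with every smooth function on $M$). 2. Conversely, if $(\ast)$ holds for some smooth, skew-symmetric and central $N:M\to\mathfrak g^*\otimes\mathfrak g^*$, then $\delta$ is a Lie algebra action. 3. For every constant $C\in G^*$ the tensor $$\tfrac12\mathcal R^D_{12}-\tfrac12\,\iota^*(C)_1^{-1}\iota^*(C)_2^{-1}\,\mathcal R^D_{12}\,\iota^*(C)_1\iota^*(C)_2$$ lies in $\iota^*(\mathfrak g^*)\otimes\iota^*(\mathfrak g^*)$ and is skew-symmetric. The map $\tilde\Gamma=C\Gamma$ defines the same transformations $\delta_\epsilon$ as $\Gamma$. If $(\ast)$ holds for $\Gamma$ with $N$ constant and equal to this tensor, then $$\{\iota^*(\tilde\Gamma)_1,\iota^*(\tilde\Gamma)_2\}=-\tfrac12\big[\mathcal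 R^D_{12},\iota^*(\tilde\Gamma)_1\iota^*(\tilde\Gamma)_2\big].$$ -/

import Mathlib

open scoped Manifold ContDiff TensorProduct

noncomputable section

namespace PoissonLie

/-! ### Poisson manifolds -/

section Bivectors

variable {E : Type*} [NormedAddCommGroup E] [NormedSpace ℝ E]
  {H : Type*} [TopologicalSpace H] {I : ModelWithCorners ℝ E H}
  {M : Type*} [TopologicalSpace M] [ChartedSpace H M]
  {E' : Type*} [NormedAddCommGroup E'] [NormedSpace ℝ E']
  {H' : Type*} [TopologicalSpace H'] {I' : ModelWithCorners ℝ E' H'}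
  {M' : Type*} [TopologicalSpace M'] [ChartedSpace H' M']

variable (I M) in
/-- A field of contravariant 2-tensors on the manifold `M`: an element of `T_x M ⊗ T_x M` for every
point `x` (no regularity is required). -/
abbrev TensorField : Type _ := ∀ x : M, TangentSpace I x ⊗[ℝ] TangentSpace I x

variable (I) in
/-- The differential `d_x f : T_x M → ℝ` of a real valued function. -/
def differential (f : M → ℝ) (x : M) : TangentSpace I x →ₗ[ℝ] ℝ :=
  { toFun := fun v => mfderiv I 𝓘(ℝ, ℝ) f x v
    map_add' := (mfderiv I 𝓘(ℝ, ℝ) f x).map_add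
    map_smul' := (mfderiv I 𝓘(ℝ, ℝ) f x).map_smul }

/-- The value of the 2-tensor `P` on a pair of linear forms: `u ⊗ v` is sent to `α u * β v`. -/
def contract {V : Type*} [AddCommGroup V] [Module ℝ V] (α β : V →ₗ[ℝ] ℝ) (P : V ⊗[ℝ] V) : ℝ :=
  TensorProduct.lid ℝ ℝ (TensorProduct.map α β P)

/-- The bracket `{f, g}(x) = (d_x f ⊗ d_x g)(π_x)` of two real valued functions. -/
def bracket (π : TensorField I M) (f g : M → ℝ) : M → ℝ :=
  fun x => contract (differential I f x) (differential I g x) (π x)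

/-- For a map `F : M → M'`, the bracket `{F₁, F₂}(x) = (d_x F ⊗ d_x F)(π_x)` of `F` with itself, in
tensorial notation; it lives in `T_{F x} M' ⊗ T_{F x} M'`. -/
def selfBracket (I' : ModelWithCorners ℝ E' H') (π : TensorField I M) (F : M → M') (x : M) :
    TangentSpace I' (F x) ⊗[ℝ] TangentSpace I' (F x) :=
  TensorProduct.map (mfderiv I I' F x : TangentSpace I x →ₗ[ℝ] TangentSpace I' (F x))
    (mfderiv I I' F x : TangentSpace I x →ₗ[ℝ] TangentSpace I' (F x)) (π x)

/-- For a map `F : M → M'` and a function `f`, the bracket `{F, f}(x) = (d_x F ⊗ d_x f)(π_x)`; it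
lives in `T_{F x} M'`. -/
def mapBracket (I' : ModelWithCorners ℝ E' H') (π : TensorField I M) (F : M → M') (f : M → ℝ)
    (x : M) : TangentSpace I' (F x) :=
  TensorProduct.rid ℝ (TangentSpace I' (F x))
    (TensorProduct.map (mfderiv I I' F x : TangentSpace I x →ₗ[ℝ] TangentSpace I' (F x))
      (differential I f x) (π x))

/-- `F` is a Poisson map: it sends the tensor field of the source to the one of the target. -/
def IsPoissonMap (π : TensorField I M) (π' : TensorField I' M') (F : M → M') : Prop :=
  ∀ x, selfBracket I' π F x = π' (F x)

/-- The direct product tensor field on `M × M'`: the sum of the images of the two fields under the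
inclusions `M ≃ M × {y}` and `M' ≃ {x} × M'`. -/
def prodTensorField (π : TensorField I M) (π' : TensorField I' M') :
    TensorField (I.prod I') (M × M') :=
  fun p => selfBracket (I.prod I') π (fun x => (x, p.2)) p.1 +
    selfBracket (I.prod I') π' (fun y => (p.1, y)) p.2

variable (E M) in
/-- A Poisson structure on a (finite dimensional, Hausdorff, boundaryless) smooth manifold: a
smooth bivector field whose bracket of functions satisfies the Jacobi identity. Smoothness of the
field is expressed by saying that the bracket of smooth functions is smooth. -/
structure PoissonStructure [ChartedSpace E M] where
  /-- the bivector field -/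
  tensor : TensorField 𝓘(ℝ, E) M
  skew : ∀ x, TensorProduct.comm ℝ _ _ (tensor x) = -tensor x
  smooth : ∀ f g : M → ℝ, ContMDiff 𝓘(ℝ, E) 𝓘(ℝ, ℝ) ∞ f → ContMDiff 𝓘(ℝ, E) 𝓘(ℝ, ℝ) ∞ g →
    ContMDiff 𝓘(ℝ, E) 𝓘(ℝ, ℝ) ∞ (bracket tensor f g)
  jacobi : ∀ f g h : M → ℝ, ContMDiff 𝓘(ℝ, E) 𝓘(ℝ, ℝ) ∞ f → ContMDiff 𝓘(ℝ, E) 𝓘(ℝ, ℝ) ∞ g →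
    ContMDiff 𝓘(ℝ, E) 𝓘(ℝ, ℝ) ∞ h →
    bracket tensor f (bracket tensor g h) + bracket tensor g (bracket tensor h f) +
      bracket tensor h (bracket tensor f g) = 0

theorem contract_tmul {V : Type*} [AddCommGroup V] [Module ℝ V] (α β : V →ₗ[ℝ] ℝ) (u v : V) :
    contract α β (u ⊗ₜ[ℝ] v) = α u * β v := by
  simp [contract]

theorem contract_add_left {V : Type*} [AddCommGroup V] [Module ℝ V] (α α' β : V →ₗ[ℝ] ℝ)
    (P : V ⊗[ℝ] V) : contract (α + α') β P = contract α β P + contract α' β P := by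
  simp [contract, TensorProduct.map_add_left]

theorem contract_smul_left {V : Type*} [AddCommGroup V] [Module ℝ V] (c : ℝ) (α β : V →ₗ[ℝ] ℝ)
    (P : V ⊗[ℝ] V) : contract (c • α) β P = c * contract α β P := by
  simp [contract, TensorProduct.map_smul_left]

theorem contract_comm {V : Type*} [AddCommGroup V] [Module ℝ V] (α β : V →ₗ[ℝ] ℝ)
    (P : V ⊗[ℝ] V) : contract α β (TensorProduct.comm ℝ V V P) = contract β α P := by
  induction P with
  | zero => simp [contract]
  | tmul u v => simp [contract, mul_comm]
  | add P Q hP hQ =>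
    simp only [contract, map_add] at hP hQ ⊢
    rw [hP, hQ]

theorem PoissonStructure.bracket_skew [ChartedSpace E M] (π : PoissonStructure E M)
    (f g : M → ℝ) : bracket π.tensor f g = -bracket π.tensor g f := by
  ext x
  simp only [bracket, Pi.neg_apply]
  rw [← contract_comm, π.skew]
  simp [contract]

variable {E'' : Type*} [NormedAddCommGroup E''] [NormedSpace ℝ E'']
  {H'' : Type*} [TopologicalSpace H''] {I'' : ModelWithCorners ℝ E'' H''}
  {M'' : Type*} [TopologicalSpace M''] [ChartedSpace H'' M'']

theorem selfBracket_comp (π : TensorField I M) {F : M → M'} {F' : M' → M''} {x : M}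
    (hF' : MDifferentiableAt I' I'' F' (F x)) (hF : MDifferentiableAt I I' F x) :
    TensorProduct.map
        (mfderiv I' I'' F' (F x) : TangentSpace I' (F x) →ₗ[ℝ] TangentSpace I'' (F' (F x)))
        (mfderiv I' I'' F' (F x) : TangentSpace I' (F x) →ₗ[ℝ] TangentSpace I'' (F' (F x)))
        (selfBracket I' π F x) = selfBracket I'' π (F' ∘ F) x := by
  rw [selfBracket, selfBracket, mfderiv_comp x hF' hF, ← LinearMap.comp_apply,
    ← TensorProduct.map_comp]
  rfl

theorem selfBracket_id (π : TensorField I M) (x : M) :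
    selfBracket I π (id : M → M) x = π x := by
  simp only [selfBracket, mfderiv_id]
  exact LinearMap.congr_fun TensorProduct.map_id (π x)

theorem differential_add {f g : M → ℝ} {x : M} (hf : MDifferentiableAt I 𝓘(ℝ, ℝ) f x)
    (hg : MDifferentiableAt I 𝓘(ℝ, ℝ) g x) :
    differential I (f + g) x = differential I f x + differential I g x := by
  ext v
  change mfderiv I 𝓘(ℝ, ℝ) (f + g) x v = _
  rw [mfderiv_add hf hg]
  rfl

theorem differential_smul (c : ℝ) {f : M → ℝ} {x : M} (hf : MDifferentiableAt I 𝓘(ℝ, ℝ) f x) :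
    differential I (c • f) x = c • differential I f x := by
  ext v
  change mfderiv I 𝓘(ℝ, ℝ) (c • f) x v = _
  rw [const_smul_mfderiv hf]
  rfl

end Bivectors

/-! ### Lie groups -/

section LieGroups

instance instLEInftyMinSmoothness : ENat.LEInfty (minSmoothness ℝ 3) :=
  ⟨by simpa using (ENat.LEInfty.out : (3 : ℕ∞ω) ≤ ∞)⟩

variable {E : Type*} [NormedAddCommGroup E] [NormedSpace ℝ E]
  {G : Type*} [TopologicalSpace G] [ChartedSpace E G] [Group G]

variable (E G) in
/-- The Lie algebra of `G`: the tangent space at the identity, with the bracket of left invariant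
vector fields. -/
abbrev LieAlg : Type _ := GroupLieAlgebra 𝓘(ℝ, E) G

instance instFiniteDimensionalTangentSpace [FiniteDimensional ℝ E] (x : G) :
    FiniteDimensional ℝ (TangentSpace 𝓘(ℝ, E) x) :=
  inferInstanceAs (FiniteDimensional ℝ E)

/-- `v ↦ g v`, the differential at the identity of `x ↦ g x`. -/
def leftTranslate (g : G) : LieAlg E G →ₗ[ℝ] TangentSpace 𝓘(ℝ, E) g :=
  { toFun := fun v => mfderiv 𝓘(ℝ, E) 𝓘(ℝ, E) (fun x => g * x) (1 : G) v
    map_add' := (mfderiv 𝓘(ℝ, E) 𝓘(ℝ, E) (fun x => g * x) (1 : G)).map_add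
    map_smul' := (mfderiv 𝓘(ℝ, E) 𝓘(ℝ, E) (fun x => g * x) (1 : G)).map_smul }

/-- `v ↦ v g`, the differential at the identity of `x ↦ x g`. -/
def rightTranslate (g : G) : LieAlg E G →ₗ[ℝ] TangentSpace 𝓘(ℝ, E) g :=
  { toFun := fun v => mfderiv 𝓘(ℝ, E) 𝓘(ℝ, E) (fun x => x * g) (1 : G) v
    map_add' := (mfderiv 𝓘(ℝ, E) 𝓘(ℝ, E) (fun x => x * g) (1 : G)).map_add
    map_smul' := (mfderiv 𝓘(ℝ, E) 𝓘(ℝ, E) (fun x => x * g) (1 : G)).map_smul }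

/-- `w ↦ g⁻¹ w`, the differential at `g` of `x ↦ g⁻¹ x`. -/
def leftTrivialize (g : G) : TangentSpace 𝓘(ℝ, E) g →ₗ[ℝ] LieAlg E G :=
  { toFun := fun v => mfderiv 𝓘(ℝ, E) 𝓘(ℝ, E) (fun x => g⁻¹ * x) g v
    map_add' := (mfderiv 𝓘(ℝ, E) 𝓘(ℝ, E) (fun x => g⁻¹ * x) g).map_add
    map_smul' := (mfderiv 𝓘(ℝ, E) 𝓘(ℝ, E) (fun x => g⁻¹ * x) g).map_smul }

/-- The adjoint action `v ↦ g v g⁻¹`. -/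
def Ad (g : G) : LieAlg E G →ₗ[ℝ] LieAlg E G :=
  { toFun := fun v => mfderiv 𝓘(ℝ, E) 𝓘(ℝ, E) (fun x => g * x * g⁻¹) (1 : G) v
    map_add' := (mfderiv 𝓘(ℝ, E) 𝓘(ℝ, E) (fun x => g * x * g⁻¹) (1 : G)).map_add
    map_smul' := (mfderiv 𝓘(ℝ, E) 𝓘(ℝ, E) (fun x => g * x * g⁻¹) (1 : G)).map_smul }

/-- The map `L ⊗ L` on 2-tensors. -/
abbrev tensorSq {V W : Type*} [AddCommGroup V] [Module ℝ V] [AddCommGroup W] [Module ℝ W]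
    (L : V →ₗ[ℝ] W) : V ⊗[ℝ] V →ₗ[ℝ] W ⊗[ℝ] W :=
  TensorProduct.map L L

/-- `(G, π)` is a Poisson-Lie group: the multiplication `G × G → G` is a Poisson map. -/
def IsPoissonLie (π : PoissonStructure E G) : Prop :=
  IsPoissonMap (prodTensorField π.tensor π.tensor) π.tensor (fun p : G × G => p.1 * p.2)

/-- The bivector of a Poisson-Lie group vanishes at the identity. -/
theorem IsPoissonLie.tensor_one [LieGroup 𝓘(ℝ, E) ∞ G] {π : PoissonStructure E G} (hπ : IsPoissonLie π) :
    π.tensor (1 : G) = 0 := by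
  have aux : ∀ y : G, y = 1 → ∀ A B C : TangentSpace 𝓘(ℝ, E) y ⊗[ℝ] TangentSpace 𝓘(ℝ, E) y,
      HEq A (π.tensor 1) → HEq B (π.tensor 1) → HEq C (π.tensor 1) → A + B = C →
      π.tensor 1 = 0 := by
    rintro y rfl A B C hA hB hC h
    rw [eq_of_heq hA, eq_of_heq hB, eq_of_heq hC] at h
    simpa using h
  have aux' : ∀ F : G → G, F = id → HEq (selfBracket 𝓘(ℝ, E) π.tensor F 1) (π.tensor 1) := by
    rintro F rfl
    exact heq_of_eq (selfBracket_id π.tensor 1)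
  have hm : MDifferentiableAt (𝓘(ℝ, E).prod 𝓘(ℝ, E)) 𝓘(ℝ, E) (fun p : G × G => p.1 * p.2)
      ((1 : G), (1 : G)) :=
    (contMDiff_mul 𝓘(ℝ, E) ∞).mdifferentiable (by simp) _
  have h1 := selfBracket_comp (I'' := 𝓘(ℝ, E)) π.tensor (F := fun x : G => (x, (1 : G))) (x := 1)
    hm (mdifferentiableAt_id.prodMk mdifferentiableAt_const)
  have h2 := selfBracket_comp (I'' := 𝓘(ℝ, E)) π.tensor (F := fun x : G => ((1 : G), x)) (x := 1)
    hm (mdifferentiableAt_const.prodMk mdifferentiableAt_id)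
  have h := hπ ((1 : G), (1 : G))
  unfold prodTensorField at h
  rw [selfBracket, map_add] at h
  refine aux (1 * 1) (one_mul 1) _ _ _ ?_ ?_ ?_ h
  · exact (heq_of_eq h1).trans (aux' _ (by ext x; simp))
  · exact (heq_of_eq h2).trans (aux' _ (by ext x; simp))
  · have : ∀ y : G, y = 1 → HEq (π.tensor y) (π.tensor 1) := by rintro y rfl; rfl
    exact this (1 * 1) (one_mul 1)

/-- The differential at the identity of a finite combination of functions `c i` vanishing there,
with differentiable coefficients. -/
theorem differential_sum_mul {ι : Type*} [Fintype ι] {a c : ι → G → ℝ} {F : G → ℝ}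
    (ha : ∀ i, MDifferentiableAt 𝓘(ℝ, E) 𝓘(ℝ, ℝ) (a i) (1 : G))
    (hc : ∀ i, MDifferentiableAt 𝓘(ℝ, E) 𝓘(ℝ, ℝ) (c i) (1 : G)) (hc0 : ∀ i, c i 1 = 0)
    (hF : ∀ᶠ x in nhds (1 : G), F x = ∑ i, a i x * c i x) :
    differential 𝓘(ℝ, E) F (1 : G) = ∑ i, a i 1 • differential 𝓘(ℝ, E) (c i) (1 : G) := by
  have hm : ∀ i, MDifferentiableAt 𝓘(ℝ, E) 𝓘(ℝ, ℝ) (a i * c i) (1 : G) := fun i =>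
    ((ha i).hasMFDerivAt.mul (hc i).hasMFDerivAt).mdifferentiableAt
  have hd : ∀ i, differential 𝓘(ℝ, E) (a i * c i) (1 : G) =
      a i 1 • differential 𝓘(ℝ, E) (c i) (1 : G) := by
    intro i
    ext v
    change mfderiv 𝓘(ℝ, E) 𝓘(ℝ, ℝ) (a i * c i) 1 v = _
    rw [((ha i).hasMFDerivAt.mul (hc i).hasMFDerivAt).mfderiv, hc0 i]
    change a i 1 * differential 𝓘(ℝ, E) (c i) 1 v + 0 * differential 𝓘(ℝ, E) (a i) 1 v = _
    rw [zero_mul, add_zero]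
    rfl
  have hs : ∀ s : Finset ι, MDifferentiableAt 𝓘(ℝ, E) 𝓘(ℝ, ℝ) (∑ i ∈ s, a i * c i) (1 : G) ∧
      differential 𝓘(ℝ, E) (∑ i ∈ s, a i * c i) (1 : G) =
        ∑ i ∈ s, a i 1 • differential 𝓘(ℝ, E) (c i) (1 : G) := by
    classical
    intro s
    induction s using Finset.induction_on with
    | empty =>
      have h0 : HasMFDerivAt 𝓘(ℝ, E) 𝓘(ℝ, ℝ) (0 : G → ℝ) (1 : G) 0 := hasMFDerivAt_const 0 1
      refine ⟨by simpa using h0.mdifferentiableAt, ?_⟩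
      ext v
      rw [Finset.sum_empty, Finset.sum_empty]
      change mfderiv 𝓘(ℝ, E) 𝓘(ℝ, ℝ) (0 : G → ℝ) 1 v = 0
      rw [h0.mfderiv]
      rfl
    | insert i s hi ih =>
      rw [Finset.sum_insert hi, Finset.sum_insert hi]
      refine ⟨(hm i).add ih.1, ?_⟩
      rw [differential_add (hm i) ih.1, hd, ih.2]
  have h2 : F =ᶠ[nhds 1] ∑ i, a i * c i := by
    filter_upwards [hF] with x hx
    rw [hx]
    simp
  rw [← (hs Finset.univ).2]
  ext v
  change mfderiv 𝓘(ℝ, E) 𝓘(ℝ, ℝ) F 1 v =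
    mfderiv 𝓘(ℝ, E) 𝓘(ℝ, ℝ) (∑ i, a i * c i : G → ℝ) 1 v
  rw [h2.mfderiv_eq]
  rfl

end LieGroups

/-! ### The Lie bracket on the dual of the Lie algebra -/

section DualBracket

variable {E : Type*} [NormedAddCommGroup E] [NormedSpace ℝ E] [FiniteDimensional ℝ E]
  {G : Type*} [TopologicalSpace G] [ChartedSpace E G] [Group G]

/-- A smooth function on `G` with differential `α` at the identity: the linear form `α` in the
preferred chart, multiplied by a bump function (see `differential_extend`). -/
def extend (α : Module.Dual ℝ (LieAlg E G)) (g : G) : ℝ :=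
  (Classical.arbitrary (SmoothBumpFunction 𝓘(ℝ, E) (1 : G))) g •
    α (extChartAt 𝓘(ℝ, E) (1 : G) g)

theorem contMDiff_extend [T2Space G] [IsManifold 𝓘(ℝ, E) ∞ G] (α : Module.Dual ℝ (LieAlg E G)) :
    ContMDiff 𝓘(ℝ, E) 𝓘(ℝ, ℝ) ∞ (extend α) := by
  refine SmoothBumpFunction.contMDiff_smul _ ?_
  let β : E →ₗ[ℝ] ℝ := α
  have h1 : ContMDiff 𝓘(ℝ, E) 𝓘(ℝ, ℝ) ∞ β := (LinearMap.toContinuousLinearMap β).contMDiff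
  exact h1.comp_contMDiffOn contMDiffOn_extChartAt

theorem eventuallyEq_extend (α : Module.Dual ℝ (LieAlg E G)) :
    ∀ᶠ y in nhds (1 : G), extend α y = α (extChartAt 𝓘(ℝ, E) (1 : G) y) := by
  filter_upwards [(Classical.arbitrary (SmoothBumpFunction 𝓘(ℝ, E) (1 : G))).eventuallyEq_one]
    with y hy
  simp only [extend, hy, Pi.one_apply, one_smul]

theorem differential_extend_apply [IsManifold 𝓘(ℝ, E) ∞ G] (α : Module.Dual ℝ (LieAlg E G)) :
    ∀ᶠ x in nhds (1 : G), ∀ v : TangentSpace 𝓘(ℝ, E) x,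
      differential 𝓘(ℝ, E) (extend α) x v =
        α (mfderiv 𝓘(ℝ, E) 𝓘(ℝ, E) (extChartAt 𝓘(ℝ, E) (1 : G)) x v) := by
  have hsrc : ∀ᶠ x in nhds (1 : G), x ∈ (chartAt E (1 : G)).source :=
    (chartAt E (1 : G)).open_source.mem_nhds (mem_chart_source E (1 : G))
  filter_upwards [(eventuallyEq_extend α).eventually_nhds, hsrc] with x hx hxs v
  let β : E →ₗ[ℝ] ℝ := α
  let γ : E →L[ℝ] ℝ := LinearMap.toContinuousLinearMap β
  have h1 : extend α =ᶠ[nhds x] γ ∘ extChartAt 𝓘(ℝ, E) (1 : G) := hx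
  have h2 : HasMFDerivAt 𝓘(ℝ, E) 𝓘(ℝ, E) (extChartAt 𝓘(ℝ, E) (1 : G)) x
      (mfderiv 𝓘(ℝ, E) 𝓘(ℝ, E) (extChartAt 𝓘(ℝ, E) (1 : G)) x) :=
    (mdifferentiableAt_extChartAt hxs).hasMFDerivAt
  have h3 : HasMFDerivAt 𝓘(ℝ, E) 𝓘(ℝ, ℝ) γ (extChartAt 𝓘(ℝ, E) (1 : G) x) γ :=
    γ.hasMFDerivAt
  have h4 := (h3.comp x h2).congr_of_eventuallyEq h1
  change mfderiv 𝓘(ℝ, E) 𝓘(ℝ, ℝ) (extend α) x v = _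
  rw [h4.mfderiv]
  rfl

theorem differential_extend [IsManifold 𝓘(ℝ, E) ∞ G] (α : Module.Dual ℝ (LieAlg E G)) :
    differential 𝓘(ℝ, E) (extend α) (1 : G) = α := by
  ext v
  rw [(differential_extend_apply α).self_of_nhds v, mfderiv_extChartAt_self]
  rfl

theorem extend_add (α β : Module.Dual ℝ (LieAlg E G)) :
    extend (α + β) = extend α + extend β := by
  ext g
  simp only [extend, Pi.add_apply, ← smul_add]
  rfl

theorem extend_smul (c : ℝ) (α : Module.Dual ℝ (LieAlg E G)) :
    extend (c • α) = c • extend α := by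
  ext g
  simp only [extend, Pi.smul_apply]
  rw [smul_comm c]
  rfl

/-- Near the identity, the differential of a smooth function is a combination, with differentiable
coefficients, of the differentials of the coordinate functions. -/
theorem exists_differential_eq_sum [IsManifold 𝓘(ℝ, E) ∞ G] {f : G → ℝ} (hf : ContMDiff 𝓘(ℝ, E) 𝓘(ℝ, ℝ) ∞ f)
    {ι : Type*} [Fintype ι] (b : Module.Basis ι ℝ (LieAlg E G)) :
    ∃ a : ι → G → ℝ, (∀ i, MDifferentiableAt 𝓘(ℝ, E) 𝓘(ℝ, ℝ) (a i) (1 : G)) ∧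
      ∀ᶠ x in nhds (1 : G), differential 𝓘(ℝ, E) f x =
        ∑ i, a i x • differential 𝓘(ℝ, E) (extend (b.coord i)) x := by
  let φ := extChartAt 𝓘(ℝ, E) (1 : G)
  let F : E → ℝ := f ∘ φ.symm
  have hsrc : ∀ᶠ x in nhds (1 : G), x ∈ (chartAt E (1 : G)).source :=
    (chartAt E (1 : G)).open_source.mem_nhds (mem_chart_source E (1 : G))
  have hF : ContDiffOn ℝ ∞ F φ.target :=
    (hf.comp_contMDiffOn (contMDiffOn_extChartAt_symm (1 : G))).contDiffOn
  have htgt : IsOpen φ.target := isOpen_extChartAt_target (1 : G)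
  have hF' : DifferentiableOn ℝ (fderiv ℝ F) φ.target :=
    (hF.fderiv_of_isOpen (m := 1) htgt (by
      simpa [one_add_one_eq_two] using (ENat.LEInfty.out : (2 : ℕ∞ω) ≤ ∞))).differentiableOn (by simp)
  refine ⟨fun i x => fderiv ℝ F (φ x) (b i : E), fun i => ?_, ?_⟩
  · have h1 : DifferentiableAt ℝ (fun y => fderiv ℝ F y (b i : E)) (φ 1) :=
      ((hF' _ (mem_extChartAt_target (1 : G))).differentiableAt
        (htgt.mem_nhds (mem_extChartAt_target (1 : G)))).clm_apply (differentiableAt_const _)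
    exact h1.mdifferentiableAt.comp (1 : G) (mdifferentiableAt_extChartAt (mem_chart_source E _))
  · have hall : ∀ᶠ x in nhds (1 : G), ∀ i, ∀ v : TangentSpace 𝓘(ℝ, E) x,
        differential 𝓘(ℝ, E) (extend (b.coord i)) x v =
          b.coord i (mfderiv 𝓘(ℝ, E) 𝓘(ℝ, E) φ x v) :=
      Filter.eventually_all.2 fun i => differential_extend_apply (b.coord i)
    filter_upwards [hsrc, hall] with x hx hxa
    ext v
    have hxφ : x ∈ φ.source := by rwa [extChartAt_source]
    have h1 : f =ᶠ[nhds x] F ∘ φ := by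
      filter_upwards [(isOpen_extChartAt_source (1 : G)).mem_nhds hxφ] with y hy
      simp only [F, Function.comp_apply, φ.left_inv hy]
    have h2 : HasMFDerivAt 𝓘(ℝ, E) 𝓘(ℝ, E) φ x (mfderiv 𝓘(ℝ, E) 𝓘(ℝ, E) φ x) :=
      (mdifferentiableAt_extChartAt hx).hasMFDerivAt
    have h3 : DifferentiableAt ℝ F (φ x) :=
      (hF.differentiableOn (by simp)).differentiableAt (htgt.mem_nhds (φ.map_source hxφ))
    have h4 := (h3.hasFDerivAt.hasMFDerivAt.comp x h2).congr_of_eventuallyEq h1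
    have h5 : differential 𝓘(ℝ, E) f x v =
        fderiv ℝ F (φ x) (mfderiv 𝓘(ℝ, E) 𝓘(ℝ, E) φ x v) := by
      change mfderiv 𝓘(ℝ, E) 𝓘(ℝ, ℝ) f x v = _
      rw [h4.mfderiv]
      rfl
    rw [h5, LinearMap.sum_apply]
    simp only [LinearMap.smul_apply, hxa, smul_eq_mul]
    let b' : Module.Basis ι ℝ E := b
    let w : E := mfderiv 𝓘(ℝ, E) 𝓘(ℝ, E) φ x v
    change fderiv ℝ F (φ x) w = ∑ i, fderiv ℝ F (φ x) (b' i) * b'.coord i w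
    conv_lhs => rw [← b'.sum_repr w, map_sum]
    simp [mul_comm]

variable [T2Space G] [LieGroup 𝓘(ℝ, E) ∞ G]

theorem mdifferentiableAt_extend (α : Module.Dual ℝ (LieAlg E G)) (x : G) :
    MDifferentiableAt 𝓘(ℝ, E) 𝓘(ℝ, ℝ) (extend α) x :=
  (contMDiff_extend α).mdifferentiable (by simp) x

theorem mdifferentiableAt_bracket_extend (π : PoissonStructure E G)
    (α β : Module.Dual ℝ (LieAlg E G)) (x : G) :
    MDifferentiableAt 𝓘(ℝ, E) 𝓘(ℝ, ℝ) (bracket π.tensor (extend α) (extend β)) x :=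
  (π.smooth _ _ (contMDiff_extend α) (contMDiff_extend β)).mdifferentiable (by simp) x

theorem bracket_extend_add (π : PoissonStructure E G) (α α' β : Module.Dual ℝ (LieAlg E G)) :
    bracket π.tensor (extend (α + α')) (extend β) =
      bracket π.tensor (extend α) (extend β) + bracket π.tensor (extend α') (extend β) := by
  ext x
  simp only [bracket, Pi.add_apply]
  rw [extend_add, differential_add (mdifferentiableAt_extend α x) (mdifferentiableAt_extend α' x),
    contract_add_left]

theorem bracket_extend_smul (π : PoissonStructure E G) (c : ℝ)
    (α β : Module.Dual ℝ (LieAlg E G)) :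
    bracket π.tensor (extend (c • α)) (extend β) =
      c • bracket π.tensor (extend α) (extend β) := by
  ext x
  simp only [bracket, Pi.smul_apply]
  rw [extend_smul, differential_smul c (mdifferentiableAt_extend α x), contract_smul_left]
  rfl

/-- The linearisation at the identity of the Poisson bracket of `G`: the bracket on the dual of the
Lie algebra given by `[d_e f, d_e g]_* = d_e {f, g}`. The functions `f` and `g` are picked by
`extend`; when `G` is a Poisson-Lie group their choice does not matter
(see `dualBracket_differential`). -/
def dualBracket (π : PoissonStructure E G) :
    Module.Dual ℝ (LieAlg E G) →ₗ[ℝ] Module.Dual ℝ (LieAlg E G) →ₗ[ℝ]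
      Module.Dual ℝ (LieAlg E G) :=
  LinearMap.mk₂ ℝ
    (fun α β => differential 𝓘(ℝ, E) (bracket π.tensor (extend α) (extend β)) (1 : G))
    (fun α α' β => by
      rw [bracket_extend_add, differential_add (mdifferentiableAt_bracket_extend π _ _ _)
        (mdifferentiableAt_bracket_extend π _ _ _)])
    (fun c α β => by
      rw [bracket_extend_smul, differential_smul c (mdifferentiableAt_bracket_extend π _ _ _)])
    (fun α β β' => by
      have h := bracket_extend_add π β β' α
      rw [π.bracket_skew, π.bracket_skew (extend β), π.bracket_skew (extend β'), ← neg_add,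
        neg_inj] at h
      rw [h, differential_add (mdifferentiableAt_bracket_extend π _ _ _)
        (mdifferentiableAt_bracket_extend π _ _ _)])
    (fun c α β => by
      have h := bracket_extend_smul π c β α
      rw [π.bracket_skew, π.bracket_skew (extend β), smul_neg, neg_inj] at h
      rw [h, differential_smul c (mdifferentiableAt_bracket_extend π _ _ _)])

theorem dualBracket_skew (π : PoissonStructure E G) (α β : Module.Dual ℝ (LieAlg E G)) :
    dualBracket π α β = -dualBracket π β α := by
  have h := differential_smul (-1) (mdifferentiableAt_bracket_extend π β α 1)
  rw [neg_one_smul, ← π.bracket_skew] at h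
  ext v
  have h' := LinearMap.congr_fun h v
  simp only [LinearMap.smul_apply, neg_one_smul] at h'
  exact h'

/-- The defining property of the bracket on the dual of the Lie algebra of a Poisson-Lie group:
`[d_e f, d_e g]_* = d_e {f, g}` for all smooth functions `f` and `g`. -/
theorem dualBracket_differential {π : PoissonStructure E G} (hπ : IsPoissonLie π) {f g : G → ℝ}
    (hf : ContMDiff 𝓘(ℝ, E) 𝓘(ℝ, ℝ) ∞ f) (hg : ContMDiff 𝓘(ℝ, E) 𝓘(ℝ, ℝ) ∞ g) :
    dualBracket π (differential 𝓘(ℝ, E) f (1 : G)) (differential 𝓘(ℝ, E) g (1 : G)) =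
      differential 𝓘(ℝ, E) (bracket π.tensor f g) (1 : G) := by
  have key : ∀ f f' g : G → ℝ, ContMDiff 𝓘(ℝ, E) 𝓘(ℝ, ℝ) ∞ f →
      ContMDiff 𝓘(ℝ, E) 𝓘(ℝ, ℝ) ∞ f' → ContMDiff 𝓘(ℝ, E) 𝓘(ℝ, ℝ) ∞ g →
      differential 𝓘(ℝ, E) f (1 : G) = differential 𝓘(ℝ, E) f' 1 →
      differential 𝓘(ℝ, E) (bracket π.tensor f g) (1 : G) =
        differential 𝓘(ℝ, E) (bracket π.tensor f' g) 1 := by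
    intro f f' g hf hf' hg hff'
    let b := Module.finBasis ℝ (LieAlg E G)
    have main : ∀ f : G → ℝ, ContMDiff 𝓘(ℝ, E) 𝓘(ℝ, ℝ) ∞ f →
        differential 𝓘(ℝ, E) (bracket π.tensor f g) (1 : G) =
          ∑ i, differential 𝓘(ℝ, E) f (1 : G) (b i) •
            differential 𝓘(ℝ, E) (bracket π.tensor (extend (b.coord i)) g) (1 : G) := by
      intro f hf
      obtain ⟨a, ha, haf⟩ := exists_differential_eq_sum hf b
      have h1 : ∀ᶠ x in nhds (1 : G), bracket π.tensor f g x =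
          ∑ i, a i x * bracket π.tensor (extend (b.coord i)) g x := by
        filter_upwards [haf] with x hx
        simp only [bracket, hx]
        have hsum : ∀ s : Finset (Fin (Module.finrank ℝ (LieAlg E G))),
            contract (∑ i ∈ s, a i x • differential 𝓘(ℝ, E) (extend (b.coord i)) x)
              (differential 𝓘(ℝ, E) g x) (π.tensor x) =
            ∑ i ∈ s, a i x * contract (differential 𝓘(ℝ, E) (extend (b.coord i)) x)
              (differential 𝓘(ℝ, E) g x) (π.tensor x) := by
          intro s
          induction s using Finset.induction_on with
          | empty => simp [contract]
          | insert i s hi ih =>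
            rw [Finset.sum_insert hi, Finset.sum_insert hi, contract_add_left, ih,
              contract_smul_left]
        exact hsum Finset.univ
      rw [differential_sum_mul ha (fun i => (π.smooth _ _ (contMDiff_extend (b.coord i))
        hg).mdifferentiable (by simp) 1) (fun i => by simp [bracket, contract, hπ.tensor_one]) h1]
      refine Finset.sum_congr rfl fun i _ => ?_
      congr 1
      have h2 := LinearMap.congr_fun haf.self_of_nhds (b i)
      rw [h2, LinearMap.sum_apply, Finset.sum_eq_single i]
      · simp [differential_extend]
      · intro j _ hj
        simp [differential_extend, hj.symm]
      · simp
    rw [main f hf, main f' hf', hff']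
  have hf' := contMDiff_extend (differential 𝓘(ℝ, E) f (1 : G))
  have hg' := contMDiff_extend (differential 𝓘(ℝ, E) g (1 : G))
  have h1 := key f _ g hf hf' hg (differential_extend _).symm
  have h2 := key g _ _ hg hg' hf' (differential_extend _).symm
  rw [h1]
  have neg : ∀ f g : G → ℝ, ContMDiff 𝓘(ℝ, E) 𝓘(ℝ, ℝ) ∞ f → ContMDiff 𝓘(ℝ, E) 𝓘(ℝ, ℝ) ∞ g →
      differential 𝓘(ℝ, E) (bracket π.tensor f g) (1 : G) =
        (-1 : ℝ) • differential 𝓘(ℝ, E) (bracket π.tensor g f) (1 : G) := by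
    intro f g hf hg
    rw [← differential_smul (-1 : ℝ) ((π.smooth g f hg hf).mdifferentiable (by simp) 1),
      π.bracket_skew f g, neg_one_smul]
  rw [neg _ _ hf' hg, h2, ← neg _ _ hf' hg']
  rfl

end DualBracket

/-! ### The Drinfel'd double -/

section Double

variable {E : Type*} [NormedAddCommGroup E] [NormedSpace ℝ E] [FiniteDimensional ℝ E]
  {G : Type*} [TopologicalSpace G] [ChartedSpace E G] [Group G] [T2Space G]
  [LieGroup 𝓘(ℝ, E) ∞ G]

variable (E G) in
/-- The vector space `𝔤 ⊕ 𝔤*` underlying the Drinfel'd double. -/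
abbrev Double : Type _ := LieAlg E G × Module.Dual ℝ (LieAlg E G)

/-- The pairing `⟨(X, lam) | (Y, mu)⟩ = mu X + lam Y`. -/
def pairing (u v : Double E G) : ℝ := v.2 u.1 + u.2 v.1

/-- The coadjoint action of `𝔤*` on `𝔤`: the element of `𝔤` on which a linear form `nu` takes the
value `[lam, nu]_* X`. -/
def dualCoad (π : PoissonStructure E G) (lam : Module.Dual ℝ (LieAlg E G)) (X : LieAlg E G) :
    LieAlg E G :=
  (Module.evalEquiv ℝ (LieAlg E G)).symm ((dualBracket π lam).flip X)

/-- The Lie bracket of the Drinfel'd double `𝔤 ⊕ 𝔤*`: the only one for which `𝔤` and `𝔤*` (with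
the bracket `dualBracket`) are subalgebras and `pairing` is invariant; see the next lemmas. -/
def doubleBracket (π : PoissonStructure E G) (u v : Double E G) : Double E G :=
  (⁅u.1, v.1⁆ + dualCoad π v.2 u.1 - dualCoad π u.2 v.1,
    dualBracket π u.2 v.2 - v.2 ∘ₗ LieAlgebra.ad ℝ (LieAlg E G) u.1 +
      u.2 ∘ₗ LieAlgebra.ad ℝ (LieAlg E G) v.1)

theorem apply_dualCoad (π : PoissonStructure E G) (lam nu : Module.Dual ℝ (LieAlg E G))
    (X : LieAlg E G) : nu (dualCoad π lam X) = dualBracket π lam nu X := by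
  rw [dualCoad, Module.apply_evalEquiv_symm_apply]
  rfl

theorem doubleBracket_inl (π : PoissonStructure E G) (X Y : LieAlg E G) :
    doubleBracket π (X, 0) (Y, 0) = (⁅X, Y⁆, 0) := by
  have h : ∀ Z : LieAlg E G, dualCoad π 0 Z = 0 := fun Z => by
    refine (Module.forall_dual_apply_eq_zero_iff ℝ _).1 fun nu => ?_
    rw [apply_dualCoad]
    simp
  simp [doubleBracket, h]

theorem doubleBracket_inr (π : PoissonStructure E G) (lam mu : Module.Dual ℝ (LieAlg E G)) :
    doubleBracket π (0, lam) (0, mu) = (0, dualBracket π lam mu) := by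
  have h : ∀ nu, dualCoad π nu 0 = 0 := fun nu => by
    refine (Module.forall_dual_apply_eq_zero_iff ℝ _).1 fun nu' => ?_
    rw [apply_dualCoad]
    simp
  simp [doubleBracket, h]

theorem pairing_doubleBracket (π : PoissonStructure E G) (u v w : Double E G) :
    pairing (doubleBracket π u v) w = pairing u (doubleBracket π v w) := by
  have h1 : ∀ X Y : LieAlg E G, ∀ lam : Module.Dual ℝ (LieAlg E G), lam ⁅X, Y⁆ = -lam ⁅Y, X⁆ := by
    intro X Y lam
    rw [← lie_skew, map_neg]
  have h2 : ∀ lam mu : Module.Dual ℝ (LieAlg E G), ∀ X : LieAlg E G,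
      dualBracket π lam mu X = -dualBracket π mu lam X := by
    intro lam mu X
    rw [dualBracket_skew]
    rfl
  simp only [pairing, doubleBracket, LinearMap.add_apply, LinearMap.sub_apply,
    LinearMap.comp_apply, LieAlgebra.ad_apply, map_add, map_sub, apply_dualCoad]
  linarith [h1 v.1 u.1 w.2, h1 w.1 u.1 v.2, h2 w.2 u.2 v.1, h2 v.2 u.2 w.1]

theorem doubleBracket_unique (π : PoissonStructure E G)
    (B : Double E G →ₗ[ℝ] Double E G →ₗ[ℝ] Double E G)
    (hB₁ : ∀ X Y : LieAlg E G, B (X, 0) (Y, 0) = (⁅X, Y⁆, 0))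
    (hB₂ : ∀ lam mu : Module.Dual ℝ (LieAlg E G), B (0, lam) (0, mu) = (0, dualBracket π lam mu))
    (hB : ∀ u v w, pairing (B u v) w = pairing u (B v w)) (u v : Double E G) :
    B u v = doubleBracket π u v := by
  have hsymm : ∀ u v : Double E G, pairing u v = pairing v u := fun u v => add_comm _ _
  have hadd : ∀ u v w : Double E G, pairing (u + v) w = pairing u w + pairing v w := by
    intro u v w
    simp only [pairing, Prod.fst_add, Prod.snd_add, map_add, LinearMap.add_apply]
    ring
  have hcyc : ∀ u v w, pairing (B u v) w = pairing (B v w) u := fun u v w => by rw [hB, hsymm]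
  have hnd : ∀ u v : Double E G, (∀ w, pairing u w = pairing v w) → u = v := by
    intro u v h
    refine Prod.ext ?_ ?_
    · refine sub_eq_zero.1 ((Module.forall_dual_apply_eq_zero_iff ℝ _).1 fun nu => ?_)
      have := h (0, nu)
      simp only [pairing, map_zero, add_zero] at this
      rw [map_sub, this, sub_self]
    · ext Z
      simpa [pairing] using h (Z, 0)
  refine hnd _ _ fun w => ?_
  have hsplit : ∀ p : Double E G, p = (p.1, 0) + (0, p.2) := fun p => by simp
  have hL : ∀ a b c : Double E G, pairing (B a b) c =
      pairing (B (a.1, 0) (b.1, 0)) c + pairing (B (0, a.2) (0, b.2)) c +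
      pairing (B (a.1, 0) (0, b.2)) c + pairing (B (0, a.2) (b.1, 0)) c := by
    intro a b c
    conv_lhs => rw [hsplit a, hsplit b]
    simp only [map_add, LinearMap.add_apply, hadd]
    ring
  have hR : ∀ a b c : Double E G, pairing (B a b) c =
      pairing (B a b) (c.1, 0) + pairing (B a b) (0, c.2) := by
    intro a b c
    rw [hsymm, hsymm _ (c.1, 0), hsymm _ (0, c.2), ← hadd, ← hsplit]
  rw [hL, hR (u.1, 0) (0, v.2), hR (0, u.2) (v.1, 0), hcyc (u.1, 0) (0, v.2) (0, w.2),
    ← hcyc (w.1, 0) (u.1, 0) (0, v.2), hcyc (0, u.2) (v.1, 0) (w.1, 0),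
    ← hcyc (0, w.2) (0, u.2) (v.1, 0)]
  simp only [hB₁, hB₂, pairing, doubleBracket, LinearMap.add_apply, LinearMap.sub_apply,
    LinearMap.comp_apply, LieAlgebra.ad_apply, map_add, map_sub, apply_dualCoad, map_zero,
    LinearMap.zero_apply, add_zero, zero_add]
  have h1 : v.2 ⁅w.1, u.1⁆ = -v.2 ⁅u.1, w.1⁆ := by rw [← lie_skew, map_neg]
  have h2 : dualBracket π w.2 u.2 v.1 = -dualBracket π u.2 w.2 v.1 := by
    rw [dualBracket_skew]
    rfl
  rw [h1, h2]
  ring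

/-- The tensor `∑ₐ (ι(Tᵃ) ⊗ ι*(Tₐ) - ι*(Tₐ) ⊗ ι(Tᵃ))`, for a basis `Tᵃ` of `𝔤` with dual basis
`Tₐ`. -/
def canonicalR {κ : Type*} [Fintype κ] (b : Module.Basis κ ℝ (LieAlg E G)) :
    Double E G ⊗[ℝ] Double E G :=
  ∑ a, (((b a, 0) : Double E G) ⊗ₜ[ℝ] ((0, b.coord a) : Double E G) -
    ((0, b.coord a) : Double E G) ⊗ₜ[ℝ] ((b a, 0) : Double E G))

end Double

/-! ### The non-abelian moment map -/

section MomentMap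

variable {E : Type*} [NormedAddCommGroup E] [NormedSpace ℝ E] [FiniteDimensional ℝ E]
  {G : Type*} [TopologicalSpace G] [ChartedSpace E G] [Group G] [T2Space G]
  [LieGroup 𝓘(ℝ, E) ∞ G]
  {Es : Type*} [NormedAddCommGroup Es] [NormedSpace ℝ Es]
  {Gs : Type*} [TopologicalSpace Gs] [ChartedSpace Es Gs] [Group Gs]
  {Ed : Type*} [NormedAddCommGroup Ed] [NormedSpace ℝ Ed]
  {DG : Type*} [TopologicalSpace DG] [ChartedSpace Ed DG] [Group DG]
  {F : Type*} [NormedAddCommGroup F] [NormedSpace ℝ F]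
  {M : Type*} [TopologicalSpace M] [ChartedSpace F M]

/-- `θ` identifies `𝔤*`, with the bracket `dualBracket`, with the Lie algebra of `Gs`. -/
def IsDualIdentification (π : PoissonStructure E G)
    (θ : Module.Dual ℝ (LieAlg E G) ≃ₗ[ℝ] LieAlg Es Gs) : Prop :=
  ∀ lam mu, θ (dualBracket π lam mu) = ⁅θ lam, θ mu⁆

/-- `Θ` identifies the Drinfel'd double of `𝔤` with the Lie algebra of `DG`. -/
def IsDoubleIdentification (π : PoissonStructure E G) (Θ : Double E G ≃ₗ[ℝ] LieAlg Ed DG) : Prop :=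
  ∀ u v, Θ (doubleBracket π u v) = ⁅Θ u, Θ v⁆

/-- The smooth group homomorphism `j : Gs → DG` is the lift of the embedding
`ι* : 𝔤* → 𝔤 ⊕ 𝔤*`. -/
def IsLift (θ : Module.Dual ℝ (LieAlg E G) ≃ₗ[ℝ] LieAlg Es Gs)
    (Θ : Double E G ≃ₗ[ℝ] LieAlg Ed DG) (j : Gs →* DG) : Prop :=
  ContMDiff 𝓘(ℝ, Es) 𝓘(ℝ, Ed) ∞ j ∧
    ∀ lam : Module.Dual ℝ (LieAlg E G),
      (mfderiv 𝓘(ℝ, Es) 𝓘(ℝ, Ed) j (1 : Gs) (θ lam) : Ed) = Θ (0, lam)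

/-- The transformation `δ_ε f = -⟨ε, Γ⁻¹ {Γ, f}⟩` of functions on `M`. (If `Γ` and `f` are smooth
then so is `δ_ε f`.) -/
def momentAction (P : PoissonStructure F M)
    (θ : Module.Dual ℝ (LieAlg E G) ≃ₗ[ℝ] LieAlg Es Gs) (Γ : M → Gs) (ε : LieAlg E G)
    (f : M → ℝ) : M → ℝ :=
  fun x => -(θ.symm (leftTrivialize (Γ x) (mapBracket 𝓘(ℝ, Es) P.tensor Γ f x))) ε

/-- `ε ↦ δ_ε` is a Lie algebra action: `[δ_ε, δ_ε'] f = δ_[ε, ε'] f` for every smooth `f`. -/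
def IsLieAction (δ : LieAlg E G → (M → ℝ) → (M → ℝ)) : Prop :=
  ∀ ε ε' : LieAlg E G, ∀ f : M → ℝ, ContMDiff 𝓘(ℝ, F) 𝓘(ℝ, ℝ) ∞ f →
    δ ε (δ ε' f) - δ ε' (δ ε f) = δ ⁅ε, ε'⁆ f

/-- The coefficient `⟨X ⊗ Y, n⟩` of `n ∈ 𝔤* ⊗ 𝔤*`. -/
def coeff (X Y : LieAlg E G)
    (n : Module.Dual ℝ (LieAlg E G) ⊗[ℝ] Module.Dual ℝ (LieAlg E G)) : ℝ :=
  contract (Module.Dual.eval ℝ (LieAlg E G) X) (Module.Dual.eval ℝ (LieAlg E G) Y) n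

/-- `N` is a smooth function on `M` with values in skew-symmetric elements of `𝔤* ⊗ 𝔤*`, and it is
central: its coefficients have zero bracket with every smooth function. -/
structure IsCentralTensor (P : PoissonStructure F M)
    (N : M → Module.Dual ℝ (LieAlg E G) ⊗[ℝ] Module.Dual ℝ (LieAlg E G)) : Prop where
  skew : ∀ x, TensorProduct.comm ℝ _ _ (N x) = -N x
  smooth : ∀ X Y : LieAlg E G, ContMDiff 𝓘(ℝ, F) 𝓘(ℝ, ℝ) ∞ fun x => coeff X Y (N x)
  central : ∀ X Y : LieAlg E G, ∀ f : M → ℝ, ContMDiff 𝓘(ℝ, F) 𝓘(ℝ, ℝ) ∞ f →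
    bracket P.tensor (fun x => coeff X Y (N x)) f = 0

/-- The element `ι* ⊗ ι*` of the double, seen in the Lie algebra of `DG`, of an element of
`𝔤* ⊗ 𝔤*`. -/
def dualTensor (Θ : Double E G ≃ₗ[ℝ] LieAlg Ed DG)
    (n : Module.Dual ℝ (LieAlg E G) ⊗[ℝ] Module.Dual ℝ (LieAlg E G)) :
    LieAlg Ed DG ⊗[ℝ] LieAlg Ed DG :=
  tensorSq (Θ.toLinearMap ∘ₗ LinearMap.inr ℝ (LieAlg E G) (Module.Dual ℝ (LieAlg E G))) n

/-- For `Λ : M → DG`, the relation `{Λ₁, Λ₂} = -1/2 [R₁₂, Λ₁ Λ₂] + N₁₂ Λ₁ Λ₂`, in the tensor square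
of the tangent space of `DG` at `Λ x`, for every `x`. Here `R₁₂ Λ₁ Λ₂` and `Λ₁ Λ₂ R₁₂` are the
images of `R` under the right and left translations by `Λ x`. -/
def SatisfiesBracket (P : PoissonStructure F M) (R : LieAlg Ed DG ⊗[ℝ] LieAlg Ed DG)
    (N : M → LieAlg Ed DG ⊗[ℝ] LieAlg Ed DG) (Λ : M → DG) : Prop :=
  ∀ x, selfBracket 𝓘(ℝ, Ed) P.tensor Λ x =
    -(1 / 2 : ℝ) • (tensorSq (rightTranslate (Λ x)) R - tensorSq (leftTranslate (Λ x)) R) +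
      tensorSq (rightTranslate (Λ x)) (N x)

end MomentMap

end PoissonLie

end

/-!
The bracket relation for `N` is equivalent to a formula for `N`, and the centrality of that `N` is
equivalent to the vanishing of the curvature `[δ_ε, δ_ε'] - δ_[ε, ε']`.

Write `T = Γ⁻¹ {Γ₁, Γ₂} ∈ 𝔤* ⊗ 𝔤*` for the bracket of `Γ` with itself, translated on the left to
the identity (`logBivector`). Translating the relation on the right to the identity of the double
group gives `Ad_Γ T = m(Γ) + N`, where `m(C) = ½ (Ad_C R - R)` (`satisfiesBracket_iff`). This
makes sense in `𝔤* ⊗ 𝔤*`: the adjoint action of the dual group preserves the pairing of the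
double, because it does so infinitesimally and the dual group is connected (`pairing_doubleAd`);
it also preserves `𝔤*`, and it follows that `m(C)` lies in `𝔤* ⊗ 𝔤*` (`twist`,
`tensorSq_inr_twist`). Hence the only possible `N` is `Ad_Γ T - m(Γ)` (`bracketDefect`), which is
always skew-symmetric and smooth.

It remains to differentiate `Ad_Γ T - m(Γ)` along the Hamiltonian vector field of a function `f`.
Let `ξ = Γ⁻¹ {Γ, f}`. The derivative of `T` is obtained from the Jacobi identity for `φ ∘ Γ`,
`ψ ∘ Γ` and `f`, where `φ` and `ψ` are functions on the dual group with prescribed left invariant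
derivatives at one point. The terms that it contains besides the commutator of the `δ_ε` are
cancelled by the derivative of `Ad_Γ` (`commutator_logBracket`). The derivative of `m` is
`½ Ad_Γ (ad_ξ R)`, and `ad_ξ R` is, up to the factor `-2`, the cobracket dual to the Lie bracket of `𝔤`
(`contract_ad_canonicalR`). So the coefficients of the bracket `{N, f}` are the values
`[δ_ε, δ_ε'] f - δ_[ε, ε'] f`, with `ε` and `ε'` twisted by the coadjoint action of `Γ`
(`bracket_coeff_bracketDefect`, `isLieAction_iff`). This proves the first two assertions.

For the third, `m` is a cocycle on the dual group (`twist_mul`), and left translation of `Γ` by a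
constant changes neither `δ` nor `T`. Therefore passing from `Γ` to `C Γ` changes the defect `N`
into `Ad_C (N + m(C⁻¹))` (`bracketDefect_mul_left`), which vanishes if `N = -m(C⁻¹)`.
-/

noncomputable section

namespace PoissonLie

/-! ### Derivatives along curves, mixed partial derivatives and Lie brackets -/

section Calculus

variable {E : Type*} [NormedAddCommGroup E] [NormedSpace ℝ E]
  {H : Type*} [TopologicalSpace H] {I : ModelWithCorners ℝ E H}
  {M : Type*} [TopologicalSpace M] [ChartedSpace H M]
  {E' : Type*} [NormedAddCommGroup E'] [NormedSpace ℝ E']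
  {H' : Type*} [TopologicalSpace H'] {I' : ModelWithCorners ℝ E' H'}
  {M' : Type*} [TopologicalSpace M'] [ChartedSpace H' M']
  {E'' : Type*} [NormedAddCommGroup E''] [NormedSpace ℝ E'']
  {H'' : Type*} [TopologicalSpace H''] {I'' : ModelWithCorners ℝ E'' H''}
  {M'' : Type*} [TopologicalSpace M''] [ChartedSpace H'' M'']

/-- The chain rule, with the base points and the composite given up to equality. Tangent vectors
are seen in the model spaces, so that no transport between tangent spaces is needed. -/
theorem mfderiv_comp_eq {f : M → M'} {g : M' → M''} {k : M → M''} {x : M} {y : M'}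
    (hy : f x = y) (hg : MDifferentiableAt I' I'' g y) (hf : MDifferentiableAt I I' f x)
    (hk : ∀ z, g (f z) = k z) (v : E) :
    (mfderiv I I'' k x v : E'') = mfderiv I' I'' g y (mfderiv I I' f x v : E') := by
  subst hy
  have : k = g ∘ f := funext fun z => (hk z).symm
  subst this
  exact mfderiv_comp_apply x hg hf v

/-- The partial derivative of a smooth function of two variables along a fixed tangent vector in the
second variable is smooth in the first one. -/
theorem contMDiff_differential_prod [IsManifold I ∞ M] [IsManifold I' ∞ M']
    {Φ : M × M' → ℝ} (hΦ : ContMDiff (I.prod I') 𝓘(ℝ, ℝ) ∞ Φ) (y : M') (v : E') :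
    ContMDiff I 𝓘(ℝ, ℝ) ∞
      (fun x => differential I' (fun z => Φ (x, z)) y v) := by
  have S₁ : ContMDiff I (I.tangent.prod I'.tangent) ∞
      (fun x : M => ((Bundle.TotalSpace.mk' E x 0 : TangentBundle I M),
        (Bundle.TotalSpace.mk' E' y v : TangentBundle I' M'))) :=
    (Bundle.contMDiff_zeroSection ℝ _).prodMk contMDiff_const
  have S₂ : ContMDiff (I.tangent.prod I'.tangent) (I.prod I').tangent ∞
    (equivTangentBundleProd I M I' M').symm := contMDiff_equivTangentBundleProd_symm
  have S₃ : ContMDiff (I.prod I').tangent 𝓘(ℝ, ℝ).tangent ∞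
      (tangentMap (I.prod I') 𝓘(ℝ, ℝ) Φ) :=
    hΦ.contMDiff_tangentMap (by simp)
  have S₄ := (contMDiff_snd_tangentBundle_modelSpace (n := ∞) ℝ 𝓘(ℝ, ℝ)).comp
    ((S₃.comp S₂).comp S₁)
  refine S₄.congr fun x => ?_
  have h := mfderiv_comp_eq (I := I') (I' := I.prod I') (I'' := 𝓘(ℝ, ℝ)) (x := y)
    (f := fun z => (x, z)) (g := Φ) rfl (hΦ.mdifferentiable (by simp) _)
    (mdifferentiableAt_const.prodMk mdifferentiableAt_id) (fun _ => rfl) v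
  rw [mfderiv_prod_right] at h
  exact h

/-- The chain rule for a function of two variables, with the conventions of `mfderiv_comp_eq`. -/
theorem mfderiv_comp_prod_eq {E₃ : Type*} [NormedAddCommGroup E₃] [NormedSpace ℝ E₃]
    {H₃ : Type*} [TopologicalSpace H₃] {I₃ : ModelWithCorners ℝ E₃ H₃}
    {M₃ : Type*} [TopologicalSpace M₃] [ChartedSpace H₃ M₃]
    {f₁ : M → M'} {f₂ : M → M''} {g : M' × M'' → M₃} {k : M → M₃} {x : M} {y₁ : M'} {y₂ : M''}
    (hy₁ : f₁ x = y₁) (hy₂ : f₂ x = y₂) (hg : MDifferentiableAt (I'.prod I'') I₃ g (y₁, y₂))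
    (hf₁ : MDifferentiableAt I I' f₁ x) (hf₂ : MDifferentiableAt I I'' f₂ x)
    (hk : ∀ z, g (f₁ z, f₂ z) = k z) (v : E) :
    (mfderiv I I₃ k x v : E₃) =
      (mfderiv I' I₃ (fun a => g (a, y₂)) y₁ (mfderiv I I' f₁ x v : E') : E₃) +
        (mfderiv I'' I₃ (fun b => g (y₁, b)) y₂ (mfderiv I I'' f₂ x v : E'') : E₃) := by
  subst hy₁ hy₂
  have h := mfderiv_comp_eq (I := I) (I'' := I₃) (f := fun z => (f₁ z, f₂ z)) rfl hg
    (hf₁.prodMk hf₂) hk v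
  rw [mfderiv_prodMk hf₁ hf₂] at h
  exact h.trans (mfderiv_prod_eq_add_apply hg)

end Calculus

section Curves
variable {E : Type*} [NormedAddCommGroup E] [NormedSpace ℝ E]
  {M : Type*} [TopologicalSpace M] [ChartedSpace E M]
  {E' : Type*} [NormedAddCommGroup E'] [NormedSpace ℝ E']
  {M' : Type*} [TopologicalSpace M'] [ChartedSpace E' M']

/-- Every tangent vector is the velocity of a curve that is smooth near `0`. -/
theorem exists_curve [IsManifold 𝓘(ℝ, E) ∞ M] (x : M) (v : E) :
    ∃ c : ℝ → M, c 0 = x ∧ ContMDiffAt 𝓘(ℝ, ℝ) 𝓘(ℝ, E) ∞ c 0 ∧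
      (mfderiv 𝓘(ℝ, ℝ) 𝓘(ℝ, E) c 0 (1 : ℝ) : E) = v := by
  let φ := extChartAt 𝓘(ℝ, E) x
  let l : ℝ → E := fun t => φ x + t • v
  have hl : ContMDiff 𝓘(ℝ, ℝ) 𝓘(ℝ, E) ∞ l := by
    apply ContDiff.contMDiff
    fun_prop
  have hl0 : l 0 = φ x := by simp [l]
  have hs : ContMDiffAt 𝓘(ℝ, E) 𝓘(ℝ, E) ∞ φ.symm (l 0) := by
    rw [hl0]
    exact (contMDiffOn_extChartAt_symm x).contMDiffAt (extChartAt_target_mem_nhds x)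
  have hc : ContMDiffAt 𝓘(ℝ, ℝ) 𝓘(ℝ, E) ∞ (φ.symm ∘ l) 0 :=
    hs.comp _ hl.contMDiffAt
  have h0 : (φ.symm ∘ l) 0 = x := by simp [hl0, φ]
  refine ⟨φ.symm ∘ l, h0, hc, ?_⟩
  have hφ : MDifferentiableAt 𝓘(ℝ, E) 𝓘(ℝ, E) φ x :=
    mdifferentiableAt_extChartAt (mem_chart_source E x)
  have hev : φ ∘ (φ.symm ∘ l) =ᶠ[nhds 0] l := by
    have : ∀ᶠ t in nhds (0 : ℝ), l t ∈ φ.target := by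
      apply hl.continuous.continuousAt.eventually_mem
      rw [hl0]
      exact extChartAt_target_mem_nhds x
    filter_upwards [this] with t ht
    exact φ.right_inv ht
  have h1 := mfderiv_comp_eq (k := φ ∘ (φ.symm ∘ l)) h0 hφ (hc.mdifferentiableAt (by simp))
    (fun _ => rfl) (1 : ℝ)
  rw [hev.mfderiv_eq, mfderiv_extChartAt_self] at h1
  have h2 : HasDerivAt l v 0 := by
    have := ((hasDerivAt_id (0 : ℝ)).smul_const v).const_add (φ x)
    rwa [one_smul] at this
  refine Eq.trans h1.symm ?_
  rw [mfderiv_eq_fderiv, h2.hasFDerivAt.fderiv]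
  exact one_smul ℝ v

/-- The derivative of a function along a tangent vector is its derivative along a curve. -/
theorem differential_apply_eq_fderiv {c : ℝ → M} {x : M} {v : E} {g : M → ℝ} (h0 : c 0 = x)
    (hc : ContMDiffAt 𝓘(ℝ, ℝ) 𝓘(ℝ, E) ∞ c 0)
    (hv : (mfderiv 𝓘(ℝ, ℝ) 𝓘(ℝ, E) c 0 (1 : ℝ) : E) = v)
    (hg : MDifferentiableAt 𝓘(ℝ, E) 𝓘(ℝ, ℝ) g x) :
    differential 𝓘(ℝ, E) g x v = fderiv ℝ (fun t => g (c t)) 0 1 := by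
  have := mfderiv_comp_eq (k := fun t => g (c t)) h0 hg (hc.mdifferentiableAt (by simp))
    (fun _ => rfl) (1 : ℝ)
  rw [← mfderiv_eq_fderiv, ← hv]
  exact this.symm

/-- Equality of the mixed partial derivatives. -/
theorem differential_differential_comm [IsManifold 𝓘(ℝ, E) ∞ M] [IsManifold 𝓘(ℝ, E') ∞ M']
    {Φ : M × M' → ℝ} (hΦ : ContMDiff (𝓘(ℝ, E).prod 𝓘(ℝ, E')) 𝓘(ℝ, ℝ) ∞ Φ) (x : M) (y : M')
    (v : TangentSpace 𝓘(ℝ, E) x) (w : TangentSpace 𝓘(ℝ, E') y) :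
    differential 𝓘(ℝ, E) (fun a => differential 𝓘(ℝ, E') (fun b => Φ (a, b)) y w) x v =
      differential 𝓘(ℝ, E') (fun b => differential 𝓘(ℝ, E) (fun a => Φ (a, b)) x v) y w := by
  obtain ⟨c, hc0, hc, hcv⟩ := exists_curve (E := E) x v
  obtain ⟨d, hd0, hd, hdw⟩ := exists_curve (E := E') y w
  have hΦ' : ContMDiff (𝓘(ℝ, E').prod 𝓘(ℝ, E)) 𝓘(ℝ, ℝ) ∞ (fun p : M' × M => Φ (p.2, p.1)) :=
    hΦ.comp (contMDiff_snd.prodMk contMDiff_fst)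
  -- along curves with velocities `v` and `w` this is the symmetry of the second derivative on `ℝ²`
  let F : ℝ × ℝ → ℝ := fun p => Φ (c p.1, d p.2)
  have hF : ContDiffAt ℝ ∞ F 0 := by
    rw [← contMDiffAt_iff_contDiffAt]
    have h1 : ContMDiffAt 𝓘(ℝ, ℝ × ℝ) (𝓘(ℝ, E).prod 𝓘(ℝ, E')) ∞
        (fun p : ℝ × ℝ => (c p.1, d p.2)) 0 := by
      have a1 : ContMDiffAt 𝓘(ℝ, ℝ × ℝ) 𝓘(ℝ, ℝ) ∞ (Prod.fst : ℝ × ℝ → ℝ) 0 :=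
        contDiff_fst.contMDiff.contMDiffAt
      have a2 : ContMDiffAt 𝓘(ℝ, ℝ × ℝ) 𝓘(ℝ, ℝ) ∞ (Prod.snd : ℝ × ℝ → ℝ) 0 :=
        contDiff_snd.contMDiff.contMDiffAt
      exact (ContMDiffAt.comp (0 : ℝ × ℝ) (g := c) hc a1).prodMk
        (ContMDiffAt.comp (0 : ℝ × ℝ) (g := d) hd a2)
    exact hΦ.contMDiffAt.comp _ h1
  have hF2 : ∀ᶠ p in nhds (0 : ℝ × ℝ), DifferentiableAt ℝ F p :=
    ((hF.of_le (m := 1) (by simp)).eventually (by simp)).mono fun p hp =>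
      hp.differentiableAt (by simp)
  have hF3 : DifferentiableAt ℝ (fderiv ℝ F) 0 :=
    ((hF.fderiv_right (m := 1) (by
      rw [one_add_one_eq_two]; exact ENat.LEInfty.out))).differentiableAt
      (by simp)
  have i1 : HasFDerivAt (fun s : ℝ => ((s, 0) : ℝ × ℝ)) (ContinuousLinearMap.inl ℝ ℝ ℝ) 0 :=
    (hasFDerivAt_id (0:ℝ)).prodMk (hasFDerivAt_const 0 0)
  have i2 : HasFDerivAt (fun s : ℝ => ((0, s) : ℝ × ℝ)) (ContinuousLinearMap.inr ℝ ℝ ℝ) 0 :=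
    (hasFDerivAt_const 0 0).prodMk (hasFDerivAt_id (0:ℝ))
  have hsymm : IsSymmSndFDerivAt ℝ F 0 := hF.isSymmSndFDerivAt (by
    simpa using (ENat.LEInfty.out : (2 : ℕ∞ω) ≤ ∞))
  have L1 := differential_apply_eq_fderiv hc0 hc hcv
    ((contMDiff_differential_prod hΦ y w).mdifferentiable (by simp) _)
  have L2 := differential_apply_eq_fderiv hd0 hd hdw
    ((contMDiff_differential_prod hΦ' x v).mdifferentiable (by simp) _)
  refine L1.trans (Eq.trans ?_ L2.symm)
  have e1 : (fun s => differential 𝓘(ℝ, E') (fun b => Φ (c s, b)) y w) =ᶠ[nhds 0]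
      fun s => fderiv ℝ F (s, 0) (0, 1) := by
    have : ∀ᶠ s in nhds (0 : ℝ), DifferentiableAt ℝ F (s, 0) :=
      (i1.continuousAt : Filter.Tendsto _ _ (nhds ((0 : ℝ), (0 : ℝ)))).eventually hF2
    filter_upwards [this] with s hs
    refine (differential_apply_eq_fderiv hd0 hd hdw
      ((hΦ.comp (contMDiff_const.prodMk contMDiff_id)).mdifferentiable (by simp) _)).trans ?_
    have i3 : HasFDerivAt (fun t : ℝ => ((s, t) : ℝ × ℝ)) (ContinuousLinearMap.inr ℝ ℝ ℝ) 0 :=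
      (hasFDerivAt_const s 0).prodMk (hasFDerivAt_id (0:ℝ))
    have := (HasFDerivAt.comp (0 : ℝ) (g := F) hs.hasFDerivAt i3).fderiv
    exact (congrArg (fun L : ℝ →L[ℝ] ℝ => L 1) this).trans (by simp)
  have e2 : (fun t => differential 𝓘(ℝ, E) (fun a => Φ (a, d t)) x v) =ᶠ[nhds 0]
      fun t => fderiv ℝ F (0, t) (1, 0) := by
    have : ∀ᶠ s in nhds (0 : ℝ), DifferentiableAt ℝ F (0, s) :=
      (i2.continuousAt : Filter.Tendsto _ _ (nhds ((0 : ℝ), (0 : ℝ)))).eventually hF2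
    filter_upwards [this] with s hs
    refine (differential_apply_eq_fderiv hc0 hc hcv
      ((hΦ.comp (contMDiff_id.prodMk contMDiff_const)).mdifferentiable (by simp) _)).trans ?_
    have i3 : HasFDerivAt (fun t : ℝ => ((t, s) : ℝ × ℝ)) (ContinuousLinearMap.inl ℝ ℝ ℝ) 0 :=
      (hasFDerivAt_id (0:ℝ)).prodMk (hasFDerivAt_const s 0)
    have := (HasFDerivAt.comp (0 : ℝ) (g := F) hs.hasFDerivAt i3).fderiv
    exact (congrArg (fun L : ℝ →L[ℝ] ℝ => L 1) this).trans (by simp)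
  refine (congrArg (fun L : ℝ →L[ℝ] ℝ => L 1) e1.fderiv_eq).trans
    (Eq.trans ?_ (congrArg (fun L : ℝ →L[ℝ] ℝ => L 1) e2.fderiv_eq).symm)
  have k1 := (HasFDerivAt.comp (0 : ℝ) (g := fderiv ℝ F) (f := fun s : ℝ => ((s, 0) : ℝ × ℝ))
    hF3.hasFDerivAt i1).clm_apply (hasFDerivAt_const ((0, 1) : ℝ × ℝ) 0)
  have k2 := (HasFDerivAt.comp (0 : ℝ) (g := fderiv ℝ F) (f := fun s : ℝ => ((0, s) : ℝ × ℝ))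
    hF3.hasFDerivAt i2).clm_apply (hasFDerivAt_const ((1, 0) : ℝ × ℝ) 0)
  have k1' := congrArg (fun L : ℝ →L[ℝ] ℝ => L 1) k1.fderiv
  have k2' := congrArg (fun L : ℝ →L[ℝ] ℝ => L 1) k2.fderiv
  refine k1'.trans (Eq.trans ?_ k2'.symm)
  simpa using hsymm (1, 0) (0, 1)

/-- The Lie bracket of vector fields is the commutator of the derivations that they define. -/
theorem mfderiv_mlieBracket [IsManifold 𝓘(ℝ, E) ∞ M] [CompleteSpace E]
    {V W : ∀ x : M, TangentSpace 𝓘(ℝ, E) x} {x : M}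
    (hV : MDifferentiableAt 𝓘(ℝ, E) 𝓘(ℝ, E).tangent
      (fun y => (V y : TangentBundle 𝓘(ℝ, E) M)) x)
    (hW : MDifferentiableAt 𝓘(ℝ, E) 𝓘(ℝ, E).tangent
      (fun y => (W y : TangentBundle 𝓘(ℝ, E) M)) x)
    {f : M → ℝ} (hf : ContMDiff 𝓘(ℝ, E) 𝓘(ℝ, ℝ) ∞ f) :
    differential 𝓘(ℝ, E) f x (VectorField.mlieBracket 𝓘(ℝ, E) V W x) =
      differential 𝓘(ℝ, E) (fun y => differential 𝓘(ℝ, E) f y (W y)) x (V x) -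
      differential 𝓘(ℝ, E) (fun y => differential 𝓘(ℝ, E) f y (V y)) x (W x) := by
  let φ := extChartAt 𝓘(ℝ, E) x
  -- the function and the vector fields, read in the chart at `x`
  let F : E → ℝ := f ∘ φ.symm
  let pb : (∀ x : M, TangentSpace 𝓘(ℝ, E) x) → E → E := fun U y =>
    VectorField.mpullbackWithin 𝓘(ℝ, E) 𝓘(ℝ, E) φ.symm U (Set.range 𝓘(ℝ, E)) y
  have hF : ContDiffAt ℝ ∞ F (φ x) := by
    rw [← contMDiffAt_iff_contDiffAt]
    exact hf.contMDiffAt.comp _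
      ((contMDiffOn_extChartAt_symm x).contMDiffAt (extChartAt_target_mem_nhds x))
  have hF3 : DifferentiableAt ℝ (fderiv ℝ F) (φ x) :=
    ((hF.fderiv_right (m := 1) (by
      rw [one_add_one_eq_two]; exact ENat.LEInfty.out))).differentiableAt (by simp)
  have hsymm : IsSymmSndFDerivAt ℝ F (φ x) := hF.isSymmSndFDerivAt (by
    simpa using (ENat.LEInfty.out : (2 : ℕ∞ω) ≤ ∞))
  have hpb : ∀ U : ∀ x : M, TangentSpace 𝓘(ℝ, E) x, MDifferentiableAt 𝓘(ℝ, E) 𝓘(ℝ, E).tangent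
      (fun y => (U y : TangentBundle 𝓘(ℝ, E) M)) x → DifferentiableAt ℝ (pb U) (φ x) := by
    intro U hU
    rw [← mdifferentiableWithinAt_univ] at hU
    have := hU.differentiableWithinAt_mpullbackWithin_vectorField
    have e : (extChartAt 𝓘(ℝ, E) x).symm ⁻¹' Set.univ ∩ Set.range 𝓘(ℝ, E) = Set.univ := by simp
    rw [e] at this
    exact differentiableWithinAt_univ.1 this
  have hpb' : ∀ U : ∀ x : M, TangentSpace 𝓘(ℝ, E) x, ∀ y ∈ φ.target,
      pb U y = mfderiv 𝓘(ℝ, E) 𝓘(ℝ, E) φ (φ.symm y) (U (φ.symm y)) := by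
    intro U y hy
    have : (mfderivWithin 𝓘(ℝ, E) 𝓘(ℝ, E) φ.symm (Set.range 𝓘(ℝ, E)) y).inverse =
        mfderiv 𝓘(ℝ, E) 𝓘(ℝ, E) φ (φ.symm y) :=
      ContinuousLinearMap.inverse_eq
        (mfderivWithin_extChartAt_symm_comp_mfderiv_extChartAt hy)
        (mfderiv_extChartAt_comp_mfderivWithin_extChartAt_symm hy)
    change (mfderivWithin 𝓘(ℝ, E) 𝓘(ℝ, E) φ.symm (Set.range 𝓘(ℝ, E)) y).inverse _ = _
    rw [this]
    rfl
  have hFφ : ∀ z ∈ φ.source, ∀ v : E, (mfderiv 𝓘(ℝ, E) 𝓘(ℝ, ℝ) f z v : ℝ) =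
      fderiv ℝ F (φ z) (mfderiv 𝓘(ℝ, E) 𝓘(ℝ, E) φ z v : E) := by
    intro z hz v
    have h1 : F ∘ φ =ᶠ[nhds z] f := by
      filter_upwards [(isOpen_extChartAt_source x).mem_nhds hz] with w hw
      exact congrArg f (φ.left_inv hw)
    have h2 : MDifferentiableAt 𝓘(ℝ, E) 𝓘(ℝ, ℝ) F (φ z) :=
      (hf.contMDiffAt.comp _ ((contMDiffOn_extChartAt_symm x).contMDiffAt
        ((isOpen_extChartAt_target x).mem_nhds (φ.map_source hz)))).mdifferentiableAt (by simp)
    have := mfderiv_comp_eq (k := F ∘ φ) rfl h2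
      (mdifferentiableAt_extChartAt (by rwa [← extChartAt_source 𝓘(ℝ, E)])) (fun _ => rfl) v
    rw [h1.mfderiv_eq, mfderiv_eq_fderiv] at this
    exact this
  have hpbf : ∀ U : ∀ x : M, TangentSpace 𝓘(ℝ, E) x, ∀ z ∈ φ.source,
      differential 𝓘(ℝ, E) f z (U z) = fderiv ℝ F (φ z) (pb U (φ z)) := by
    intro U z hz
    rw [hpb' U _ (φ.map_source hz)]
    refine (hFφ z hz (U z)).trans (congrArg _ ?_)
    exact (congrArg (fun w => (mfderiv 𝓘(ℝ, E) 𝓘(ℝ, E) φ w (U w) : E)) (φ.left_inv hz)).symm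
  have hpbx : ∀ U : ∀ x : M, TangentSpace 𝓘(ℝ, E) x, pb U (φ x) = U x := by
    intro U
    rw [hpb' U _ (mem_extChartAt_target x)]
    refine (congrArg (fun w => (mfderiv 𝓘(ℝ, E) 𝓘(ℝ, E) φ w (U w) : E))
      (φ.left_inv (mem_extChartAt_source x))).trans ?_
    change (mfderiv 𝓘(ℝ, E) 𝓘(ℝ, E) (extChartAt 𝓘(ℝ, E) x) x (U x) : E) = _
    rw [mfderiv_extChartAt_self]
    rfl
  -- the product rule; the term with the second derivative of `F` is symmetric in the two fields
  have key : ∀ U : ∀ x : M, TangentSpace 𝓘(ℝ, E) x, MDifferentiableAt 𝓘(ℝ, E) 𝓘(ℝ, E).tangent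
      (fun y => (U y : TangentBundle 𝓘(ℝ, E) M)) x → ∀ v : E,
      differential 𝓘(ℝ, E) (fun y => differential 𝓘(ℝ, E) f y (U y)) x v =
        fderiv ℝ (fderiv ℝ F) (φ x) v (U x) + fderiv ℝ F (φ x) (fderiv ℝ (pb U) (φ x) v) := by
    intro U hU v
    have h1 : (fun y => differential 𝓘(ℝ, E) f y (U y)) =ᶠ[nhds x]
        (fun y => fderiv ℝ F y (pb U y)) ∘ φ := by
      filter_upwards [extChartAt_source_mem_nhds (I := 𝓘(ℝ, E)) x] with z hz
      exact hpbf U z hz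
    have h2 := hF3.hasFDerivAt.clm_apply (hpb U hU).hasFDerivAt
    have h3 := mfderiv_comp_eq (I := 𝓘(ℝ, E)) (I'' := 𝓘(ℝ, ℝ)) (f := φ) (x := x) rfl
      h2.differentiableAt.mdifferentiableAt
      (mdifferentiableAt_extChartAt (mem_chart_source E x)) (fun _ => rfl) v
    change (mfderiv 𝓘(ℝ, E) 𝓘(ℝ, ℝ) _ x v : ℝ) = _
    rw [h1.mfderiv_eq]
    refine h3.trans ?_
    rw [mfderiv_eq_fderiv, h2.fderiv, mfderiv_extChartAt_self]
    change fderiv ℝ F (φ x) (fderiv ℝ (pb U) (φ x) v) +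
      fderiv ℝ (fderiv ℝ F) (φ x) v (pb U (φ x)) = _
    rw [hpbx, add_comm]
  have hbr : VectorField.mlieBracket 𝓘(ℝ, E) V W x =
      fderiv ℝ (pb W) (φ x) (V x) - fderiv ℝ (pb V) (φ x) (W x) := by
    rw [← hpbx V, ← hpbx W]
    have : VectorField.mlieBracket 𝓘(ℝ, E) V W x =
        (mfderiv 𝓘(ℝ, E) 𝓘(ℝ, E) (extChartAt 𝓘(ℝ, E) x) x).inverse
          (VectorField.lieBracketWithin (E := E) ℝ (pb V) (pb W)
            ((extChartAt 𝓘(ℝ, E) x).symm ⁻¹' Set.univ ∩ Set.range 𝓘(ℝ, E)) (φ x)) := rfl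
    have e : (extChartAt 𝓘(ℝ, E) x).symm ⁻¹' Set.univ ∩ Set.range 𝓘(ℝ, E) = Set.univ := by simp
    have hid : (mfderiv 𝓘(ℝ, E) 𝓘(ℝ, E) (extChartAt 𝓘(ℝ, E) x) x).inverse =
        ContinuousLinearMap.id ℝ E := by
      rw [mfderiv_extChartAt_self]
      exact ContinuousLinearMap.inverse_id (R := ℝ) (M := E)
    rw [this, e, VectorField.lieBracketWithin_univ]
    exact congrArg
      (fun L : E →L[ℝ] E => L (VectorField.lieBracket (E := E) ℝ (pb V) (pb W) (φ x))) hid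
  refine Eq.trans ?_ (congrArg₂ (· - ·) (key W hW (V x)) (key V hV (W x))).symm
  refine (hFφ x (mem_extChartAt_source x) _).trans ?_
  rw [mfderiv_extChartAt_self, hbr]
  change fderiv ℝ F (φ x) (fderiv ℝ (pb W) (φ x) (V x) - fderiv ℝ (pb V) (φ x) (W x)) = _
  rw [map_sub]
  have := hsymm.eq (V x) (W x)
  linarith

end Curves

/-! ### Left invariant derivations and the adjoint action -/

section LieGroupCalculus

variable {E : Type*} [NormedAddCommGroup E] [NormedSpace ℝ E]
  {G : Type*} [TopologicalSpace G] [ChartedSpace E G] [Group G] [LieGroup 𝓘(ℝ, E) ∞ G]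

theorem mdifferentiableAt_mul_left (g x : G) :
    MDifferentiableAt 𝓘(ℝ, E) 𝓘(ℝ, E) (fun y => g * y) x :=
  (contMDiff_mul_left (n := ∞)).mdifferentiable (by simp) x

theorem mdifferentiableAt_mul_right (g x : G) :
    MDifferentiableAt 𝓘(ℝ, E) 𝓘(ℝ, E) (fun y => y * g) x :=
  (contMDiff_mul_right (n := ∞)).mdifferentiable (by simp) x

theorem contMDiff_conj (g : G) : ContMDiff 𝓘(ℝ, E) 𝓘(ℝ, E) ∞ (fun y => g * y * g⁻¹) :=
  (contMDiff_mul_left.mul contMDiff_const)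

theorem mdifferentiableAt_conj (g x : G) :
    MDifferentiableAt 𝓘(ℝ, E) 𝓘(ℝ, E) (fun y => g * y * g⁻¹) x :=
  (contMDiff_conj g).mdifferentiable (by simp) x

theorem leftTranslate_leftTrivialize (g : G) (v : TangentSpace 𝓘(ℝ, E) g) :
    leftTranslate g (leftTrivialize g v) = v := by
  have := mfderiv_comp_eq (E := E) (f := fun x => g⁻¹ * x) (g := fun x => g * x) (k := id)
    (inv_mul_cancel g) (mdifferentiableAt_mul_left g 1)
    (mdifferentiableAt_mul_left g⁻¹ g) (fun z => by simp) (v : E)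
  rw [mfderiv_id] at this
  exact this.symm

theorem leftTranslate_eq_rightTranslate_Ad (g : G) (v : LieAlg E G) :
    leftTranslate g v = rightTranslate g (Ad g v) :=
  mfderiv_comp_eq (E := E) (f := fun x => g * x * g⁻¹) (g := fun x => x * g)
    (k := fun x => g * x) (by simp) (mdifferentiableAt_mul_right g 1)
    (mdifferentiableAt_conj g 1) (fun z => by simp) (v : E)

theorem rightTranslate_injective (g : G) :
    Function.Injective (rightTranslate g : LieAlg E G →ₗ[ℝ] _) := by
  refine Function.LeftInverse.injective
    (g := fun w : TangentSpace 𝓘(ℝ, E) g =>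
      (mfderiv 𝓘(ℝ, E) 𝓘(ℝ, E) (fun x => x * g⁻¹) g w : E)) fun v => ?_
  have := mfderiv_comp_eq (E := E) (f := fun x => x * g) (g := fun x => x * g⁻¹) (k := id)
    (one_mul g) (mdifferentiableAt_mul_right g⁻¹ g)
    (mdifferentiableAt_mul_right g 1) (fun z => by simp) (v : E)
  rw [mfderiv_id] at this
  exact this.symm

theorem Ad_mul (g h : G) (v : LieAlg E G) : Ad (g * h) v = Ad g (Ad h v) :=
  mfderiv_comp_eq (E := E) (f := fun x => h * x * h⁻¹) (g := fun x => g * x * g⁻¹)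
    (k := fun x => g * h * x * (g * h)⁻¹) (by simp) (mdifferentiableAt_conj g 1)
    (mdifferentiableAt_conj h 1) (fun z => by simp [mul_assoc]) (v : E)

theorem Ad_one (v : LieAlg E G) : Ad (1 : G) v = v := by
  have : (fun x : G => 1 * x * 1⁻¹) = id := by ext; simp
  change (mfderiv 𝓘(ℝ, E) 𝓘(ℝ, E) (fun x : G => 1 * x * 1⁻¹) 1 v : E) = v
  rw [this, mfderiv_id]
  rfl

/-- The derivative of a function along the left invariant vector field defined by `v`. -/
def leftDeriv (φ : G → ℝ) (v : LieAlg E G) (g : G) : ℝ :=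
  differential 𝓘(ℝ, E) φ g (leftTranslate g v)

theorem leftDeriv_add (φ : G → ℝ) (v w : LieAlg E G) (g : G) :
    leftDeriv φ (v + w) g = leftDeriv φ v g + leftDeriv φ w g := by
  simp [leftDeriv]

theorem leftDeriv_smul (φ : G → ℝ) (c : ℝ) (v : LieAlg E G) (g : G) :
    leftDeriv φ (c • v) g = c * leftDeriv φ v g := by
  simp [leftDeriv]

theorem leftDeriv_eq_differential_one {φ : G → ℝ}
    (hφ : ContMDiff 𝓘(ℝ, E) 𝓘(ℝ, ℝ) ∞ φ) (v : LieAlg E G) (g : G) :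
    leftDeriv φ v g = differential 𝓘(ℝ, E) (fun x => φ (g * x)) (1 : G) v :=
  (mfderiv_comp_eq (mul_one g) (hφ.mdifferentiable (by simp) g)
    (mdifferentiableAt_mul_left g 1) (fun _ => rfl) (v : E)).symm

theorem contMDiff_leftDeriv {φ : G → ℝ}
    (hφ : ContMDiff 𝓘(ℝ, E) 𝓘(ℝ, ℝ) ∞ φ) (v : LieAlg E G) :
    ContMDiff 𝓘(ℝ, E) 𝓘(ℝ, ℝ) ∞ (leftDeriv φ v) := by
  have := contMDiff_differential_prod (I := 𝓘(ℝ, E)) (I' := 𝓘(ℝ, E))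
    (Φ := fun p : G × G => φ (p.1 * p.2)) (hφ.comp (contMDiff_mul 𝓘(ℝ, E) ∞)) 1 v
  exact this.congr fun g => leftDeriv_eq_differential_one hφ v g

theorem leftDeriv_comp_mul_left {φ : G → ℝ}
    (hφ : ContMDiff 𝓘(ℝ, E) 𝓘(ℝ, ℝ) ∞ φ) (v : LieAlg E G) (g x : G) :
    leftDeriv (fun y => φ (g * y)) v x = leftDeriv φ v (g * x) := by
  have h : ContMDiff 𝓘(ℝ, E) 𝓘(ℝ, ℝ) ∞ (fun y => φ (g * y)) := hφ.comp contMDiff_mul_left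
  rw [leftDeriv_eq_differential_one hφ, leftDeriv_eq_differential_one h]
  simp only [mul_assoc]

theorem leftDeriv_one {φ : G → ℝ}
    (hφ : ContMDiff 𝓘(ℝ, E) 𝓘(ℝ, ℝ) ∞ φ) (v : LieAlg E G) :
    leftDeriv φ v 1 = differential 𝓘(ℝ, E) φ (1 : G) v := by
  rw [leftDeriv_eq_differential_one hφ]
  simp only [one_mul]

/-- The bracket of the Lie algebra is the commutator of left invariant derivations. -/
theorem leftDeriv_lie [CompleteSpace E] {φ : G → ℝ}
    (hφ : ContMDiff 𝓘(ℝ, E) 𝓘(ℝ, ℝ) ∞ φ) (v w : LieAlg E G) (g : G) :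
    leftDeriv φ ⁅v, w⁆ g =
      leftDeriv (leftDeriv φ w) v g - leftDeriv (leftDeriv φ v) w g := by
  have key : ∀ {φ : G → ℝ}, ContMDiff 𝓘(ℝ, E) 𝓘(ℝ, ℝ) ∞ φ → leftDeriv φ ⁅v, w⁆ 1 =
      leftDeriv (leftDeriv φ w) v 1 - leftDeriv (leftDeriv φ v) w 1 := by
    intro φ hφ
    rw [leftDeriv_one hφ, leftDeriv_one (contMDiff_leftDeriv hφ w),
      leftDeriv_one (contMDiff_leftDeriv hφ v), GroupLieAlgebra.bracket_def]
    have h := mfderiv_mlieBracket (x := (1 : G))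
      (mdifferentiableAt_mulInvariantVectorField v)
      (mdifferentiableAt_mulInvariantVectorField w) hφ
    have h1 : ∀ u : LieAlg E G, (mulInvariantVectorField u (1 : G) : LieAlg E G) = u := by
      intro u
      have : (fun x : G => 1 * x) = id := by ext; simp
      change (mfderiv 𝓘(ℝ, E) 𝓘(ℝ, E) (fun x : G => 1 * x) 1 u : E) = u
      rw [this, mfderiv_id]
      rfl
    rw [h1, h1] at h
    exact h
  have h := key (φ := fun y => φ (g * y)) (hφ.comp contMDiff_mul_left)
  have e : ∀ u, leftDeriv (fun y => φ (g * y)) u = fun x => leftDeriv φ u (g * x) :=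
    fun u => funext fun x => leftDeriv_comp_mul_left hφ u g x
  rw [e v, e w, leftDeriv_comp_mul_left (contMDiff_leftDeriv hφ w),
    leftDeriv_comp_mul_left (contMDiff_leftDeriv hφ v), leftDeriv_comp_mul_left hφ,
    mul_one] at h
  exact h

section FiniteDim
variable [FiniteDimensional ℝ E] [T2Space G]

/-- Any linear form is realised by the left invariant derivatives, at a given point, of a smooth
function. -/
theorem exists_leftDeriv_eq (α : Module.Dual ℝ (LieAlg E G)) (g : G) :
    ∃ φ : G → ℝ, ContMDiff 𝓘(ℝ, E) 𝓘(ℝ, ℝ) ∞ φ ∧ ∀ v, leftDeriv φ v g = α v := by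
  refine ⟨fun x => extend α (g⁻¹ * x), (contMDiff_extend α).comp contMDiff_mul_left,
    fun v => ?_⟩
  rw [leftDeriv_comp_mul_left (contMDiff_extend α), inv_mul_cancel,
    leftDeriv_one (contMDiff_extend α), differential_extend]

/-- `α (Ad g v)` is a derivative of a function of two variables. -/
theorem apply_Ad_eq (α : Module.Dual ℝ (LieAlg E G)) (v : LieAlg E G) (g : G) :
    α (Ad g v) = differential 𝓘(ℝ, E) (fun x => extend α (g * x * g⁻¹)) (1 : G) v := by
  have := mfderiv_comp_eq (E := E) (f := fun x => g * x * g⁻¹) (g := extend α)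
    (k := fun x => extend α (g * x * g⁻¹)) (by simp : g * 1 * g⁻¹ = 1)
    ((contMDiff_extend α).mdifferentiable (by simp) 1)
    (mdifferentiableAt_conj g 1) (fun _ => rfl) (v : E)
  refine Eq.trans ?_ this.symm
  exact (LinearMap.congr_fun (differential_extend α) _).symm

theorem contMDiff_apply_Ad (α : Module.Dual ℝ (LieAlg E G)) (v : LieAlg E G) :
    ContMDiff 𝓘(ℝ, E) 𝓘(ℝ, ℝ) ∞ (fun g : G => α (Ad g v)) := by
  have := contMDiff_differential_prod (I := 𝓘(ℝ, E)) (I' := 𝓘(ℝ, E))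
    (Φ := fun p : G × G => extend α (p.1 * p.2 * p.1⁻¹))
    ((contMDiff_extend α).comp ((contMDiff_mul 𝓘(ℝ, E) ∞).mul contMDiff_fst.inv)) 1 v
  exact this.congr fun g => apply_Ad_eq α v g

/-- The differential of `Ad` at the identity is the adjoint action of the Lie algebra: it is the
sum of a derivative on the left, and of minus a derivative on the right that mixes with `v`. -/
theorem differential_apply_Ad_one (α : Module.Dual ℝ (LieAlg E G)) (v w : LieAlg E G) :
    differential 𝓘(ℝ, E) (fun g : G => α (Ad g v)) (1 : G) w = α ⁅w, v⁆ := by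
  let φ := extend α
  have hφ : ContMDiff 𝓘(ℝ, E) 𝓘(ℝ, ℝ) ∞ φ := contMDiff_extend α
  -- `α (Ad g v) = Ψ (g, g⁻¹)`
  let Ψ : G × G → ℝ := fun p => differential 𝓘(ℝ, E) (fun x => φ (p.1 * x * p.2)) (1 : G) v
  have hΨ : ContMDiff (𝓘(ℝ, E).prod 𝓘(ℝ, E)) 𝓘(ℝ, ℝ) ∞ Ψ :=
    contMDiff_differential_prod (I := 𝓘(ℝ, E).prod 𝓘(ℝ, E)) (I' := 𝓘(ℝ, E))
      (Φ := fun p : (G × G) × G => φ (p.1.1 * p.2 * p.1.2))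
      (hφ.comp (((contMDiff_fst.comp contMDiff_fst).mul contMDiff_snd).mul
        (contMDiff_snd.comp contMDiff_fst))) 1 v
  have hinv : MDifferentiableAt 𝓘(ℝ, E) 𝓘(ℝ, E) (fun g : G => g⁻¹) 1 :=
    (contMDiff_inv 𝓘(ℝ, E) ∞).mdifferentiable (by simp) 1
  have hid : ∀ f : G → G, (∀ x, f x = x) → ∀ w : E,
      (mfderiv 𝓘(ℝ, E) 𝓘(ℝ, E) f 1 w : E) = w := by
    intro f hf w
    have : f = id := funext hf
    rw [this, mfderiv_id]
    rfl
  have hdinv : ∀ w : E, (mfderiv 𝓘(ℝ, E) 𝓘(ℝ, E) (fun g : G => g⁻¹) 1 w : E) = -w := by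
    intro w
    have h := mfderiv_comp_prod_eq (E := E) (f₁ := fun g : G => g) (f₂ := fun g : G => g⁻¹)
      (g := fun p : G × G => p.1 * p.2) (k := fun _ => (1 : G)) (y₁ := 1) (y₂ := 1) (x := 1) rfl
      inv_one ((contMDiff_mul 𝓘(ℝ, E) ∞).mdifferentiable (by simp) _)
      mdifferentiableAt_id hinv (fun g => mul_inv_cancel g) w
    have h0 : (mfderiv 𝓘(ℝ, E) 𝓘(ℝ, E) (fun _ : G => (1 : G)) 1 w : E) = 0 := by
      rw [mfderiv_const]
      rfl
    let d : E := mfderiv 𝓘(ℝ, E) 𝓘(ℝ, E) (fun g : G => g⁻¹) 1 w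
    have h' : (0 : E) = w + d := by
      refine h0.symm.trans (h.trans (congrArg₂ (fun a b : E => a + b) ?_ ?_))
      · exact (hid _ mul_one _).trans (hid _ (fun _ => rfl) _)
      · exact hid _ one_mul _
    exact (neg_eq_of_add_eq_zero_right h'.symm).symm
  have h1 := mfderiv_comp_prod_eq (E := E) (k := fun g : G => α (Ad g v)) (f₁ := fun g : G => g)
    (f₂ := fun g : G => g⁻¹) (g := Ψ) (y₁ := 1) (y₂ := 1) (x := 1) rfl inv_one
    (hΨ.mdifferentiable (by simp) _)
    mdifferentiableAt_id hinv (fun g => (apply_Ad_eq α v g).symm) (w : E)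
  have h2 : differential 𝓘(ℝ, E) (fun g : G => α (Ad g v)) (1 : G) w =
      differential 𝓘(ℝ, E) (fun a => Ψ (a, 1)) (1 : G) w -
        differential 𝓘(ℝ, E) (fun b => Ψ (1, b)) (1 : G) w := by
    rw [sub_eq_add_neg, ← map_neg]
    refine h1.trans (congrArg₂ (fun a b : ℝ => a + b) ?_ ?_)
    · exact congrArg (differential 𝓘(ℝ, E) (fun a => Ψ (a, 1)) (1 : G)) (hid _ (fun _ => rfl) w)
    · exact congrArg (differential 𝓘(ℝ, E) (fun b => Ψ (1, b)) (1 : G)) (hdinv w)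
  rw [h2]
  -- both partial derivatives of `Ψ` are second derivatives of `φ` along left invariant fields
  have a1 : (fun a => Ψ (a, 1)) = leftDeriv φ v := by
    ext a
    rw [leftDeriv_eq_differential_one hφ]
    simp only [Ψ, mul_one]
  have a2 : (fun b => Ψ (1, b)) =
      fun b => differential 𝓘(ℝ, E) (fun x => φ (x * b)) (1 : G) v := by
    ext b
    simp only [Ψ, one_mul]
  have a3 : (fun x => differential 𝓘(ℝ, E) (fun b => φ (x * b)) (1 : G) w) =
      leftDeriv φ w := by
    ext a
    rw [leftDeriv_eq_differential_one hφ]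
  have a4 := differential_differential_comm (Φ := fun p : G × G => φ (p.1 * p.2))
    (hφ.comp (contMDiff_mul 𝓘(ℝ, E) ∞)) 1 1 v w
  have a5 := leftDeriv_lie hφ w v 1
  rw [leftDeriv_one hφ, leftDeriv_one (contMDiff_leftDeriv hφ v),
    leftDeriv_one (contMDiff_leftDeriv hφ w)] at a5
  rw [a1, a2, ← a4, a3]
  rw [← a5, differential_extend]

/-- The differential of `Ad` at `g`, along the left translate of `w`. -/
theorem leftDeriv_apply_Ad (α : Module.Dual ℝ (LieAlg E G)) (v w : LieAlg E G) (g : G) :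
    leftDeriv (fun g : G => α (Ad g v)) w g = α (Ad g ⁅w, v⁆) := by
  rw [leftDeriv_eq_differential_one (contMDiff_apply_Ad α v),
    ← LinearMap.comp_apply α, ← differential_apply_Ad_one]
  simp only [Ad_mul, LinearMap.comp_apply]

end FiniteDim

end LieGroupCalculus

/-! ### Two-tensors and their coefficients -/

section Contract

variable {V W : Type*} [AddCommGroup V] [Module ℝ V] [AddCommGroup W] [Module ℝ W]

theorem contract_add (α β : V →ₗ[ℝ] ℝ) (S T : V ⊗[ℝ] V) :
    contract α β (S + T) = contract α β S + contract α β T := by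
  simp [contract]

theorem contract_neg (α β : V →ₗ[ℝ] ℝ) (T : V ⊗[ℝ] V) :
    contract α β (-T) = -contract α β T := by
  simp [contract]

theorem contract_sub (α β : V →ₗ[ℝ] ℝ) (S T : V ⊗[ℝ] V) :
    contract α β (S - T) = contract α β S - contract α β T := by
  simp [contract]

theorem contract_smul (α β : V →ₗ[ℝ] ℝ) (c : ℝ) (T : V ⊗[ℝ] V) :
    contract α β (c • T) = c * contract α β T := by
  simp [contract]

theorem contract_sum {ι : Type*} (s : Finset ι) (α β : V →ₗ[ℝ] ℝ) (T : ι → V ⊗[ℝ] V) :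
    contract α β (∑ i ∈ s, T i) = ∑ i ∈ s, contract α β (T i) := by
  simp [contract]

theorem contract_add_right (α β β' : V →ₗ[ℝ] ℝ) (T : V ⊗[ℝ] V) :
    contract α (β + β') T = contract α β T + contract α β' T := by
  simp [contract, TensorProduct.map_add_right]

theorem contract_tensorSq (L : V →ₗ[ℝ] W) (α β : W →ₗ[ℝ] ℝ) (T : V ⊗[ℝ] V) :
    contract α β (tensorSq L T) = contract (α ∘ₗ L) (β ∘ₗ L) T := by
  rw [contract, contract, TensorProduct.map_comp]
  rfl

theorem contract_eq_neg_of_skew {T : V ⊗[ℝ] V} (hT : TensorProduct.comm ℝ V V T = -T)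
    (α β : V →ₗ[ℝ] ℝ) : contract α β T = -contract β α T := by
  rw [← contract_comm, hT, contract_neg]

theorem tensorSq_comm (L : V →ₗ[ℝ] W) (T : V ⊗[ℝ] V) :
    TensorProduct.comm ℝ W W (tensorSq L T) = tensorSq L (TensorProduct.comm ℝ V V T) := by
  induction T with
  | zero => simp
  | tmul u v => simp
  | add S T hS hT => simp only [map_add, hS, hT]

theorem tensorSq_comp {U : Type*} [AddCommGroup U] [Module ℝ U] (L : V →ₗ[ℝ] W) (L' : W →ₗ[ℝ] U)
    (T : V ⊗[ℝ] V) : tensorSq L' (tensorSq L T) = tensorSq (L' ∘ₗ L) T := by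
  rw [tensorSq, tensorSq, tensorSq, TensorProduct.map_comp]
  rfl

theorem tensorSq_sub_of_eq_zero {L : V →ₗ[ℝ] W} {S : V ⊗[ℝ] V} (hS : tensorSq L S = 0)
    (T : V ⊗[ℝ] V) : tensorSq L (T - S) = tensorSq L T := by
  rw [map_sub, hS, sub_zero]

theorem comm_sum_tmul_sub {ι : Type*} [Fintype ι] (f g : ι → V) :
    TensorProduct.comm ℝ V V (∑ a, (f a ⊗ₜ[ℝ] g a - g a ⊗ₜ[ℝ] f a)) =
      -∑ a, (f a ⊗ₜ[ℝ] g a - g a ⊗ₜ[ℝ] f a) := by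
  simp only [map_sum, map_sub, TensorProduct.comm_tmul, ← Finset.sum_neg_distrib, neg_sub]

variable {ι : Type*} [Fintype ι] (b : Module.Basis ι ℝ V)

theorem tensorProduct_repr_eq_contract (T : V ⊗[ℝ] V) (i j : ι) :
    (b.tensorProduct b).repr T (i, j) = contract (b.coord i) (b.coord j) T := by
  induction T with
  | zero => simp [contract]
  | tmul u v => simp [contract_tmul, mul_comm]
  | add S T hS hT => rw [contract_add, map_add, Finsupp.add_apply, hS, hT]

/-- A two-tensor is determined by its values on pairs of linear forms. -/
theorem tensor_ext [FiniteDimensional ℝ V] {S T : V ⊗[ℝ] V}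
    (h : ∀ α β : V →ₗ[ℝ] ℝ, contract α β S = contract α β T) : S = T := by
  let b := Module.finBasis ℝ V
  refine (b.tensorProduct b).ext_elem fun ⟨i, j⟩ => ?_
  rw [tensorProduct_repr_eq_contract, tensorProduct_repr_eq_contract, h]

theorem contract_eq_sum (α β : V →ₗ[ℝ] ℝ) (T : V ⊗[ℝ] V) :
    contract α β T = ∑ i, ∑ j, α (b i) * β (b j) * contract (b.coord i) (b.coord j) T := by
  conv_lhs => rw [← (b.tensorProduct b).sum_repr T]
  rw [contract_sum, Fintype.sum_prod_type]
  refine Finset.sum_congr rfl fun i _ => Finset.sum_congr rfl fun j _ => ?_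
  rw [contract_smul, tensorProduct_repr_eq_contract, Module.Basis.tensorProduct_apply,
    contract_tmul]
  ring

/-- The contraction of the first slot: the vector `(α ⊗ 1) T`. -/
def contractLeft (α : V →ₗ[ℝ] ℝ) (T : V ⊗[ℝ] V) : V :=
  TensorProduct.lid ℝ V (TensorProduct.map α LinearMap.id T)

/-- The contraction of the second slot: the vector `(1 ⊗ β) T`. -/
def contractRight (β : V →ₗ[ℝ] ℝ) (T : V ⊗[ℝ] V) : V :=
  TensorProduct.rid ℝ V (TensorProduct.map LinearMap.id β T)

theorem apply_contractLeft (α β : V →ₗ[ℝ] ℝ) (T : V ⊗[ℝ] V) :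
    β (contractLeft α T) = contract α β T := by
  induction T with
  | zero => simp [contract, contractLeft]
  | tmul u v => simp [contract, contractLeft]
  | add S T hS hT => simp only [contract, contractLeft, map_add] at hS hT ⊢; rw [hS, hT]

theorem apply_contractRight (α β : V →ₗ[ℝ] ℝ) (T : V ⊗[ℝ] V) :
    α (contractRight β T) = contract α β T := by
  induction T with
  | zero => simp [contract, contractRight]
  | tmul u v => simp [contract, contractRight, mul_comm]
  | add S T hS hT => simp only [contract, contractRight, map_add] at hS hT ⊢; rw [hS, hT]

theorem tensorSq_injective {L : V →ₗ[ℝ] W} (hL : Function.Injective L) :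
    Function.Injective (tensorSq L) := by
  obtain ⟨L', h⟩ := L.exists_leftInverse_of_injective (LinearMap.ker_eq_bot.2 hL)
  refine Function.LeftInverse.injective (g := tensorSq L') fun T => ?_
  rw [tensorSq_comp, h, tensorSq, TensorProduct.map_id]
  rfl

/-! The Lie algebra, its dual and the double carry several definitionally equal additive structures,
which rewriting does not identify on the tensor squares. The identities between sums and
differences are therefore stated for abstract modules. -/

theorem tensorSq_half_sub_add (L : V →ₗ[ℝ] W) (S T N : V ⊗[ℝ] V) :
    tensorSq L ((1 / 2 : ℝ) • (T - S) + N) =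
      -(1 / 2 : ℝ) • (tensorSq L S - tensorSq L T) + tensorSq L N := by
  simp only [map_add, map_smul, map_sub, neg_smul, ← smul_neg, neg_sub]

theorem tensorSq_neg_half_sub (L : V →ₗ[ℝ] W) (S T : V ⊗[ℝ] V) :
    tensorSq L (-((1 / 2 : ℝ) • (T - S))) =
      (1 / 2 : ℝ) • tensorSq L S - (1 / 2 : ℝ) • tensorSq L T := by
  rw [← smul_neg, neg_sub, map_smul, map_sub, smul_sub]

theorem comm_smul_tensorSq_of_skew (c : ℝ) {L : V →ₗ[ℝ] W} {T : V ⊗[ℝ] V}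
    (hT : TensorProduct.comm ℝ V V T = -T) :
    TensorProduct.comm ℝ W W (c • tensorSq L T) = -(c • tensorSq L T) := by
  rw [map_smul, tensorSq_comm, hT, map_neg, smul_neg]

theorem half_sub_add_half_sub (R S T : V ⊗[ℝ] V) :
    (1 / 2 : ℝ) • (T - R) = (1 / 2 : ℝ) • (S - R) + (1 / 2 : ℝ) • (T - S) := by
  rw [← smul_add]
  congr 1
  abel

theorem apply_map_contractRight (L : V →ₗ[ℝ] W) (β : V →ₗ[ℝ] ℝ) (T : V ⊗[ℝ] V) :
    L (contractRight β T) = TensorProduct.rid ℝ W (TensorProduct.map L β T) := by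
  induction T with
  | zero => simp [contractRight]
  | tmul u v => simp [contractRight]
  | add S T hS hT => simp only [contractRight, map_add] at hS hT ⊢; rw [hS, hT]

/-- The bracket relation in an abstract form: `R` and `S` stand for `R₁₂` and its image under the
adjoint action, `m` for `½ (S - R)`, and `L` for a right translation. -/
theorem tensorSq_eq_iff_eq_add {U : Type*} [AddCommGroup U] [Module ℝ U] {i : U →ₗ[ℝ] V}
    {L : V →ₗ[ℝ] W} (hi : Function.Injective i) (hL : Function.Injective L)
    {R S : V ⊗[ℝ] V} {m : U ⊗[ℝ] U}
    (hm : tensorSq i m = (1 / 2 : ℝ) • (S - R)) (T N : U ⊗[ℝ] U) :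
    tensorSq L (tensorSq i T) =
        -(1 / 2 : ℝ) • (tensorSq L R - tensorSq L S) + tensorSq L (tensorSq i N) ↔
      T = m + N := by
  rw [← tensorSq_half_sub_add, ← hm, ← map_add, (tensorSq_injective hL).eq_iff,
    (tensorSq_injective hi).eq_iff]

theorem tensorSq_neg (L : V →ₗ[ℝ] W) (T : V ⊗[ℝ] V) : tensorSq L (-T) = -tensorSq L T := map_neg _ _

theorem comm_neg_of_skew {T : V ⊗[ℝ] V}
    (hT : TensorProduct.comm ℝ V V T = -T) : TensorProduct.comm ℝ V V (-T) = -(-T) := by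
  rw [map_neg, hT]

theorem tensorSq_add_eq_zero (L : V →ₗ[ℝ] W) {S T : V ⊗[ℝ] V} (h : S = -T) :
    tensorSq L (S + T) = 0 := by
  rw [h, neg_add_cancel, map_zero]

theorem sub_add_eq_of_zero_eq_add {t u v w : V ⊗[ℝ] V} (h : 0 = u + w) :
    t - (u + v) = t - v + w := by
  rw [eq_neg_of_add_eq_zero_left h.symm]
  abel

/-- A tensor on a product all of whose coefficients on forms vanishing on the second factor are
zero is a tensor on the second factor. -/
theorem tensorSq_inr_snd_eq [FiniteDimensional ℝ V] [FiniteDimensional ℝ W]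
    {T : (V × W) ⊗[ℝ] (V × W)}
    (h₁ : ∀ σ τ : V × W →ₗ[ℝ] ℝ, σ ∘ₗ LinearMap.inr ℝ V W = 0 → contract σ τ T = 0)
    (h₂ : ∀ σ τ : V × W →ₗ[ℝ] ℝ, τ ∘ₗ LinearMap.inr ℝ V W = 0 → contract σ τ T = 0) :
    tensorSq (LinearMap.inr ℝ V W) (tensorSq (LinearMap.snd ℝ V W) T) = T := by
  refine tensor_ext fun σ τ => ?_
  have dec : ∀ σ : V × W →ₗ[ℝ] ℝ, σ = (σ ∘ₗ LinearMap.inl ℝ V W) ∘ₗ LinearMap.fst ℝ V W +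
      (σ ∘ₗ LinearMap.inr ℝ V W) ∘ₗ LinearMap.snd ℝ V W := fun σ => by
    ext <;> simp <;> exact σ.map_zero
  have z : ∀ σ : V × W →ₗ[ℝ] ℝ,
      ((σ ∘ₗ LinearMap.inl ℝ V W) ∘ₗ LinearMap.fst ℝ V W) ∘ₗ LinearMap.inr ℝ V W = 0 :=
    fun σ => by
    ext
    simp
    exact σ.map_zero
  rw [contract_tensorSq, contract_tensorSq]
  conv_rhs => rw [dec σ, dec τ, contract_add_left, contract_add_right, contract_add_right]
  rw [h₁ _ _ (z σ), h₁ _ _ (z σ), h₂ _ _ (z τ), zero_add, zero_add, zero_add]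

end Contract

section DoubleAlgebra

variable {E : Type*} [NormedAddCommGroup E] [NormedSpace ℝ E] [FiniteDimensional ℝ E]
  {G : Type*} [TopologicalSpace G] [ChartedSpace E G] [Group G] [T2Space G]
  [LieGroup 𝓘(ℝ, E) ∞ G]

/-- The linear form `⟨p | ·⟩` on the double. -/
def pairingForm (p : Double E G) : Double E G →ₗ[ℝ] ℝ :=
  (Module.Dual.eval ℝ (LieAlg E G) p.1) ∘ₗ LinearMap.snd ℝ _ _ + p.2 ∘ₗ LinearMap.fst ℝ _ _

theorem pairingForm_apply (p u : Double E G) : pairingForm p u = pairing p u := rfl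

theorem exists_pairingForm (σ : Double E G →ₗ[ℝ] ℝ) : ∃ p, pairingForm p = σ := by
  refine ⟨((Module.evalEquiv ℝ (LieAlg E G)).symm (σ ∘ₗ LinearMap.inr ℝ _ _),
    σ ∘ₗ LinearMap.inl ℝ _ _), ?_⟩
  ext u
  · simp [pairingForm_apply, pairing]
  · simp [pairingForm_apply, pairing, Module.apply_evalEquiv_symm_apply]
    exact σ.map_zero

variable {κ : Type*} [Fintype κ] (b : Module.Basis κ ℝ (LieAlg E G))

theorem comm_canonicalR :
    TensorProduct.comm ℝ _ _ (canonicalR b) = -canonicalR b :=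
  comm_sum_tmul_sub _ _

theorem contract_canonicalR (p q : Double E G) :
    contract (pairingForm p) (pairingForm q) (canonicalR b) = p.2 q.1 - q.2 p.1 := by
  have h : ∀ (lam : Module.Dual ℝ (LieAlg E G)) (X : LieAlg E G),
      ∑ a, lam (b a) * b.coord a X = lam X := by
    intro lam X
    conv_rhs => rw [← b.sum_repr X, map_sum]
    simp [mul_comm]
  rw [canonicalR, contract_sum]
  simp only [contract_sub, contract_tmul, pairingForm_apply, pairing, map_zero, zero_add, add_zero,
    LinearMap.zero_apply, Finset.sum_sub_distrib, h]
  congr 1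
  simp only [mul_comm (b.coord _ _), h]

theorem tensorSq_snd_canonicalR :
    tensorSq (LinearMap.snd ℝ (LieAlg E G) (Module.Dual ℝ (LieAlg E G))) (canonicalR b) = 0 := by
  simp [canonicalR]

/-- The derivative of the canonical tensor under the adjoint action of `ξ ∈ 𝔤*`: it is minus twice
the cobracket dual to the Lie bracket of `𝔤`. -/
theorem contract_ad_canonicalR (π : PoissonStructure E G) (ξ : Module.Dual ℝ (LieAlg E G))
    {T : Double E G →ₗ[ℝ] Double E G} (hT : ∀ u, T u = doubleBracket π (0, ξ) u)
    (σ τ : Double E G →ₗ[ℝ] ℝ) (X Y : LieAlg E G) (hσ : ∀ lam, σ (0, lam) = lam X)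
    (hτ : ∀ lam, τ (0, lam) = lam Y) :
    contract (σ ∘ₗ T) τ (canonicalR b) + contract σ (τ ∘ₗ T) (canonicalR b) = -2 * ξ ⁅X, Y⁆ := by
  obtain ⟨p, rfl⟩ := exists_pairingForm σ
  obtain ⟨q, rfl⟩ := exists_pairingForm τ
  have e : ∀ {p : Double E G} {X}, (∀ lam, pairingForm p (0, lam) = lam X) → p.1 = X := by
    intro p X h
    refine sub_eq_zero.1 ((Module.forall_dual_apply_eq_zero_iff ℝ _).1 fun nu => ?_)
    have := h nu
    simp only [pairingForm_apply, pairing, map_zero, add_zero] at this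
    rw [map_sub, this, sub_self]
  obtain rfl := e hσ
  obtain rfl := e hτ
  have h : ∀ p : Double E G, pairingForm p ∘ₗ T = pairingForm (doubleBracket π p (0, ξ)) := by
    intro p
    ext1 <;> ext1 u <;>
    · simp only [LinearMap.comp_apply, hT]
      exact (pairing_doubleBracket π _ _ _).symm
  rw [h, h, contract_canonicalR, contract_canonicalR]
  have h1 : ξ ⁅q.1, p.1⁆ = -ξ ⁅p.1, q.1⁆ := by rw [← lie_skew, map_neg]
  have h2 : dualBracket π q.2 ξ p.1 = -dualBracket π ξ q.2 p.1 := by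
    rw [dualBracket_skew]
    rfl
  have h3 : dualBracket π p.2 ξ q.1 = -dualBracket π ξ p.2 q.1 := by
    rw [dualBracket_skew]
    rfl
  have h4 : ∀ nu : Module.Dual ℝ (LieAlg E G), dualCoad π nu 0 = 0 := fun nu => by
    refine (Module.forall_dual_apply_eq_zero_iff ℝ _).1 fun nu' => ?_
    rw [apply_dualCoad, map_zero]
  simp only [doubleBracket, LinearMap.add_apply, LinearMap.sub_apply,
    LinearMap.comp_apply, LieAlgebra.ad_apply, map_add, map_sub, apply_dualCoad, map_zero,
    LinearMap.zero_apply, lie_zero, h4]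
  linarith

/-- If `B'` is an isometry of the double that maps `𝔤*` to itself, and `B` is its adjoint, then
`(B ⊗ B) R - R` lies in `𝔤* ⊗ 𝔤*`. -/
theorem tensorSq_inr_canonicalR {B B' : Double E G →ₗ[ℝ] Double E G}
    (hB : ∀ u v, pairing u (B v) = pairing (B' u) v)
    (hB' : ∀ u v, pairing (B' u) (B' v) = pairing u v) (h0 : ∀ lam, (B' (0, lam)).1 = 0) :
    tensorSq (LinearMap.inr ℝ _ _)
        (tensorSq (LinearMap.snd ℝ (LieAlg E G) (Module.Dual ℝ (LieAlg E G)) ∘ₗ B)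
          (canonicalR b)) = tensorSq B (canonicalR b) - canonicalR b := by
  have hs : ∀ p q : Double E G,
      contract (pairingForm p) (pairingForm q) (tensorSq B (canonicalR b) - canonicalR b) =
        ((B' p).2 (B' q).1 - (B' q).2 (B' p).1) - (p.2 q.1 - q.2 p.1) := by
    intro p q
    have h : ∀ p : Double E G, pairingForm p ∘ₗ B = pairingForm (B' p) := by
      intro p
      ext1 <;> ext1 u <;> exact hB _ _
    rw [contract_sub, contract_tensorSq, h, h, contract_canonicalR, contract_canonicalR]
  have e : ∀ p : Double E G, pairingForm p ∘ₗ LinearMap.inr ℝ _ _ = 0 → p.1 = 0 := by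
    intro p h
    refine (Module.forall_dual_apply_eq_zero_iff ℝ _).1 fun nu => ?_
    simpa [pairingForm_apply, pairing] using LinearMap.congr_fun h nu
  have e' : ∀ p : Double E G, p.1 = 0 → (B' p).1 = 0 := by
    rintro ⟨X, lam⟩ h
    obtain rfl : X = 0 := h
    exact h0 lam
  have key := tensorSq_inr_snd_eq (T := tensorSq B (canonicalR b) - canonicalR b) ?_ ?_
  · have h := tensorSq_sub_of_eq_zero (tensorSq_snd_canonicalR b) (tensorSq B (canonicalR b))
    rw [tensorSq_comp] at h
    rw [h] at key
    exact key
  · intro σ τ hσ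
    obtain ⟨p, rfl⟩ := exists_pairingForm σ
    obtain ⟨q, rfl⟩ := exists_pairingForm τ
    have hp := e p hσ
    have := hB' p q
    rw [hs]
    simp only [pairing, hp, e' p hp, map_zero] at this ⊢
    linarith
  · intro σ τ hτ
    obtain ⟨p, rfl⟩ := exists_pairingForm σ
    obtain ⟨q, rfl⟩ := exists_pairingForm τ
    have hq := e q hτ
    have := hB' p q
    rw [hs]
    simp only [pairing, hq, e' q hq, map_zero] at this ⊢
    linarith

end DoubleAlgebra

/-! ### Differentiating contractions -/

section DiffContract

variable {F : Type*} [NormedAddCommGroup F] [NormedSpace ℝ F]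
  {M : Type*} [TopologicalSpace M] [ChartedSpace F M] {x : M}

theorem differential_mul {f g : M → ℝ} (hf : MDifferentiableAt 𝓘(ℝ, F) 𝓘(ℝ, ℝ) f x)
    (hg : MDifferentiableAt 𝓘(ℝ, F) 𝓘(ℝ, ℝ) g x) (v : TangentSpace 𝓘(ℝ, F) x) :
    differential 𝓘(ℝ, F) (fun y => f y * g y) x v =
      f x * differential 𝓘(ℝ, F) g x v + g x * differential 𝓘(ℝ, F) f x v := by
  have h := (hf.hasMFDerivAt.mul hg.hasMFDerivAt).mfderiv
  change mfderiv 𝓘(ℝ, F) 𝓘(ℝ, ℝ) (f * g) x v = _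
  rw [h]
  rfl

theorem mdifferentiableAt_mul {f g : M → ℝ} (hf : MDifferentiableAt 𝓘(ℝ, F) 𝓘(ℝ, ℝ) f x)
    (hg : MDifferentiableAt 𝓘(ℝ, F) 𝓘(ℝ, ℝ) g x) :
    MDifferentiableAt 𝓘(ℝ, F) 𝓘(ℝ, ℝ) (fun y => f y * g y) x :=
  (hf.hasMFDerivAt.mul hg.hasMFDerivAt).mdifferentiableAt

theorem differential_const (c : ℝ) : differential 𝓘(ℝ, F) (fun _ : M => c) x = 0 := by
  ext v
  change mfderiv 𝓘(ℝ, F) 𝓘(ℝ, ℝ) (fun _ : M => c) x v = 0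
  rw [mfderiv_const]
  rfl

theorem differential_congr {f g : M → ℝ} (h : ∀ y, f y = g y) :
    differential 𝓘(ℝ, F) f x = differential 𝓘(ℝ, F) g x := by
  rw [funext h]

theorem differential_sum {ι : Type*} (s : Finset ι) {f : ι → M → ℝ}
    (hf : ∀ i, MDifferentiableAt 𝓘(ℝ, F) 𝓘(ℝ, ℝ) (f i) x) :
    MDifferentiableAt 𝓘(ℝ, F) 𝓘(ℝ, ℝ) (fun y => ∑ i ∈ s, f i y) x ∧
      ∀ v, differential 𝓘(ℝ, F) (fun y => ∑ i ∈ s, f i y) x v =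
        ∑ i ∈ s, differential 𝓘(ℝ, F) (f i) x v := by
  classical
  induction s using Finset.induction_on with
  | empty => simp [mdifferentiableAt_const, differential_const]
  | insert i s hi ih =>
    simp only [Finset.sum_insert hi]
    refine ⟨(hf i).add ih.1, fun v => ?_⟩
    rw [← ih.2 v, ← LinearMap.add_apply, ← differential_add (hf i) ih.1]
    rfl

variable {V : Type*} [AddCommGroup V] [Module ℝ V] [FiniteDimensional ℝ V]

/-- The product rule for the evaluation of a variable linear form at a variable vector. -/
theorem differential_apply_apply {τ : M → V →ₗ[ℝ] ℝ} {w : M → V}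
    (hτ : ∀ v, MDifferentiableAt 𝓘(ℝ, F) 𝓘(ℝ, ℝ) (fun y => τ y v) x)
    (hw : ∀ σ : V →ₗ[ℝ] ℝ, MDifferentiableAt 𝓘(ℝ, F) 𝓘(ℝ, ℝ) (fun y => σ (w y)) x)
    (Y : TangentSpace 𝓘(ℝ, F) x) {τ' : V →ₗ[ℝ] ℝ}
    (hτ' : ∀ v, differential 𝓘(ℝ, F) (fun y => τ y v) x Y = τ' v) :
    differential 𝓘(ℝ, F) (fun y => τ y (w y)) x Y =
      τ' (w x) + differential 𝓘(ℝ, F) (fun y => τ x (w y)) x Y := by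
  let b := Module.finBasis ℝ V
  have e : ∀ (τ : V →ₗ[ℝ] ℝ) w, τ w = ∑ i, τ (b i) * b.coord i w := by
    intro τ w
    conv_lhs => rw [← b.sum_repr w, map_sum]
    simp [mul_comm]
  rw [differential_congr fun y => e (τ y) (w y), differential_congr fun y => e (τ x) (w y),
    (differential_sum _ fun i => mdifferentiableAt_mul (hτ (b i)) (hw (b.coord i))).2,
    (differential_sum _ fun i => mdifferentiableAt_mul mdifferentiableAt_const
      (hw (b.coord i))).2, e τ' (w x), ← Finset.sum_add_distrib]
  refine Finset.sum_congr rfl fun i _ => ?_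
  rw [differential_mul (hτ (b i)) (hw (b.coord i)),
    differential_mul mdifferentiableAt_const (hw (b.coord i)), differential_const, hτ']
  simp only [LinearMap.zero_apply]
  ring

/-- The product rule for the contraction of a variable tensor with variable linear forms. -/
theorem differential_contract {α β : M → V →ₗ[ℝ] ℝ} {T : M → V ⊗[ℝ] V}
    (hα : ∀ v, MDifferentiableAt 𝓘(ℝ, F) 𝓘(ℝ, ℝ) (fun y => α y v) x)
    (hβ : ∀ v, MDifferentiableAt 𝓘(ℝ, F) 𝓘(ℝ, ℝ) (fun y => β y v) x)
    (hT : ∀ σ τ, MDifferentiableAt 𝓘(ℝ, F) 𝓘(ℝ, ℝ) (fun y => contract σ τ (T y)) x)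
    (Y : TangentSpace 𝓘(ℝ, F) x) {α' β' : V →ₗ[ℝ] ℝ}
    (hα' : ∀ v, differential 𝓘(ℝ, F) (fun y => α y v) x Y = α' v)
    (hβ' : ∀ v, differential 𝓘(ℝ, F) (fun y => β y v) x Y = β' v) :
    differential 𝓘(ℝ, F) (fun y => contract (α y) (β y) (T y)) x Y =
      contract α' (β x) (T x) + contract (α x) β' (T x) +
        differential 𝓘(ℝ, F) (fun y => contract (α x) (β x) (T y)) x Y := by
  let b := Module.finBasis ℝ V
  have h1 : ∀ i j, MDifferentiableAt 𝓘(ℝ, F) 𝓘(ℝ, ℝ) (fun y => α y (b i) * β y (b j)) x :=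
    fun i j => mdifferentiableAt_mul (hα _) (hβ _)
  have h2 := fun i j => mdifferentiableAt_mul (h1 i j) (hT (b.coord i) (b.coord j))
  have h3 := fun i j => mdifferentiableAt_mul
    (mdifferentiableAt_const (I := 𝓘(ℝ, F)) (x := x) (c := α x (b i) * β x (b j)))
    (hT (b.coord i) (b.coord j))
  rw [differential_congr fun y => contract_eq_sum b (α y) (β y) (T y),
    differential_congr fun y => contract_eq_sum b (α x) (β x) (T y),
    (differential_sum _ fun i => (differential_sum _ fun j => h2 i j).1).2,
    (differential_sum _ fun i => (differential_sum _ fun j => h3 i j).1).2,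
    contract_eq_sum b α', contract_eq_sum b _ β', ← Finset.sum_add_distrib,
    ← Finset.sum_add_distrib]
  refine Finset.sum_congr rfl fun i _ => ?_
  rw [(differential_sum _ fun j => h2 i j).2, (differential_sum _ fun j => h3 i j).2,
    ← Finset.sum_add_distrib, ← Finset.sum_add_distrib]
  refine Finset.sum_congr rfl fun j _ => ?_
  rw [differential_mul (h1 i j) (hT _ _), differential_mul mdifferentiableAt_const (hT _ _),
    differential_mul (hα _) (hβ _), hα', hβ', differential_const]
  simp only [LinearMap.zero_apply]
  ring

theorem contMDiff_contract {α β : M → V →ₗ[ℝ] ℝ} {T : M → V ⊗[ℝ] V}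
    (hα : ∀ v, ContMDiff 𝓘(ℝ, F) 𝓘(ℝ, ℝ) ∞ (fun y => α y v))
    (hβ : ∀ v, ContMDiff 𝓘(ℝ, F) 𝓘(ℝ, ℝ) ∞ (fun y => β y v))
    (hT : ∀ σ τ, ContMDiff 𝓘(ℝ, F) 𝓘(ℝ, ℝ) ∞ (fun y => contract σ τ (T y))) :
    ContMDiff 𝓘(ℝ, F) 𝓘(ℝ, ℝ) ∞ (fun y => contract (α y) (β y) (T y)) := by
  let b := Module.finBasis ℝ V
  have := ContMDiff.sum (t := Finset.univ) fun i _ => ContMDiff.sum (t := Finset.univ)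
    fun j _ => ((hα (b i)).mul (hβ (b j))).mul (hT (b.coord i) (b.coord j))
  refine this.congr fun y => ?_
  rw [contract_eq_sum b]
  rfl

/-- A vector valued function is smooth if it is so after pairing with a family of variable smooth
linear forms that restricts to a basis of the dual at the point: near the point the linear system
is solved by Cramer's rule. -/
theorem contMDiffAt_apply_of_frame {ι : Type*} [Fintype ι] [DecidableEq ι]
    (b : Module.Basis ι ℝ V) {τ : ι → M → V →ₗ[ℝ] ℝ} {w : M → V}
    (hτ : ∀ i v, ContMDiff 𝓘(ℝ, F) 𝓘(ℝ, ℝ) ∞ (fun y => τ i y v))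
    (hτx : ∀ i, τ i x = b.coord i)
    (hw : ∀ i, ContMDiff 𝓘(ℝ, F) 𝓘(ℝ, ℝ) ∞ (fun y => τ i y (w y))) (σ : V →ₗ[ℝ] ℝ) :
    ContMDiffAt 𝓘(ℝ, F) 𝓘(ℝ, ℝ) ∞ (fun y => σ (w y)) x := by
  let A : M → Matrix ι ι ℝ := fun y => Matrix.of fun i j => τ i y (b j)
  let u : M → ι → ℝ := fun y i => τ i y (w y)
  have hdet : ∀ B : M → Matrix ι ι ℝ,
      (∀ i j, ContMDiff 𝓘(ℝ, F) 𝓘(ℝ, ℝ) ∞ (fun y => B y i j)) →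
      ContMDiff 𝓘(ℝ, F) 𝓘(ℝ, ℝ) ∞ (fun y => (B y).det) := by
    intro B hB
    simp only [Matrix.det_apply']
    exact ContMDiff.sum fun p _ => contMDiff_const.mul (ContMDiff.prod fun i _ => hB _ _)
  have hA : ∀ i j, ContMDiff 𝓘(ℝ, F) 𝓘(ℝ, ℝ) ∞ (fun y => A y i j) := fun i j => hτ i (b j)
  have hAx : (A x).det = 1 := by
    have : A x = 1 := by
      ext i j
      simp [A, hτx, Matrix.one_apply, Finsupp.single_apply, eq_comm]
    rw [this, Matrix.det_one]
  have hAu : ∀ y, (A y).mulVec (b.repr (w y)) = u y := by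
    intro y
    ext i
    simp only [Matrix.mulVec, dotProduct, A, u, Matrix.of_apply]
    conv_rhs => rw [← b.sum_repr (w y), map_sum]
    simp [mul_comm]
  have hcr : ∀ y i, (A y).det * b.repr (w y) i = (A y).cramer (u y) i := by
    intro y i
    rw [← hAu y, Matrix.cramer_eq_adjugate_mulVec, Matrix.mulVec_mulVec, Matrix.adjugate_mul,
      Matrix.smul_mulVec, Matrix.one_mulVec]
    rfl
  have hne : ∀ᶠ y in nhds x, (A y).det ≠ 0 :=
    (hdet A hA).continuous.continuousAt.eventually_ne (by rw [hAx]; exact one_ne_zero)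
  have hi : ∀ i, ContMDiffAt 𝓘(ℝ, F) 𝓘(ℝ, ℝ) ∞ (fun y => b.repr (w y) i) x := by
    intro i
    have h1 : ContMDiff 𝓘(ℝ, F) 𝓘(ℝ, ℝ) ∞ (fun y => (A y).cramer (u y) i) := by
      simp only [Matrix.cramer_apply]
      refine hdet _ fun k l => ?_
      by_cases h : l = i
      · simpa [Matrix.updateCol_apply, h, u] using hw k
      · simpa [Matrix.updateCol_apply, h] using hA k l
    have h2 : ContMDiffAt 𝓘(ℝ, F) 𝓘(ℝ, ℝ) ∞ (fun y => ((A y).det)⁻¹) x :=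
      ((contDiffAt_inv ℝ (by rw [hAx]; exact one_ne_zero)).contMDiffAt).comp x
        (hdet A hA).contMDiffAt
    refine (h2.mul h1.contMDiffAt).congr_of_eventuallyEq ?_
    filter_upwards [hne] with y hy
    simp only [Pi.mul_apply]
    rw [← hcr, inv_mul_cancel_left₀ hy]
  have := ContMDiffAt.sum (t := Finset.univ) fun i _ =>
    (contMDiffAt_const (I := 𝓘(ℝ, F)) (n := ∞) (x := x) (c := σ (b i))).mul (hi i)
  refine this.congr_of_eventuallyEq (Filter.Eventually.of_forall fun y => ?_)
  change σ (w y) = _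
  conv_lhs => rw [← b.sum_repr (w y), map_sum]
  simp [mul_comm]

/-- A function on a connected manifold with vanishing differential is constant. -/
theorem eq_of_differential_eq_zero [IsManifold 𝓘(ℝ, F) ∞ M] [PreconnectedSpace M] {f : M → ℝ}
    (hf : ContMDiff 𝓘(ℝ, F) 𝓘(ℝ, ℝ) ∞ f) (h : ∀ x, differential 𝓘(ℝ, F) f x = 0) (x y : M) :
    f x = f y := by
  refine IsLocallyConstant.apply_eq_of_preconnectedSpace
    ((IsLocallyConstant.iff_eventually_eq f).2 fun x => ?_) x y
  let φ := extChartAt 𝓘(ℝ, F) x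
  have hF : ∀ z ∈ φ.target, HasFDerivAt (f ∘ φ.symm) (0 : F →L[ℝ] ℝ) z := by
    intro z hz
    have h1 : ContMDiffAt 𝓘(ℝ, F) 𝓘(ℝ, F) ∞ φ.symm z :=
      (contMDiffOn_extChartAt_symm x).contMDiffAt ((isOpen_extChartAt_target x).mem_nhds hz)
    have h2 : DifferentiableAt ℝ (f ∘ φ.symm) z :=
      ((hf.contMDiffAt.comp z h1).mdifferentiableAt (by simp)).differentiableAt
    have h3 : fderiv ℝ (f ∘ φ.symm) z = 0 := by
      ext v
      rw [← mfderiv_eq_fderiv]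
      refine (mfderiv_comp_apply z (hf.mdifferentiable (by simp) _)
        (h1.mdifferentiableAt (by simp)) v).trans ?_
      exact LinearMap.congr_fun (h (φ.symm z)) _
    rw [← h3]
    exact h2.hasFDerivAt
  obtain ⟨r, hr, hball⟩ := Metric.isOpen_iff.1 (isOpen_extChartAt_target (I := 𝓘(ℝ, F)) x) _
    (mem_extChartAt_target (I := 𝓘(ℝ, F)) x)
  have hev : ∀ᶠ z in nhds x, z ∈ φ.source ∧ φ z ∈ Metric.ball (φ x) r :=
    Filter.Eventually.and (extChartAt_source_mem_nhds x)
      ((continuousAt_extChartAt x).eventually_mem (Metric.ball_mem_nhds _ hr))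
  filter_upwards [hev] with z hz
  have := (convex_ball (φ x) r).is_const_of_fderivWithin_eq_zero (𝕜 := ℝ) (f := f ∘ φ.symm)
    (fun w hw => (hF w (hball hw)).differentiableAt.differentiableWithinAt)
    (fun w hw => by
      rw [fderivWithin_of_isOpen Metric.isOpen_ball hw, (hF w (hball hw)).fderiv])
    hz.2 (Metric.mem_ball_self hr)
  have hx := φ.left_inv (mem_extChartAt_source (I := 𝓘(ℝ, F)) x)
  have hz' := φ.left_inv hz.1
  simpa only [Function.comp_apply, hx, hz'] using this

end DiffContract

/-! ### Hamiltonian vector fields and maps to a Lie group -/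

section Hamiltonian

variable {F : Type*} [NormedAddCommGroup F] [NormedSpace ℝ F]
  {M : Type*} [TopologicalSpace M] [ChartedSpace F M] (P : PoissonStructure F M)

/-- The Hamiltonian vector field of `f`, for which `dh (hamVec f) = {h, f}`. -/
def hamVec (f : M → ℝ) (x : M) : TangentSpace 𝓘(ℝ, F) x :=
  contractRight (differential 𝓘(ℝ, F) f x) (P.tensor x)

theorem differential_hamVec (h f : M → ℝ) (x : M) :
    differential 𝓘(ℝ, F) h x (hamVec P f x) = bracket P.tensor h f x :=
  apply_contractRight _ _ _

theorem apply_hamVec (x : M) (α : TangentSpace 𝓘(ℝ, F) x →ₗ[ℝ] ℝ) (f : M → ℝ) :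
    α (hamVec P f x) = contract α (differential 𝓘(ℝ, F) f x) (P.tensor x) :=
  apply_contractRight _ _ _

variable {Es : Type*} [NormedAddCommGroup Es] [NormedSpace ℝ Es]
  {Gs : Type*} [TopologicalSpace Gs] [ChartedSpace Es Gs] [Group Gs]
  {V : Type*} [AddCommGroup V] [Module ℝ V] (θ : V ≃ₗ[ℝ] LieAlg Es Gs) (Γ : M → Gs)

/-- The left logarithmic derivative `Γ⁻¹ dΓ` of a map to a Lie group, seen in a model `V` of the
Lie algebra. -/
def logDeriv (x : M) : TangentSpace 𝓘(ℝ, F) x →ₗ[ℝ] V :=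
  θ.symm.toLinearMap ∘ₗ leftTrivialize (Γ x) ∘ₗ
    (mfderiv 𝓘(ℝ, F) 𝓘(ℝ, Es) Γ x : TangentSpace 𝓘(ℝ, F) x →ₗ[ℝ] TangentSpace 𝓘(ℝ, Es) (Γ x))

/-- The bracket `{Γ₁, Γ₂}` translated on the left to the identity. -/
def logBivector (x : M) : V ⊗[ℝ] V := tensorSq (logDeriv (F := F) θ Γ x) (P.tensor x)

/-- The element `Γ⁻¹ {Γ, f}` of the Lie algebra. -/
def logBracket (f : M → ℝ) (x : M) : V := logDeriv θ Γ x (hamVec P f x)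

/-- The linear form `v ↦ (θ v) φ` on `V`, at the point `g`, where elements of the Lie algebra act by
left invariant derivations. -/
def leftForm (φ : Gs → ℝ) (g : Gs) : V →ₗ[ℝ] ℝ :=
  differential 𝓘(ℝ, Es) φ g ∘ₗ leftTranslate g ∘ₗ θ.toLinearMap

theorem leftForm_apply (φ : Gs → ℝ) (g : Gs) (v : V) :
    leftForm θ φ g v = leftDeriv φ (θ v) g := rfl

theorem logBivector_skew (x : M) :
    TensorProduct.comm ℝ V V (logBivector P θ Γ x) = -logBivector P θ Γ x := by
  have h := tensorSq_comm (logDeriv (F := F) θ Γ x) (P.tensor x)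
  rw [P.skew] at h
  exact h.trans (map_neg _ _)

theorem contract_logBivector (σ τ : V →ₗ[ℝ] ℝ) (x : M) :
    contract σ τ (logBivector P θ Γ x) =
      contract (σ ∘ₗ logDeriv (F := F) θ Γ x) (τ ∘ₗ logDeriv (F := F) θ Γ x) (P.tensor x) :=
  contract_tensorSq _ _ _ _

theorem apply_logBracket (σ : V →ₗ[ℝ] ℝ) (f : M → ℝ) (x : M) :
    σ (logBracket P θ Γ f x) =
      contract (σ ∘ₗ logDeriv (F := F) θ Γ x) (differential 𝓘(ℝ, F) f x) (P.tensor x) :=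
  apply_hamVec P x (σ ∘ₗ logDeriv (F := F) θ Γ x) f

variable [LieGroup 𝓘(ℝ, Es) ∞ Gs] {Γ}

theorem differential_comp_map (hΓ : ContMDiff 𝓘(ℝ, F) 𝓘(ℝ, Es) ∞ Γ) {φ : Gs → ℝ}
    (hφ : ContMDiff 𝓘(ℝ, Es) 𝓘(ℝ, ℝ) ∞ φ) (x : M) :
    differential 𝓘(ℝ, F) (φ ∘ Γ) x = leftForm θ φ (Γ x) ∘ₗ logDeriv θ Γ x := by
  ext v
  have h := mfderiv_comp_apply x (hφ.mdifferentiable (by simp) (Γ x))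
    (hΓ.mdifferentiable (by simp) x) v
  refine h.trans ?_
  simp only [logDeriv, LinearMap.comp_apply, leftForm_apply, LinearEquiv.coe_coe,
    LinearEquiv.apply_symm_apply, leftDeriv, leftTranslate_leftTrivialize]
  rfl

theorem differential_comp_map_apply (hΓ : ContMDiff 𝓘(ℝ, F) 𝓘(ℝ, Es) ∞ Γ) {φ : Gs → ℝ}
    (hφ : ContMDiff 𝓘(ℝ, Es) 𝓘(ℝ, ℝ) ∞ φ) (x : M) (Y : TangentSpace 𝓘(ℝ, F) x) :
    differential 𝓘(ℝ, F) (fun y => φ (Γ y)) x Y = leftDeriv φ (θ (logDeriv θ Γ x Y)) (Γ x) :=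
  LinearMap.congr_fun (differential_comp_map θ hΓ hφ x) Y

theorem bracket_comp_map (hΓ : ContMDiff 𝓘(ℝ, F) 𝓘(ℝ, Es) ∞ Γ) {φ : Gs → ℝ}
    (hφ : ContMDiff 𝓘(ℝ, Es) 𝓘(ℝ, ℝ) ∞ φ) (f : M → ℝ) (x : M) :
    bracket P.tensor (φ ∘ Γ) f x = leftForm θ φ (Γ x) (logBracket P θ Γ f x) := by
  rw [← differential_hamVec, differential_comp_map θ hΓ hφ]
  rfl

theorem apply_logBracket_comp_map (hΓ : ContMDiff 𝓘(ℝ, F) 𝓘(ℝ, Es) ∞ Γ) {φ : Gs → ℝ}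
    (hφ : ContMDiff 𝓘(ℝ, Es) 𝓘(ℝ, ℝ) ∞ φ) (σ : V →ₗ[ℝ] ℝ) (x : M) :
    σ (logBracket P θ Γ (φ ∘ Γ) x) = contract σ (leftForm θ φ (Γ x)) (logBivector P θ Γ x) := by
  rw [apply_logBracket, contract_logBivector, differential_comp_map θ hΓ hφ]

theorem contMDiff_leftForm (hΓ : ContMDiff 𝓘(ℝ, F) 𝓘(ℝ, Es) ∞ Γ) {φ : Gs → ℝ}
    (hφ : ContMDiff 𝓘(ℝ, Es) 𝓘(ℝ, ℝ) ∞ φ) (v : V) :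
    ContMDiff 𝓘(ℝ, F) 𝓘(ℝ, ℝ) ∞ (fun x => leftForm θ φ (Γ x) v) :=
  (contMDiff_leftDeriv hφ (θ v)).comp hΓ

variable [FiniteDimensional ℝ Es] [T2Space Gs]

theorem exists_leftForm_eq (σ : V →ₗ[ℝ] ℝ) (g : Gs) :
    ∃ φ : Gs → ℝ, ContMDiff 𝓘(ℝ, Es) 𝓘(ℝ, ℝ) ∞ φ ∧ leftForm θ φ g = σ := by
  obtain ⟨φ, hφ, h⟩ := exists_leftDeriv_eq (σ ∘ₗ θ.symm.toLinearMap) g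
  refine ⟨φ, hφ, ?_⟩
  ext v
  simp [leftForm_apply, h]

variable [FiniteDimensional ℝ V]

theorem contMDiff_apply_of_leftForm (hΓ : ContMDiff 𝓘(ℝ, F) 𝓘(ℝ, Es) ∞ Γ) {w : M → V}
    (hw : ∀ φ : Gs → ℝ, ContMDiff 𝓘(ℝ, Es) 𝓘(ℝ, ℝ) ∞ φ →
      ContMDiff 𝓘(ℝ, F) 𝓘(ℝ, ℝ) ∞ (fun x => leftForm θ φ (Γ x) (w x))) (σ : V →ₗ[ℝ] ℝ) :
    ContMDiff 𝓘(ℝ, F) 𝓘(ℝ, ℝ) ∞ (fun x => σ (w x)) := by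
  intro x
  let b := Module.finBasis ℝ V
  choose φ hφ h using fun i => exists_leftForm_eq θ (b.coord i) (Γ x)
  exact contMDiffAt_apply_of_frame b (τ := fun i y => leftForm θ (φ i) (Γ y))
    (fun i v => contMDiff_leftForm θ hΓ (hφ i) v) h (fun i => hw _ (hφ i)) σ

theorem contMDiff_apply_logBracket (hΓ : ContMDiff 𝓘(ℝ, F) 𝓘(ℝ, Es) ∞ Γ) {f : M → ℝ}
    (hf : ContMDiff 𝓘(ℝ, F) 𝓘(ℝ, ℝ) ∞ f) (σ : V →ₗ[ℝ] ℝ) :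
    ContMDiff 𝓘(ℝ, F) 𝓘(ℝ, ℝ) ∞ (fun x => σ (logBracket P θ Γ f x)) := by
  refine contMDiff_apply_of_leftForm θ hΓ (fun φ hφ => ?_) σ
  exact (P.smooth (φ ∘ Γ) f (hφ.comp hΓ) hf).congr fun x => (bracket_comp_map P θ hΓ hφ f x).symm

theorem contMDiff_contract_logBivector (hΓ : ContMDiff 𝓘(ℝ, F) 𝓘(ℝ, Es) ∞ Γ)
    (σ τ : V →ₗ[ℝ] ℝ) :
    ContMDiff 𝓘(ℝ, F) 𝓘(ℝ, ℝ) ∞ (fun x => contract σ τ (logBivector P θ Γ x)) := by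
  have := contMDiff_apply_of_leftForm θ hΓ
    (w := fun x => contractLeft σ (logBivector P θ Γ x)) (fun φ hφ => ?_) τ
  · exact this.congr fun x => (apply_contractLeft σ τ _).symm
  · refine (contMDiff_apply_logBracket P θ hΓ (hφ.comp hΓ) σ).congr fun x => ?_
    rw [apply_contractLeft, apply_logBracket_comp_map P θ hΓ hφ]

/-- The commutator of the derivations `f ↦ σ (Γ⁻¹ {Γ, f})`. The proof applies the Jacobi identity
to `φ ∘ Γ`, `ψ ∘ Γ` and `f`, where `φ` and `ψ` have left invariant derivatives `σ` and `τ` at the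
given point: the second derivatives of `φ` and `ψ` only enter through commutators. -/
theorem commutator_logBracket (hΓ : ContMDiff 𝓘(ℝ, F) 𝓘(ℝ, Es) ∞ Γ) {f : M → ℝ}
    (hf : ContMDiff 𝓘(ℝ, F) 𝓘(ℝ, ℝ) ∞ f) (σ τ : V →ₗ[ℝ] ℝ) (x : M) {D : V →ₗ[ℝ] V}
    (hD : ∀ v, θ (D v) = ⁅θ (logBracket P θ Γ f x), θ v⁆) :
    σ (logBracket P θ Γ (fun y => τ (logBracket P θ Γ f y)) x) -
        τ (logBracket P θ Γ (fun y => σ (logBracket P θ Γ f y)) x) =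
      differential 𝓘(ℝ, F) (fun y => contract σ τ (logBivector P θ Γ y)) x (hamVec P f x) +
        contract (σ ∘ₗ D) τ (logBivector P θ Γ x) + contract σ (τ ∘ₗ D) (logBivector P θ Γ x) := by
  obtain ⟨φ, hφ, hφσ⟩ := exists_leftForm_eq θ σ (Γ x)
  obtain ⟨ψ, hψ, hψτ⟩ := exists_leftForm_eq θ τ (Γ x)
  set T := logBivector P θ Γ with hT
  set ξ := logBracket P θ Γ f x with hξ
  -- the second derivatives of a function on the group
  let Hs : (Gs → ℝ) → V → V → ℝ := fun χ a c => leftDeriv (leftDeriv χ (θ c)) (θ a) (Γ x)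
  -- the tangent vector whose derivation is `g ↦ σ (Γ⁻¹ {Γ, g})`
  let Z : (V →ₗ[ℝ] ℝ) → TangentSpace 𝓘(ℝ, F) x := fun σ =>
    contractLeft (σ ∘ₗ logDeriv θ Γ x) (P.tensor x)
  have hZ : ∀ σ (g : M → ℝ), differential 𝓘(ℝ, F) g x (Z σ) = σ (logBracket P θ Γ g x) := by
    intro σ g
    rw [apply_logBracket]
    exact apply_contractLeft _ _ _
  have hZT : ∀ σ, logDeriv θ Γ x (Z σ) = contractLeft σ (T x) := by
    intro σ
    refine sub_eq_zero.1 ((Module.forall_dual_apply_eq_zero_iff ℝ _).1 fun nu => ?_)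
    rw [map_sub, apply_contractLeft, hT, contract_logBivector, sub_eq_zero]
    exact apply_contractLeft _ (nu ∘ₗ logDeriv θ Γ x) _
  have hsm : ∀ τ : V →ₗ[ℝ] ℝ, MDifferentiableAt 𝓘(ℝ, F) 𝓘(ℝ, ℝ)
      (fun y => τ (logBracket P θ Γ f y)) x := fun τ =>
    (contMDiff_apply_logBracket P θ hΓ hf τ).mdifferentiable (by simp) x
  have hfs : ∀ {χ : Gs → ℝ}, ContMDiff 𝓘(ℝ, Es) 𝓘(ℝ, ℝ) ∞ χ → ∀ v,
      MDifferentiableAt 𝓘(ℝ, F) 𝓘(ℝ, ℝ) (fun y => leftForm θ χ (Γ y) v) x := fun hχ v =>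
    (contMDiff_leftForm θ hΓ hχ v).mdifferentiable (by simp) x
  have hfd : ∀ {χ : Gs → ℝ}, ContMDiff 𝓘(ℝ, Es) 𝓘(ℝ, ℝ) ∞ χ → ∀ Y v,
      differential 𝓘(ℝ, F) (fun y => leftForm θ χ (Γ y) v) x Y = Hs χ (logDeriv θ Γ x Y) v :=
    fun hχ Y v => differential_comp_map_apply θ hΓ (contMDiff_leftDeriv hχ (θ v)) x Y
  -- the second derivatives, as a linear form in the inner argument
  have hlin : ∀ {χ : Gs → ℝ}, ContMDiff 𝓘(ℝ, Es) 𝓘(ℝ, ℝ) ∞ χ → ∀ a,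
      ∃ ℓ : V →ₗ[ℝ] ℝ, ∀ v, ℓ v = Hs χ a v := by
    intro χ hχ a
    have hd : ∀ v, MDifferentiableAt 𝓘(ℝ, Es) 𝓘(ℝ, ℝ) (leftDeriv χ v) (Γ x) := fun v =>
      (contMDiff_leftDeriv hχ v).mdifferentiable (by simp) _
    refine ⟨{ toFun := Hs χ a, map_add' := fun v w => ?_, map_smul' := fun c v => ?_ },
      fun v => rfl⟩
    · have : leftDeriv χ (θ (v + w)) = leftDeriv χ (θ v) + leftDeriv χ (θ w) := by
        ext g
        rw [map_add, leftDeriv_add]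
        rfl
      simp only [Hs]
      rw [this]
      simp only [leftDeriv]
      rw [differential_add (hd _) (hd _)]
      rfl
    · have : leftDeriv χ (θ (c • v)) = c • leftDeriv χ (θ v) := by
        ext g
        rw [map_smul, leftDeriv_smul]
        rfl
      simp only [Hs]
      rw [this]
      simp only [leftDeriv]
      rw [differential_smul c (hd _)]
      rfl
  -- the iterated bracket: `Z σ` acts on `τ (Γ⁻¹ {Γ, f})` and on the coefficients of `dψ`
  have iter : ∀ {φ ψ : Gs → ℝ} {σ τ : V →ₗ[ℝ] ℝ}, ContMDiff 𝓘(ℝ, Es) 𝓘(ℝ, ℝ) ∞ φ →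
      ContMDiff 𝓘(ℝ, Es) 𝓘(ℝ, ℝ) ∞ ψ → leftForm θ φ (Γ x) = σ → leftForm θ ψ (Γ x) = τ →
      bracket P.tensor (φ ∘ Γ) (bracket P.tensor (ψ ∘ Γ) f) x =
        σ (logBracket P θ Γ (fun y => τ (logBracket P θ Γ f y)) x) +
          Hs ψ (contractLeft σ (T x)) ξ := by
    intro φ ψ σ τ hφ hψ h1 h2
    obtain ⟨ℓ, hℓ⟩ := hlin hψ (contractLeft σ (T x))
    rw [bracket_comp_map P θ hΓ hφ, h1, ← hZ,
      differential_congr fun y => bracket_comp_map P θ hΓ hψ f y,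
      differential_apply_apply (hfs hψ) hsm (Z σ) (τ' := ℓ)
        (fun v => by rw [hfd hψ, hZT, hℓ]), h2, hZ, hℓ, add_comm]
  -- the bracket of `{φ ∘ Γ, ψ ∘ Γ} = (dφ ⊗ dψ) T` with `f`, by the product rule
  have outer : bracket P.tensor (bracket P.tensor (φ ∘ Γ) (ψ ∘ Γ)) f x =
      -Hs φ ξ (contractLeft τ (T x)) + Hs ψ ξ (contractLeft σ (T x)) +
        differential 𝓘(ℝ, F) (fun y => contract σ τ (T y)) x (hamVec P f x) := by
    obtain ⟨ℓ, hℓ⟩ := hlin hφ ξ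
    obtain ⟨m, hm⟩ := hlin hψ ξ
    have e : ∀ y, bracket P.tensor (φ ∘ Γ) (ψ ∘ Γ) y =
        contract (leftForm θ φ (Γ y)) (leftForm θ ψ (Γ y)) (T y) := fun y => by
      rw [bracket_comp_map P θ hΓ hφ, apply_logBracket_comp_map P θ hΓ hψ]
    rw [← differential_hamVec, differential_congr e,
      differential_contract (hfs hφ) (hfs hψ)
        (fun σ τ => (contMDiff_contract_logBivector P θ hΓ σ τ).mdifferentiable (by simp) x)
        (hamVec P f x) (α' := ℓ) (β' := m) (fun v => by rw [hfd hφ, hℓ]; rfl)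
        (fun v => by rw [hfd hψ, hm]; rfl), hφσ, hψτ,
      contract_eq_neg_of_skew (logBivector_skew P θ Γ x) ℓ τ, ← apply_contractLeft τ ℓ,
      ← apply_contractLeft σ m, hℓ, hm]
  -- the composite with `D` is the difference of the two orders of differentiation
  have hc : ∀ {χ : Gs → ℝ} {σ : V →ₗ[ℝ] ℝ}, ContMDiff 𝓘(ℝ, Es) 𝓘(ℝ, ℝ) ∞ χ →
      leftForm θ χ (Γ x) = σ → ∀ v, σ (D v) = Hs χ ξ v - Hs χ v ξ := by
    rintro χ σ hχ rfl v
    rw [leftForm_apply, hD, leftDeriv_lie hχ]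
  have jac := congrFun (P.jacobi (φ ∘ Γ) (ψ ∘ Γ) f (hφ.comp hΓ) (hψ.comp hΓ) hf) x
  simp only [Pi.add_apply, Pi.zero_apply] at jac
  have hneg : bracket P.tensor (ψ ∘ Γ) (bracket P.tensor f (φ ∘ Γ)) x =
      -bracket P.tensor (ψ ∘ Γ) (bracket P.tensor (φ ∘ Γ) f) x := by
    rw [P.bracket_skew f, P.bracket_skew (ψ ∘ Γ), P.bracket_skew (ψ ∘ Γ)]
    simp only [Pi.neg_apply]
    rw [← differential_hamVec, ← differential_hamVec, neg_neg]
    have := differential_smul (-1 : ℝ)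
      ((P.smooth (φ ∘ Γ) f (hφ.comp hΓ) hf).mdifferentiable (by simp) x)
    rw [neg_one_smul] at this
    rw [this]
    simp
  rw [hneg, P.bracket_skew f, Pi.neg_apply, iter hφ hψ hφσ hψτ, iter hψ hφ hψτ hφσ, outer] at jac
  rw [contract_eq_neg_of_skew (logBivector_skew P θ Γ x) (σ ∘ₗ D) τ,
    ← apply_contractLeft σ (τ ∘ₗ D), ← apply_contractLeft τ (σ ∘ₗ D), LinearMap.comp_apply,
    LinearMap.comp_apply, hc hψ hψτ, hc hφ hφσ]
  linarith

end Hamiltonian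

/-! ### The adjoint action of the dual group on the double -/

section Twist

variable {E : Type*} [NormedAddCommGroup E] [NormedSpace ℝ E] [FiniteDimensional ℝ E]
  {G : Type*} [TopologicalSpace G] [ChartedSpace E G] [Group G] [T2Space G]
  [LieGroup 𝓘(ℝ, E) ∞ G]
  {Es : Type*} [NormedAddCommGroup Es] [NormedSpace ℝ Es]
  {Gs : Type*} [TopologicalSpace Gs] [ChartedSpace Es Gs] [Group Gs]
  [LieGroup 𝓘(ℝ, Es) ∞ Gs]
  {Ed : Type*} [NormedAddCommGroup Ed] [NormedSpace ℝ Ed]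
  {DG : Type*} [TopologicalSpace DG] [ChartedSpace Ed DG] [Group DG]
  [LieGroup 𝓘(ℝ, Ed) ∞ DG]
  (θ : Module.Dual ℝ (LieAlg E G) ≃ₗ[ℝ] LieAlg Es Gs)
  (Θ : Double E G ≃ₗ[ℝ] LieAlg Ed DG) {j : Gs →* DG}

/-- The adjoint action of the dual group on `𝔤*`. -/
def dualAd (C : Gs) : Module.Dual ℝ (LieAlg E G) →ₗ[ℝ] Module.Dual ℝ (LieAlg E G) :=
  θ.symm.toLinearMap ∘ₗ Ad C ∘ₗ θ.toLinearMap

/-- The adjoint action of the dual group on the double, through `j`. -/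
def doubleAd (j : Gs →* DG) (C : Gs) : Double E G →ₗ[ℝ] Double E G :=
  Θ.symm.toLinearMap ∘ₗ Ad (j C) ∘ₗ Θ.toLinearMap

theorem dualAd_mul (C C' : Gs) : dualAd θ (C * C') = dualAd θ C ∘ₗ dualAd θ C' := by
  ext1 lam
  simp [dualAd, Ad_mul]

theorem dualAd_inv_comp (C : Gs) : dualAd θ C⁻¹ ∘ₗ dualAd θ C = LinearMap.id := by
  rw [← dualAd_mul, inv_mul_cancel]
  ext1 lam
  simp [dualAd, Ad_one]

theorem doubleAd_mul (C C' : Gs) : doubleAd Θ j (C * C') = doubleAd Θ j C ∘ₗ doubleAd Θ j C' := by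
  refine LinearMap.ext fun u => ?_
  simp [doubleAd, Ad_mul]

theorem doubleAd_one : doubleAd Θ j 1 = LinearMap.id := by
  refine LinearMap.ext fun u => ?_
  simp [doubleAd, Ad_one]

theorem mfderiv_hom_leftTranslate (hj : ContMDiff 𝓘(ℝ, Es) 𝓘(ℝ, Ed) ∞ j) (C : Gs)
    (v : LieAlg Es Gs) :
    (mfderiv 𝓘(ℝ, Es) 𝓘(ℝ, Ed) j C (leftTranslate C v) : Ed) =
      leftTranslate (j C) (mfderiv 𝓘(ℝ, Es) 𝓘(ℝ, Ed) j 1 v : Ed) := by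
  have h1 := mfderiv_comp_eq (E := Es) (f := fun x => C * x) (g := j) (k := fun x => j (C * x))
    (mul_one C) (hj.mdifferentiable (by simp) C) (mdifferentiableAt_mul_left C 1)
    (fun _ => rfl) v
  have h2 := mfderiv_comp_eq (E := Es) (f := j) (g := fun y => j C * y)
    (k := fun x => j (C * x)) (map_one j) (mdifferentiableAt_mul_left (j C) 1)
    (hj.mdifferentiable (by simp) 1) (fun x => (map_mul j C x).symm) v
  exact h1.symm.trans h2

theorem mfderiv_hom_Ad (hj : ContMDiff 𝓘(ℝ, Es) 𝓘(ℝ, Ed) ∞ j) (C : Gs) (v : LieAlg Es Gs) :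
    (mfderiv 𝓘(ℝ, Es) 𝓘(ℝ, Ed) j 1 (Ad C v) : Ed) =
      Ad (j C) (mfderiv 𝓘(ℝ, Es) 𝓘(ℝ, Ed) j 1 v : Ed) := by
  have h1 := mfderiv_comp_eq (E := Es) (f := fun x => C * x * C⁻¹) (g := j)
    (k := fun x => j (C * x * C⁻¹)) (by simp : C * 1 * C⁻¹ = 1)
    (hj.mdifferentiable (by simp) 1) (mdifferentiableAt_conj C 1) (fun _ => rfl) v
  have h2 := mfderiv_comp_eq (E := Es) (f := j) (g := fun y => j C * y * (j C)⁻¹)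
    (k := fun x => j (C * x * C⁻¹)) (map_one j) (mdifferentiableAt_conj (j C) 1)
    (hj.mdifferentiable (by simp) 1) (fun x => by simp) v
  exact h1.symm.trans h2

variable {θ Θ}

theorem doubleAd_inr (hj : IsLift θ Θ j) (C : Gs) (lam : Module.Dual ℝ (LieAlg E G)) :
    doubleAd Θ j C (0, lam) = (0, dualAd θ C lam) := by
  apply Θ.injective
  have h := hj.2 (dualAd θ C lam)
  simp only [dualAd, LinearMap.comp_apply, LinearEquiv.coe_coe, LinearEquiv.apply_symm_apply] at h
  simp only [doubleAd, LinearMap.comp_apply, LinearEquiv.coe_coe, LinearEquiv.apply_symm_apply]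
  rw [← hj.2]
  exact (mfderiv_hom_Ad hj.1 C (θ lam)).symm.trans h

theorem doubleAd_comp_inr (hj : IsLift θ Θ j) (C : Gs) :
    doubleAd Θ j C ∘ₗ LinearMap.inr ℝ _ _ = LinearMap.inr ℝ _ _ ∘ₗ dualAd θ C :=
  LinearMap.ext fun lam => doubleAd_inr hj C lam

variable [FiniteDimensional ℝ Ed] [T2Space DG]

theorem contMDiff_apply_doubleAd (hj : IsLift θ Θ j) (σ : Double E G →ₗ[ℝ] ℝ) (u : Double E G) :
    ContMDiff 𝓘(ℝ, Es) 𝓘(ℝ, ℝ) ∞ (fun C => σ (doubleAd Θ j C u)) :=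
  (contMDiff_apply_Ad (σ ∘ₗ Θ.symm.toLinearMap) (Θ u)).comp hj.1

variable {π : PoissonStructure E G}

theorem leftDeriv_apply_doubleAd (hΘ : IsDoubleIdentification π Θ) (hj : IsLift θ Θ j)
    (σ : Double E G →ₗ[ℝ] ℝ) (u : Double E G) (lam : Module.Dual ℝ (LieAlg E G)) (C : Gs) :
    leftDeriv (fun C => σ (doubleAd Θ j C u)) (θ lam) C =
      σ (doubleAd Θ j C (doubleBracket π (0, lam) u)) := by
  have h1 := mfderiv_comp_eq (E := Es) (f := j)
    (g := fun h => (σ ∘ₗ Θ.symm.toLinearMap) (Ad h (Θ u)))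
    (k := fun C => σ (doubleAd Θ j C u)) (x := C) rfl
    ((contMDiff_apply_Ad (σ ∘ₗ Θ.symm.toLinearMap) (Θ u)).mdifferentiable (by simp) _)
    (hj.1.mdifferentiable (by simp) C) (fun _ => rfl) (leftTranslate C (θ lam))
  refine h1.trans ?_
  have h2 := leftDeriv_apply_Ad (σ ∘ₗ Θ.symm.toLinearMap) (Θ u) (Θ (0, lam)) (j C)
  rw [← hΘ] at h2
  refine Eq.trans ?_ h2
  refine congrArg (differential 𝓘(ℝ, Ed) _ (j C)) ?_
  refine (mfderiv_hom_leftTranslate hj.1 C (θ lam)).trans ?_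
  exact congrArg (leftTranslate (j C)) (hj.2 lam)

theorem pairing_comm (u v : Double E G) : pairing u v = pairing v u := add_comm _ _

/-- The adjoint action of the connected dual group preserves the pairing of the double, because the
infinitesimal action does. -/
theorem pairing_doubleAd [PreconnectedSpace Gs] (hΘ : IsDoubleIdentification π Θ)
    (hj : IsLift θ Θ j) (C : Gs) (u v : Double E G) :
    pairing (doubleAd Θ j C u) (doubleAd Θ j C v) = pairing u v := by
  let f : Gs → ℝ := fun C => pairing (doubleAd Θ j C u) (doubleAd Θ j C v)
  have hf : ContMDiff 𝓘(ℝ, Es) 𝓘(ℝ, ℝ) ∞ f := by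
    let b := Module.finBasis ℝ (Double E G)
    have := ContMDiff.sum (t := Finset.univ) fun i _ =>
      (contMDiff_apply_doubleAd hj (pairingForm (b i)) u).mul
        (contMDiff_apply_doubleAd hj (b.coord i) v)
    refine this.congr fun C => ?_
    change pairingForm (doubleAd Θ j C u) (doubleAd Θ j C v) = _
    conv_lhs => rw [← b.sum_repr (doubleAd Θ j C v), map_sum]
    refine Finset.sum_congr rfl fun i _ => ?_
    rw [map_smul, pairingForm_apply, pairing_comm, smul_eq_mul, mul_comm]
    rfl
  have hdf : ∀ C, differential 𝓘(ℝ, Es) f C = 0 := by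
    intro C
    refine LinearMap.ext fun Y => ?_
    -- right translation reduces the claim to the identity, where the pairing is `ad`-invariant
    obtain ⟨lam, hlam⟩ : ∃ lam, rightTranslate C (θ lam) = Y :=
      ⟨θ.symm (Ad C (leftTrivialize C Y)), by
        rw [LinearEquiv.apply_symm_apply, ← leftTranslate_eq_rightTranslate_Ad,
          leftTranslate_leftTrivialize]⟩
    have h1 := mfderiv_comp_eq (E := Es) (f := fun x => x * C) (g := f)
      (k := fun x => pairingForm (doubleAd Θ j x (doubleAd Θ j C u))
        (doubleAd Θ j x (doubleAd Θ j C v))) (one_mul C)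
      (hf.mdifferentiable (by simp) C) (mdifferentiableAt_mul_right C 1)
      (fun x => by simp only [f, doubleAd_mul, LinearMap.comp_apply, pairingForm_apply]) (θ lam)
    have hd : ∀ (u : Double E G) (σ : Double E G →ₗ[ℝ] ℝ),
        differential 𝓘(ℝ, Es) (fun C => σ (doubleAd Θ j C u)) (1 : Gs) (θ lam) =
        σ (doubleBracket π (0, lam) u) := by
      intro u σ
      rw [← leftDeriv_one (contMDiff_apply_doubleAd hj σ u), leftDeriv_apply_doubleAd hΘ hj,
        doubleAd_one, LinearMap.id_apply]
    have hm : ∀ (u : Double E G) (σ : Double E G →ₗ[ℝ] ℝ), MDifferentiableAt 𝓘(ℝ, Es) 𝓘(ℝ, ℝ)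
        (fun C => σ (doubleAd Θ j C u)) (1 : Gs) := fun u σ =>
      (contMDiff_apply_doubleAd hj σ u).mdifferentiable (by simp) 1
    rw [← hlam]
    refine h1.symm.trans ?_
    have hsw : ∀ u v : Double E G, (fun x : Gs => pairingForm (doubleAd Θ j x u) v) =
        fun x => pairingForm v (doubleAd Θ j x u) := fun u v => funext fun x => pairing_comm _ _
    refine (differential_apply_apply (x := (1 : Gs))
      (τ := fun x => pairingForm (doubleAd Θ j x (doubleAd Θ j C u)))
      (w := fun x => doubleAd Θ j x (doubleAd Θ j C v))
      (fun v => by rw [hsw]; exact hm _ _) (fun σ => hm _ σ) (θ lam)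
      (τ' := pairingForm (doubleBracket π (0, lam) (doubleAd Θ j C u)))
      (fun v => by rw [hsw, hd]; exact add_comm _ _)).trans ?_
    rw [hd, doubleAd_one, LinearMap.id_apply, LinearMap.id_apply, pairingForm_apply,
      pairingForm_apply, ← pairing_doubleBracket]
    have h0 : ∀ a b c : Double E G, pairing (doubleBracket π a b) c =
        -pairing (doubleBracket π b a) c := by
      intro a b c
      have h1 : ∀ X Y : LieAlg E G, ∀ nu : Module.Dual ℝ (LieAlg E G), nu ⁅X, Y⁆ = -nu ⁅Y, X⁆ := by
        intro X Y nu
        rw [← lie_skew, map_neg]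
      have h2 : ∀ nu mu : Module.Dual ℝ (LieAlg E G), ∀ X : LieAlg E G,
          dualBracket π nu mu X = -dualBracket π mu nu X := by
        intro nu mu X
        rw [dualBracket_skew]
        rfl
      simp only [pairing, doubleBracket, LinearMap.add_apply, LinearMap.sub_apply,
        LinearMap.comp_apply, LieAlgebra.ad_apply, map_add, map_sub]
      linarith [h1 a.1 b.1 c.2, h2 a.2 b.2 c.1]
    rw [h0, neg_add_cancel]
    rfl
  rw [show pairing u v = f 1 by simp [f, doubleAd_one]]
  exact eq_of_differential_eq_zero hf hdf C 1

variable {κ : Type*} [Fintype κ] (b : Module.Basis κ ℝ (LieAlg E G))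

variable (Θ) in
/-- The cocycle `½ (Ad_C R - R)` on the dual group, seen in `𝔤* ⊗ 𝔤*`. The projection of `R` itself
to `𝔤* ⊗ 𝔤*` is zero, so that only the first term is needed; see `tensorSq_inr_twist`. -/
def twist (j : Gs →* DG) (C : Gs) :
    Module.Dual ℝ (LieAlg E G) ⊗[ℝ] Module.Dual ℝ (LieAlg E G) :=
  (1 / 2 : ℝ) • tensorSq (LinearMap.snd ℝ (LieAlg E G) (Module.Dual ℝ (LieAlg E G)) ∘ₗ
    doubleAd Θ j C) (canonicalR b)

theorem tensorSq_inr_twist [PreconnectedSpace Gs] (hΘ : IsDoubleIdentification π Θ)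
    (hj : IsLift θ Θ j) (C : Gs) :
    tensorSq (LinearMap.inr ℝ _ _) (twist Θ b j C) =
      (1 / 2 : ℝ) • (tensorSq (doubleAd Θ j C) (canonicalR b) - canonicalR b) := by
  have h := tensorSq_inr_canonicalR b (B := doubleAd Θ j C) (B' := doubleAd Θ j C⁻¹)
    (fun u v => by
      rw [← pairing_doubleAd hΘ hj C (doubleAd Θ j C⁻¹ u) v, ← LinearMap.comp_apply,
        ← doubleAd_mul, mul_inv_cancel, doubleAd_one]
      rfl)
    (fun u v => pairing_doubleAd hΘ hj _ u v) (fun lam => by rw [doubleAd_inr hj])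
  rw [← h]
  exact map_smul _ _ _

theorem twist_skew (C : Gs) :
    TensorProduct.comm ℝ _ _ (twist Θ b j C) = -twist Θ b j C :=
  comm_smul_tensorSq_of_skew _ (comm_canonicalR b)

theorem inr_injective : Function.Injective
    (LinearMap.inr ℝ (LieAlg E G) (Module.Dual ℝ (LieAlg E G))) := LinearMap.inr_injective

/-- The cocycle identity. -/
theorem twist_mul [PreconnectedSpace Gs] (hΘ : IsDoubleIdentification π Θ)
    (hj : IsLift θ Θ j) (C C' : Gs) :
    twist Θ b j (C * C') = twist Θ b j C + tensorSq (dualAd θ C) (twist Θ b j C') := by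
  apply tensorSq_injective inr_injective
  rw [map_add, tensorSq_comp, ← doubleAd_comp_inr hj, ← tensorSq_comp, tensorSq_inr_twist b hΘ hj,
    tensorSq_inr_twist b hΘ hj, tensorSq_inr_twist b hΘ hj, doubleAd_mul, ← tensorSq_comp]
  refine (half_sub_add_half_sub _ _ _).trans (congrArg _ ?_)
  exact (congrArg _ (map_sub (tensorSq (doubleAd Θ j C)) _ _).symm).trans (map_smul _ _ _).symm

theorem twist_one [PreconnectedSpace Gs] (hΘ : IsDoubleIdentification π Θ)
    (hj : IsLift θ Θ j) : twist Θ b j 1 = 0 := by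
  apply tensorSq_injective inr_injective
  rw [map_zero, tensorSq_inr_twist b hΘ hj, doubleAd_one, tensorSq, TensorProduct.map_id]
  exact (congrArg _ (sub_self _)).trans (smul_zero _)

end Twist

/-! ### The bracket relation for a map to the dual group -/

section MomentMap

variable {E : Type*} [NormedAddCommGroup E] [NormedSpace ℝ E] [FiniteDimensional ℝ E]
  {G : Type*} [TopologicalSpace G] [ChartedSpace E G] [Group G] [T2Space G]
  [LieGroup 𝓘(ℝ, E) ∞ G] {π : PoissonStructure E G}
  {Es : Type*} [NormedAddCommGroup Es] [NormedSpace ℝ Es]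
  {Gs : Type*} [TopologicalSpace Gs] [ChartedSpace Es Gs] [Group Gs]
  [LieGroup 𝓘(ℝ, Es) ∞ Gs]
  {Ed : Type*} [NormedAddCommGroup Ed] [NormedSpace ℝ Ed]
  {DG : Type*} [TopologicalSpace DG] [ChartedSpace Ed DG] [Group DG]
  [LieGroup 𝓘(ℝ, Ed) ∞ DG]
  {θ : Module.Dual ℝ (LieAlg E G) ≃ₗ[ℝ] LieAlg Es Gs}
  {Θ : Double E G ≃ₗ[ℝ] LieAlg Ed DG} {j : Gs →* DG}
  {κ : Type*} [Fintype κ] (b : Module.Basis κ ℝ (LieAlg E G))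
  {F : Type*} [NormedAddCommGroup F] [NormedSpace ℝ F]
  {M : Type*} [TopologicalSpace M] [ChartedSpace F M]
  (P : PoissonStructure F M) {Γ : M → Gs}

theorem momentAction_apply (ε : LieAlg E G) (f : M → ℝ) (x : M) :
    momentAction P θ Γ ε f x = -logBracket P θ Γ f x ε := by
  have h := apply_map_contractRight
    (mfderiv 𝓘(ℝ, F) 𝓘(ℝ, Es) Γ x : TangentSpace 𝓘(ℝ, F) x →ₗ[ℝ] TangentSpace 𝓘(ℝ, Es) (Γ x))
    (differential 𝓘(ℝ, F) f x) (P.tensor x)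
  change -(θ.symm (leftTrivialize (Γ x) (mapBracket 𝓘(ℝ, Es) P.tensor Γ f x))) ε = _
  rw [mapBracket, ← h]
  rfl

theorem logDeriv_apply {V : Type*} [AddCommGroup V] [Module ℝ V] (θ : V ≃ₗ[ℝ] LieAlg Es Gs)
    (hΓ : ContMDiff 𝓘(ℝ, F) 𝓘(ℝ, Es) ∞ Γ) (x : M) (v : TangentSpace 𝓘(ℝ, F) x) :
    logDeriv θ Γ x v =
      θ.symm (mfderiv 𝓘(ℝ, F) 𝓘(ℝ, Es) (fun z => (Γ x)⁻¹ * Γ z) x v : Es) := by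
  refine congrArg θ.symm ?_
  exact (mfderiv_comp_eq (E := F) (f := Γ) (g := fun y => (Γ x)⁻¹ * y)
    (k := fun z => (Γ x)⁻¹ * Γ z) rfl (mdifferentiableAt_mul_left _ _)
    (hΓ.mdifferentiable (by simp) x) (fun _ => rfl) v).symm

theorem logDeriv_mul_left {V : Type*} [AddCommGroup V] [Module ℝ V] (θ : V ≃ₗ[ℝ] LieAlg Es Gs)
    (hΓ : ContMDiff 𝓘(ℝ, F) 𝓘(ℝ, Es) ∞ Γ) (C : Gs) (x : M) :
    logDeriv (F := F) θ (fun y => C * Γ y) x = logDeriv θ Γ x := by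
  ext v
  have h : (fun z => (C * Γ x)⁻¹ * (C * Γ z)) = fun z => (Γ x)⁻¹ * Γ z := by
    ext z
    group
  refine (logDeriv_apply θ (Γ := fun y => C * Γ y) (contMDiff_const.mul hΓ) x v).trans
    (Eq.trans ?_ (logDeriv_apply θ hΓ x v).symm)
  exact congrArg (fun k : M → Gs => θ.symm (mfderiv 𝓘(ℝ, F) 𝓘(ℝ, Es) k x v : Es)) h

/-- The bracket `{j(Γ)₁, j(Γ)₂}` is the right translate of an element of `𝔤* ⊗ 𝔤*`. -/
theorem selfBracket_comp_hom (hj : IsLift θ Θ j) (hΓ : ContMDiff 𝓘(ℝ, F) 𝓘(ℝ, Es) ∞ Γ) (x : M) :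
    selfBracket 𝓘(ℝ, Ed) P.tensor (j ∘ Γ) x =
      tensorSq (rightTranslate (j (Γ x)) ∘ₗ Θ.toLinearMap)
        (tensorSq (LinearMap.inr ℝ _ _)
          (tensorSq (dualAd θ (Γ x)) (logBivector P θ Γ x))) := by
  have h : (mfderiv 𝓘(ℝ, F) 𝓘(ℝ, Ed) (j ∘ Γ) x :
      TangentSpace 𝓘(ℝ, F) x →ₗ[ℝ] TangentSpace 𝓘(ℝ, Ed) ((j ∘ Γ) x)) =
      (rightTranslate (j (Γ x)) ∘ₗ Θ.toLinearMap) ∘ₗ (LinearMap.inr ℝ _ _ ∘ₗ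
        (dualAd θ (Γ x) ∘ₗ logDeriv θ Γ x)) := by
    refine LinearMap.ext fun v => ?_
    have h1 := mfderiv_comp_eq (E := F) (f := Γ) (g := j) (k := j ∘ Γ) (x := x) rfl
      (hj.1.mdifferentiable (by simp) _) (hΓ.mdifferentiable (by simp) x) (fun _ => rfl) v
    refine h1.trans ?_
    rw [← leftTranslate_leftTrivialize (Γ x) (mfderiv 𝓘(ℝ, F) 𝓘(ℝ, Es) Γ x v)]
    refine (mfderiv_hom_leftTranslate hj.1 _ _).trans ?_
    have h2 := hj.2 (logDeriv θ Γ x v)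
    rw [logDeriv, LinearMap.comp_apply, LinearEquiv.coe_coe, LinearEquiv.apply_symm_apply] at h2
    refine (congrArg (leftTranslate (j (Γ x))) h2).trans ?_
    rw [leftTranslate_eq_rightTranslate_Ad]
    refine congrArg (rightTranslate (j (Γ x))) ?_
    refine Eq.trans ?_ (congrArg Θ (doubleAd_inr hj (Γ x) (logDeriv θ Γ x v)))
    simp only [doubleAd, LinearMap.comp_apply, LinearEquiv.coe_coe, LinearEquiv.apply_symm_apply]
    rfl
  rw [logBivector, tensorSq_comp, tensorSq_comp, tensorSq_comp]
  exact congrArg (fun L => tensorSq L (P.tensor x)) h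

/-- The bracket relation, translated on the right to the identity of the double group and pulled
back to `𝔤* ⊗ 𝔤*`. -/
theorem satisfiesBracket_iff [FiniteDimensional ℝ Ed] [T2Space DG] [PreconnectedSpace Gs]
    (hΘ : IsDoubleIdentification π Θ) (hj : IsLift θ Θ j)
    (hΓ : ContMDiff 𝓘(ℝ, F) 𝓘(ℝ, Es) ∞ Γ)
    (N : M → Module.Dual ℝ (LieAlg E G) ⊗[ℝ] Module.Dual ℝ (LieAlg E G)) :
    SatisfiesBracket P (tensorSq Θ.toLinearMap (canonicalR b)) (fun x => dualTensor Θ (N x))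
        (j ∘ Γ) ↔
      ∀ x, tensorSq (dualAd θ (Γ x)) (logBivector P θ Γ x) = twist Θ b j (Γ x) + N x := by
  refine forall_congr' fun x => ?_
  rw [selfBracket_comp_hom P hj hΓ]
  have h := tensorSq_eq_iff_eq_add inr_injective
    (L := rightTranslate (j (Γ x)) ∘ₗ Θ.toLinearMap)
    ((rightTranslate_injective (j (Γ x))).comp Θ.injective) (tensorSq_inr_twist b hΘ hj (Γ x))
    (tensorSq (dualAd θ (Γ x)) (logBivector P θ Γ x)) (N x)
  have e : (rightTranslate (j (Γ x)) ∘ₗ Θ.toLinearMap) ∘ₗ doubleAd Θ j (Γ x) =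
      leftTranslate (j (Γ x)) ∘ₗ Θ.toLinearMap := by
    refine LinearMap.ext fun u => ?_
    simp [doubleAd, leftTranslate_eq_rightTranslate_Ad]
  rw [tensorSq_comp _ _ (canonicalR b), e] at h
  refine Iff.trans (iff_of_eq ?_) h
  refine congrArg (_ = ·) (congrArg₂ (· + ·)
    (congrArg (-(1 / 2 : ℝ) • ·) (congrArg₂ (· - ·) ?_ ?_)) ?_)
  · exact tensorSq_comp _ _ _
  · exact tensorSq_comp _ _ _
  · refine (tensorSq_comp _ _ _).trans (Eq.trans ?_ (tensorSq_comp _ _ _).symm)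
    rfl

/-- The tensor `Ad_Γ (Γ⁻¹ {Γ₁, Γ₂}) - ½ (Ad_Γ R - R)`, seen in `𝔤* ⊗ 𝔤*`. It is the only `N` for
which the bracket relation can hold, see `satisfiesBracket_iff_eq_bracketDefect`. -/
def bracketDefect (θ : Module.Dual ℝ (LieAlg E G) ≃ₗ[ℝ] LieAlg Es Gs)
    (Θ : Double E G ≃ₗ[ℝ] LieAlg Ed DG) (j : Gs →* DG) (Γ : M → Gs) (x : M) :
    Module.Dual ℝ (LieAlg E G) ⊗[ℝ] Module.Dual ℝ (LieAlg E G) :=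
  tensorSq (dualAd θ (Γ x)) (logBivector P θ Γ x) - twist Θ b j (Γ x)

variable [FiniteDimensional ℝ Ed] [T2Space DG]

theorem bracketDefect_skew (x : M) :
    TensorProduct.comm ℝ _ _ (bracketDefect b P θ Θ j Γ x) = -bracketDefect b P θ Θ j Γ x := by
  have h := comm_smul_tensorSq_of_skew 1 (L := dualAd θ (Γ x)) (logBivector_skew P θ Γ x)
  rw [one_smul] at h
  rw [bracketDefect, map_sub, h, twist_skew]
  abel

theorem contract_twist (σ τ : Module.Dual ℝ (LieAlg E G) →ₗ[ℝ] ℝ) (C : Gs) :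
    contract σ τ (twist Θ b j C) =
      1 / 2 * contract ((σ ∘ₗ LinearMap.snd ℝ _ _) ∘ₗ doubleAd Θ j C)
        ((τ ∘ₗ LinearMap.snd ℝ _ _) ∘ₗ doubleAd Θ j C) (canonicalR b) := by
  rw [twist, contract_smul, contract_tensorSq]
  rfl

theorem contract_bracketDefect (σ τ : Module.Dual ℝ (LieAlg E G) →ₗ[ℝ] ℝ) (x : M) :
    contract σ τ (bracketDefect b P θ Θ j Γ x) =
      contract (σ ∘ₗ dualAd θ (Γ x)) (τ ∘ₗ dualAd θ (Γ x)) (logBivector P θ Γ x) -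
        1 / 2 * contract ((σ ∘ₗ LinearMap.snd ℝ _ _) ∘ₗ doubleAd Θ j (Γ x))
          ((τ ∘ₗ LinearMap.snd ℝ _ _) ∘ₗ doubleAd Θ j (Γ x)) (canonicalR b) := by
  rw [bracketDefect, contract_sub, contract_twist, contract_tensorSq]

theorem contMDiff_apply_dualAd (hj : IsLift θ Θ j) (σ : Module.Dual ℝ (LieAlg E G) →ₗ[ℝ] ℝ)
    (lam : Module.Dual ℝ (LieAlg E G)) :
    ContMDiff 𝓘(ℝ, Es) 𝓘(ℝ, ℝ) ∞ (fun C => σ (dualAd θ C lam)) := by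
  refine (contMDiff_apply_doubleAd hj (σ ∘ₗ LinearMap.snd ℝ _ _) (0, lam)).congr fun C => ?_
  simp [doubleAd_inr hj]

theorem leftDeriv_apply_dualAd (hΘ : IsDoubleIdentification π Θ) (hj : IsLift θ Θ j)
    (σ : Module.Dual ℝ (LieAlg E G) →ₗ[ℝ] ℝ) (lam mu : Module.Dual ℝ (LieAlg E G)) (C : Gs) :
    leftDeriv (fun C => σ (dualAd θ C mu)) (θ lam) C = σ (dualAd θ C (dualBracket π lam mu)) := by
  have h := leftDeriv_apply_doubleAd hΘ hj (σ ∘ₗ LinearMap.snd ℝ _ _) (0, mu) lam C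
  rw [doubleBracket_inr] at h
  simpa [doubleAd_inr hj] using h

/-- The adjoint action of `ξ ∈ 𝔤*` on the double, as a linear map. -/
theorem exists_linearMap_doubleBracket (hΘ : IsDoubleIdentification π Θ)
    (u : Double E G) : ∃ T : Double E G →ₗ[ℝ] Double E G, ∀ v, T v = doubleBracket π u v := by
  refine ⟨Θ.symm.toLinearMap ∘ₗ (LieAlgebra.ad ℝ (LieAlg Ed DG) (Θ u) : LieAlg Ed DG →ₗ[ℝ] _) ∘ₗ
    Θ.toLinearMap, fun v => Θ.injective ?_⟩
  simp [hΘ u v]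

theorem contMDiff_contract_doubleAd (hj : IsLift θ Θ j)
    (hΓ : ContMDiff 𝓘(ℝ, F) 𝓘(ℝ, Es) ∞ Γ) (σ τ : Double E G →ₗ[ℝ] ℝ)
    (R : Double E G ⊗[ℝ] Double E G) :
    ContMDiff 𝓘(ℝ, F) 𝓘(ℝ, ℝ) ∞ (fun y => contract (σ ∘ₗ doubleAd Θ j (Γ y))
      (τ ∘ₗ doubleAd Θ j (Γ y)) R) :=
  contMDiff_contract (fun v => (contMDiff_apply_doubleAd hj σ v).comp hΓ)
    (fun v => (contMDiff_apply_doubleAd hj τ v).comp hΓ) (fun _ _ => contMDiff_const)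

theorem differential_contract_doubleAd (hΘ : IsDoubleIdentification π Θ) (hj : IsLift θ Θ j)
    (hΓ : ContMDiff 𝓘(ℝ, F) 𝓘(ℝ, Es) ∞ Γ) (σ τ : Double E G →ₗ[ℝ] ℝ)
    (R : Double E G ⊗[ℝ] Double E G) (x : M) (Y : TangentSpace 𝓘(ℝ, F) x)
    {T : Double E G →ₗ[ℝ] Double E G} (hT : ∀ u, T u = doubleBracket π (0, logDeriv θ Γ x Y) u) :
    differential 𝓘(ℝ, F) (fun y => contract (σ ∘ₗ doubleAd Θ j (Γ y))
        (τ ∘ₗ doubleAd Θ j (Γ y)) R) x Y =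
      contract ((σ ∘ₗ doubleAd Θ j (Γ x)) ∘ₗ T) (τ ∘ₗ doubleAd Θ j (Γ x)) R +
        contract (σ ∘ₗ doubleAd Θ j (Γ x)) ((τ ∘ₗ doubleAd Θ j (Γ x)) ∘ₗ T) R := by
  have h : ∀ σ : Double E G →ₗ[ℝ] ℝ, ∀ v,
      MDifferentiableAt 𝓘(ℝ, F) 𝓘(ℝ, ℝ) (fun y => σ (doubleAd Θ j (Γ y) v)) x := fun σ v =>
    ((contMDiff_apply_doubleAd hj σ v).comp hΓ).mdifferentiable (by simp) x
  have h' : ∀ (σ : Double E G →ₗ[ℝ] ℝ) (v : Double E G),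
      differential 𝓘(ℝ, F) (fun y => σ (doubleAd Θ j (Γ y) v)) x Y =
        σ (doubleAd Θ j (Γ x) (T v)) := fun σ v => by
    rw [hT]
    exact (differential_comp_map_apply θ hΓ (contMDiff_apply_doubleAd hj σ v) x Y).trans
      (leftDeriv_apply_doubleAd hΘ hj σ v _ (Γ x))
  refine (differential_contract (h σ) (h τ) (fun _ _ => mdifferentiableAt_const) Y
    (α' := (σ ∘ₗ doubleAd Θ j (Γ x)) ∘ₗ T) (β' := (τ ∘ₗ doubleAd Θ j (Γ x)) ∘ₗ T)
    (h' σ) (h' τ) (T := fun _ => R)).trans ?_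
  rw [differential_const, LinearMap.zero_apply, add_zero]

variable [FiniteDimensional ℝ Es] [T2Space Gs]

theorem contMDiff_contract_dualAd (hj : IsLift θ Θ j)
    (hΓ : ContMDiff 𝓘(ℝ, F) 𝓘(ℝ, Es) ∞ Γ) (σ τ : Module.Dual ℝ (LieAlg E G) →ₗ[ℝ] ℝ) :
    ContMDiff 𝓘(ℝ, F) 𝓘(ℝ, ℝ) ∞ (fun y => contract (σ ∘ₗ dualAd θ (Γ y))
      (τ ∘ₗ dualAd θ (Γ y)) (logBivector P θ Γ y)) :=
  contMDiff_contract (fun v => (contMDiff_apply_dualAd hj σ v).comp hΓ)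
    (fun v => (contMDiff_apply_dualAd hj τ v).comp hΓ) (contMDiff_contract_logBivector P θ hΓ)

theorem differential_contract_dualAd (hΘ : IsDoubleIdentification π Θ) (hj : IsLift θ Θ j)
    (hΓ : ContMDiff 𝓘(ℝ, F) 𝓘(ℝ, Es) ∞ Γ) (σ τ : Module.Dual ℝ (LieAlg E G) →ₗ[ℝ] ℝ) (x : M)
    (Y : TangentSpace 𝓘(ℝ, F) x) :
    differential 𝓘(ℝ, F) (fun y => contract (σ ∘ₗ dualAd θ (Γ y)) (τ ∘ₗ dualAd θ (Γ y))
        (logBivector P θ Γ y)) x Y =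
      contract ((σ ∘ₗ dualAd θ (Γ x)) ∘ₗ dualBracket π (logDeriv θ Γ x Y)) (τ ∘ₗ dualAd θ (Γ x))
          (logBivector P θ Γ x) +
        contract (σ ∘ₗ dualAd θ (Γ x)) ((τ ∘ₗ dualAd θ (Γ x)) ∘ₗ dualBracket π (logDeriv θ Γ x Y))
          (logBivector P θ Γ x) +
        differential 𝓘(ℝ, F) (fun y => contract (σ ∘ₗ dualAd θ (Γ x)) (τ ∘ₗ dualAd θ (Γ x))
          (logBivector P θ Γ y)) x Y := by
  have h : ∀ σ : Module.Dual ℝ (LieAlg E G) →ₗ[ℝ] ℝ, ∀ v,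
      MDifferentiableAt 𝓘(ℝ, F) 𝓘(ℝ, ℝ) (fun y => σ (dualAd θ (Γ y) v)) x := fun σ v =>
    ((contMDiff_apply_dualAd hj σ v).comp hΓ).mdifferentiable (by simp) x
  have h' : ∀ (σ : Module.Dual ℝ (LieAlg E G) →ₗ[ℝ] ℝ) (v : Module.Dual ℝ (LieAlg E G)),
      differential 𝓘(ℝ, F) (fun y => σ (dualAd θ (Γ y) v)) x Y =
        σ (dualAd θ (Γ x) (dualBracket π (logDeriv θ Γ x Y) v)) := fun σ v =>
    (differential_comp_map_apply θ hΓ (contMDiff_apply_dualAd hj σ v) x Y).trans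
      (leftDeriv_apply_dualAd hΘ hj σ _ v (Γ x))
  exact differential_contract (h σ) (h τ)
    (fun σ τ => (contMDiff_contract_logBivector P θ hΓ σ τ).mdifferentiable (by simp) x) Y
    (h' σ) (h' τ)

theorem contMDiff_coeff_bracketDefect (hj : IsLift θ Θ j)
    (hΓ : ContMDiff 𝓘(ℝ, F) 𝓘(ℝ, Es) ∞ Γ) (X Y : LieAlg E G) :
    ContMDiff 𝓘(ℝ, F) 𝓘(ℝ, ℝ) ∞ (fun x => coeff X Y (bracketDefect b P θ Θ j Γ x)) := by
  simp only [coeff, contract_bracketDefect]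
  exact (contMDiff_contract_dualAd P hj hΓ _ _).sub
    (contMDiff_const.mul (contMDiff_contract_doubleAd hj hΓ _ _ _))

/-- The bracket of the coefficients of the defect with `f` is the curvature
`[δ_ε, δ_ε'] f - δ_[ε, ε'] f`, at the images `X'` and `Y'` of `X` and `Y` under the transpose of the
adjoint action of `Γ x`. The commutator comes from the derivative of `Ad_Γ (Γ⁻¹ {Γ₁, Γ₂})`, the
bracket of `𝔤` from the derivative of `½ Ad_Γ R`. -/
theorem bracket_coeff_bracketDefect (hθ : IsDualIdentification π θ)
    (hΘ : IsDoubleIdentification π Θ) (hj : IsLift θ Θ j)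
    (hΓ : ContMDiff 𝓘(ℝ, F) 𝓘(ℝ, Es) ∞ Γ) {f : M → ℝ}
    (hf : ContMDiff 𝓘(ℝ, F) 𝓘(ℝ, ℝ) ∞ f) (x : M) {X Y X' Y' : LieAlg E G}
    (hX : ∀ lam, dualAd θ (Γ x) lam X = lam X') (hY : ∀ lam, dualAd θ (Γ x) lam Y = lam Y') :
    bracket P.tensor (fun y => coeff X Y (bracketDefect b P θ Θ j Γ y)) f x =
      logBracket P θ Γ (fun y => logBracket P θ Γ f y Y') x X' -
        logBracket P θ Γ (fun y => logBracket P θ Γ f y X') x Y' +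
        logBracket P θ Γ f x ⁅X', Y'⁆ := by
  let e : LieAlg E G → Module.Dual ℝ (LieAlg E G) →ₗ[ℝ] ℝ := fun X =>
    Module.Dual.eval ℝ (LieAlg E G) X
  let s : LieAlg E G → Double E G →ₗ[ℝ] ℝ := fun X => e X ∘ₗ LinearMap.snd ℝ _ _
  obtain ⟨T, hT⟩ := exists_linearMap_doubleBracket hΘ (0, logBracket P θ Γ f x)
  have hs : ∀ {X X'}, (∀ lam, dualAd θ (Γ x) lam X = lam X') →
      ∀ lam, (s X ∘ₗ doubleAd Θ j (Γ x)) (0, lam) = lam X' := by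
    intro X X' hX lam
    simp only [s, LinearMap.comp_apply, doubleAd_inr hj]
    exact hX lam
  have he : ∀ {X X'}, (∀ lam, dualAd θ (Γ x) lam X = lam X') → e X ∘ₗ dualAd θ (Γ x) = e X' :=
    fun hX => LinearMap.ext hX
  have d1 := differential_contract_dualAd P hΘ hj hΓ (e X) (e Y) x (hamVec P f x)
  rw [he hX, he hY] at d1
  have hcomm := commutator_logBracket P θ hΓ hf (e X') (e Y') x
    (D := dualBracket π (logBracket P θ Γ f x)) (fun v => hθ _ _)
  have d2 := differential_contract_doubleAd hΘ hj hΓ (s X) (s Y) (canonicalR b) x (hamVec P f x) hT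
  rw [contract_ad_canonicalR b π _ hT _ _ X' Y' (hs hX) (hs hY)] at d2
  have m1 := (contMDiff_contract_dualAd P hj hΓ (e X) (e Y)).mdifferentiable (by simp) x
  have m2 := (contMDiff_contract_doubleAd hj hΓ (s X) (s Y)
    (canonicalR b)).mdifferentiable (by simp) x
  have hsum := LinearMap.congr_fun (differential_add m1 (m2.const_smul (-(1 / 2 : ℝ))))
    (hamVec P f x)
  rw [LinearMap.add_apply, differential_smul _ m2, LinearMap.smul_apply, d1, d2] at hsum
  rw [← differential_hamVec]
  refine Eq.trans (LinearMap.congr_fun (differential_congr fun y => ?_) _) (hsum.trans ?_)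
  · rw [coeff, contract_bracketDefect, sub_eq_add_neg, ← neg_mul]
    rfl
  · change e X' (logBracket P θ Γ (fun y => e Y' (logBracket P θ Γ f y)) x) -
      e Y' (logBracket P θ Γ (fun y => e X' (logBracket P θ Γ f y)) x) = _ at hcomm
    refine Eq.trans ?_ (congrArg (· + logBracket P θ Γ f x ⁅X', Y'⁆) hcomm.symm)
    simp only [logBracket, smul_eq_mul]
    ring

end MomentMap

/-! ### The curvature of the infinitesimal action -/

section MomentMap

variable {E : Type*} [NormedAddCommGroup E] [NormedSpace ℝ E] [FiniteDimensional ℝ E]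
  {G : Type*} [TopologicalSpace G] [ChartedSpace E G] [Group G] [T2Space G]
  [LieGroup 𝓘(ℝ, E) ∞ G] {π : PoissonStructure E G}
  {Es : Type*} [NormedAddCommGroup Es] [NormedSpace ℝ Es] [FiniteDimensional ℝ Es]
  {Gs : Type*} [TopologicalSpace Gs] [ChartedSpace Es Gs] [Group Gs] [T2Space Gs]
  [LieGroup 𝓘(ℝ, Es) ∞ Gs]
  {Ed : Type*} [NormedAddCommGroup Ed] [NormedSpace ℝ Ed] [FiniteDimensional ℝ Ed]
  {DG : Type*} [TopologicalSpace DG] [ChartedSpace Ed DG] [Group DG] [T2Space DG]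
  [LieGroup 𝓘(ℝ, Ed) ∞ DG]
  {θ : Module.Dual ℝ (LieAlg E G) ≃ₗ[ℝ] LieAlg Es Gs}
  {Θ : Double E G ≃ₗ[ℝ] LieAlg Ed DG} {j : Gs →* DG}
  {κ : Type*} [Fintype κ] (b : Module.Basis κ ℝ (LieAlg E G))
  {F : Type*} [NormedAddCommGroup F] [NormedSpace ℝ F]
  {M : Type*} [TopologicalSpace M] [ChartedSpace F M]
  (P : PoissonStructure F M) {Γ : M → Gs}

theorem momentAction_momentAction (hΓ : ContMDiff 𝓘(ℝ, F) 𝓘(ℝ, Es) ∞ Γ) {f : M → ℝ}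
    (hf : ContMDiff 𝓘(ℝ, F) 𝓘(ℝ, ℝ) ∞ f) (ε ε' : LieAlg E G) (x : M) :
    momentAction P θ Γ ε (momentAction P θ Γ ε' f) x =
      logBracket P θ Γ (fun y => logBracket P θ Γ f y ε') x ε := by
  have h1 : momentAction P θ Γ ε' f = (-1 : ℝ) • fun y => logBracket P θ Γ f y ε' := by
    ext y
    rw [momentAction_apply, Pi.smul_apply, neg_one_smul]
  have h2 : MDifferentiableAt 𝓘(ℝ, F) 𝓘(ℝ, ℝ) (fun y => logBracket P θ Γ f y ε') x :=
    (contMDiff_apply_logBracket P θ hΓ hf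
      (Module.Dual.eval ℝ (LieAlg E G) ε')).mdifferentiable (by simp) x
  have h3 := fun g => apply_logBracket P θ Γ (Module.Dual.eval ℝ (LieAlg E G) ε) g x
  simp only [Module.Dual.eval_apply] at h3
  rw [h1, momentAction_apply, h3, h3, differential_smul _ h2, ← contract_comm, contract_smul_left,
    contract_comm]
  ring

/-- The moment map defines a Lie algebra action if and only if the defect is central. -/
theorem isLieAction_iff (hθ : IsDualIdentification π θ)
    (hΘ : IsDoubleIdentification π Θ) (hj : IsLift θ Θ j)
    (hΓ : ContMDiff 𝓘(ℝ, F) 𝓘(ℝ, Es) ∞ Γ) :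
    IsLieAction (F := F) (momentAction P θ Γ) ↔
      ∀ X Y : LieAlg E G, ∀ f : M → ℝ, ContMDiff 𝓘(ℝ, F) 𝓘(ℝ, ℝ) ∞ f →
        bracket P.tensor (fun x => coeff X Y (bracketDefect b P θ Θ j Γ x)) f = 0 := by
  -- the transpose of a linear endomorphism of the dual
  have htr : ∀ (A : Module.Dual ℝ (LieAlg E G) →ₗ[ℝ] Module.Dual ℝ (LieAlg E G))
      (X : LieAlg E G), ∃ X', ∀ lam, A lam X = lam X' := fun A X =>
    ⟨(Module.evalEquiv ℝ (LieAlg E G)).symm (Module.Dual.eval ℝ (LieAlg E G) X ∘ₗ A), fun lam => by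
      rw [Module.apply_evalEquiv_symm_apply]
      rfl⟩
  constructor
  · intro h X Y f hf
    ext x
    obtain ⟨X', hX⟩ := htr (dualAd θ (Γ x)) X
    obtain ⟨Y', hY⟩ := htr (dualAd θ (Γ x)) Y
    have h' := congrFun (h X' Y' f hf) x
    rw [Pi.sub_apply, momentAction_momentAction P hΓ hf, momentAction_momentAction P hΓ hf,
      momentAction_apply] at h'
    rw [bracket_coeff_bracketDefect b P hθ hΘ hj hΓ hf x hX hY, h', neg_add_cancel]
    rfl
  · intro h ε ε' f hf
    ext x
    have hi : ∀ {X ε}, (∀ lam, dualAd θ (Γ x)⁻¹ lam ε = lam X) →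
        ∀ lam, dualAd θ (Γ x) lam X = lam ε := by
      intro X ε hX lam
      rw [← hX, ← LinearMap.comp_apply, dualAd_inv_comp]
      rfl
    -- every pair of elements of `𝔤` is obtained from the transpose of the adjoint action
    obtain ⟨X, hX⟩ := htr (dualAd θ (Γ x)⁻¹) ε
    obtain ⟨Y, hY⟩ := htr (dualAd θ (Γ x)⁻¹) ε'
    have h' := congrFun (h X Y f hf) x
    rw [bracket_coeff_bracketDefect b P hθ hΘ hj hΓ hf x (hi hX) (hi hY)] at h'
    rw [Pi.sub_apply, momentAction_momentAction P hΓ hf, momentAction_momentAction P hΓ hf,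
      momentAction_apply]
    exact eq_neg_of_add_eq_zero_left h'

variable {P} in
theorem satisfiesBracket_iff_eq_bracketDefect [PreconnectedSpace Gs]
    (hΘ : IsDoubleIdentification π Θ) (hj : IsLift θ Θ j)
    (hΓ : ContMDiff 𝓘(ℝ, F) 𝓘(ℝ, Es) ∞ Γ)
    (N : M → Module.Dual ℝ (LieAlg E G) ⊗[ℝ] Module.Dual ℝ (LieAlg E G)) :
    SatisfiesBracket P (tensorSq Θ.toLinearMap (canonicalR b)) (fun x => dualTensor Θ (N x))
        (j ∘ Γ) ↔ N = bracketDefect b P θ Θ j Γ := by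
  rw [satisfiesBracket_iff b P hΘ hj hΓ, funext_iff]
  refine forall_congr' fun x => ?_
  rw [bracketDefect, eq_sub_iff_add_eq, add_comm, eq_comm]

theorem logBivector_mul_left (hΓ : ContMDiff 𝓘(ℝ, F) 𝓘(ℝ, Es) ∞ Γ) (C : Gs) (x : M) :
    logBivector P θ (fun y => C * Γ y) x = logBivector P θ Γ x := by
  rw [logBivector, logBivector, logDeriv_mul_left θ hΓ]

theorem momentAction_mul_left (hΓ : ContMDiff 𝓘(ℝ, F) 𝓘(ℝ, Es) ∞ Γ) (C : Gs) (ε : LieAlg E G)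
    (f : M → ℝ) : momentAction P θ (fun y => C * Γ y) ε f = momentAction P θ Γ ε f := by
  ext x
  rw [momentAction_apply, momentAction_apply, logBracket, logBracket, logDeriv_mul_left θ hΓ]

/-- The change of the defect under a left translation of the moment map. -/
theorem bracketDefect_mul_left [PreconnectedSpace Gs]
    (hΘ : IsDoubleIdentification π Θ) (hj : IsLift θ Θ j)
    (hΓ : ContMDiff 𝓘(ℝ, F) 𝓘(ℝ, Es) ∞ Γ) (C : Gs) (x : M) :
    bracketDefect b P θ Θ j (fun y => C * Γ y) x =
      tensorSq (dualAd θ C) (bracketDefect b P θ Θ j Γ x + twist Θ b j C⁻¹) := by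
  have h := twist_mul b hΘ hj C C⁻¹
  rw [mul_inv_cancel, twist_one b hΘ hj] at h
  rw [bracketDefect, bracketDefect, logBivector_mul_left P hΓ, twist_mul b hΘ hj, dualAd_mul,
    ← tensorSq_comp, map_add, map_sub]
  exact sub_add_eq_of_zero_eq_add h

/-- In the double, `-m(C⁻¹)` is half the difference of `R` and its conjugate by `C⁻¹`. -/
theorem dualTensor_neg_twist_inv [PreconnectedSpace Gs]
    (hΘ : IsDoubleIdentification π Θ) (hj : IsLift θ Θ j) (C : Gs) :
    dualTensor Θ (-twist Θ b j C⁻¹) =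
      (1 / 2 : ℝ) • tensorSq Θ.toLinearMap (canonicalR b) -
        (1 / 2 : ℝ) • tensorSq (Ad (j C)⁻¹) (tensorSq Θ.toLinearMap (canonicalR b)) := by
  have e : Θ.toLinearMap ∘ₗ doubleAd Θ j C⁻¹ = Ad (j C)⁻¹ ∘ₗ Θ.toLinearMap := by
    refine LinearMap.ext fun u => ?_
    simp [doubleAd]
  have h := tensorSq_neg_half_sub Θ.toLinearMap (canonicalR b)
    (tensorSq (doubleAd Θ j C⁻¹) (canonicalR b))
  rw [tensorSq_comp _ Θ.toLinearMap, e, ← tensorSq_comp] at h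
  refine Eq.trans ?_ h
  rw [dualTensor, ← tensorSq_comp]
  exact congrArg _ ((tensorSq_neg _ _).trans (congrArg Neg.neg (tensorSq_inr_twist b hΘ hj C⁻¹)))

end MomentMap

end PoissonLie

end

theorem mainTheorem1
    {E : Type*} [NormedAddCommGroup E] [NormedSpace ℝ E] [FiniteDimensional ℝ E]
    {G : Type*} [TopologicalSpace G] [ChartedSpace E G] [Group G] [T2Space G]
    [LieGroup 𝓘(ℝ, E) ∞ G]
    (πG : PoissonLie.PoissonStructure E G) (hG : PoissonLie.IsPoissonLie πG)
    {Es : Type*} [NormedAddCommGroup Es] [NormedSpace ℝ Es] [FiniteDimensional ℝ Es]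
    {Gs : Type*} [TopologicalSpace Gs] [ChartedSpace Es Gs] [Group Gs] [T2Space Gs]
    [LieGroup 𝓘(ℝ, Es) ∞ Gs] [SimplyConnectedSpace Gs]
    (θ : Module.Dual ℝ (PoissonLie.LieAlg E G) ≃ₗ[ℝ] PoissonLie.LieAlg Es Gs)
    (hθ : PoissonLie.IsDualIdentification πG θ)
    {Ed : Type*} [NormedAddCommGroup Ed] [NormedSpace ℝ Ed] [FiniteDimensional ℝ Ed]
    {DG : Type*} [TopologicalSpace DG] [ChartedSpace Ed DG] [Group DG] [T2Space DG]
    [LieGroup 𝓘(ℝ, Ed) ∞ DG]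
    (Θ : PoissonLie.Double E G ≃ₗ[ℝ] PoissonLie.LieAlg Ed DG)
    (hΘ : PoissonLie.IsDoubleIdentification πG Θ)
    (j : Gs →* DG) (hj : PoissonLie.IsLift θ Θ j)
    {κ : Type*} [Fintype κ] (b : Module.Basis κ ℝ (PoissonLie.LieAlg E G))
    {F : Type*} [NormedAddCommGroup F] [NormedSpace ℝ F] [FiniteDimensional ℝ F]
    {M : Type*} [TopologicalSpace M] [ChartedSpace F M] [T2Space M] [IsManifold 𝓘(ℝ, F) ∞ M]
    (P : PoissonLie.PoissonStructure F M)
    (Γ : M → Gs) (hΓ : ContMDiff 𝓘(ℝ, F) 𝓘(ℝ, Es) ∞ Γ) :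
    let R := PoissonLie.tensorSq Θ.toLinearMap (PoissonLie.canonicalR b)
    (PoissonLie.IsLieAction (F := F) (PoissonLie.momentAction P θ Γ) →
      ∃ N : M → Module.Dual ℝ (PoissonLie.LieAlg E G) ⊗[ℝ] Module.Dual ℝ (PoissonLie.LieAlg E G),
        PoissonLie.IsCentralTensor P N ∧
        PoissonLie.SatisfiesBracket P R (fun x => PoissonLie.dualTensor Θ (N x)) (j ∘ Γ)) ∧
    (∀ N : M → Module.Dual ℝ (PoissonLie.LieAlg E G) ⊗[ℝ] Module.Dual ℝ (PoissonLie.LieAlg E G),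
      PoissonLie.IsCentralTensor P N →
      PoissonLie.SatisfiesBracket P R (fun x => PoissonLie.dualTensor Θ (N x)) (j ∘ Γ) →
      PoissonLie.IsLieAction (F := F) (PoissonLie.momentAction P θ Γ)) ∧
    (∀ C : Gs,
      ∃ n : Module.Dual ℝ (PoissonLie.LieAlg E G) ⊗[ℝ] Module.Dual ℝ (PoissonLie.LieAlg E G),
        TensorProduct.comm ℝ _ _ n = -n ∧
        PoissonLie.dualTensor Θ n =
          (1 / 2 : ℝ) • R - (1 / 2 : ℝ) • PoissonLie.tensorSq (PoissonLie.Ad (j C)⁻¹) R ∧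
        (∀ ε : PoissonLie.LieAlg E G, ∀ f : M → ℝ, ContMDiff 𝓘(ℝ, F) 𝓘(ℝ, ℝ) ∞ f →
          PoissonLie.momentAction P θ (fun x => C * Γ x) ε f =
            PoissonLie.momentAction P θ Γ ε f) ∧
        (PoissonLie.SatisfiesBracket P R (fun _ => PoissonLie.dualTensor Θ n) (j ∘ Γ) →
          PoissonLie.SatisfiesBracket P R (fun _ => 0) (j ∘ fun x => C * Γ x))) := by
  refine ⟨fun h => ⟨PoissonLie.bracketDefect b P θ Θ j Γ,
    ⟨PoissonLie.bracketDefect_skew b P, PoissonLie.contMDiff_coeff_bracketDefect b P hj hΓ,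
      (PoissonLie.isLieAction_iff b P hθ hΘ hj hΓ).1 h⟩,
    (PoissonLie.satisfiesBracket_iff_eq_bracketDefect b hΘ hj hΓ _).2 rfl⟩, fun N hN h => ?_,
    fun C => ⟨-PoissonLie.twist Θ b j C⁻¹, ?_, PoissonLie.dualTensor_neg_twist_inv b hΘ hj C,
      fun ε f _ => PoissonLie.momentAction_mul_left P hΓ C ε f, fun h => ?_⟩⟩
  · rw [PoissonLie.isLieAction_iff b P hθ hΘ hj hΓ,
      ← (PoissonLie.satisfiesBracket_iff_eq_bracketDefect b hΘ hj hΓ N).1 h]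
    exact hN.central
  · exact PoissonLie.comm_neg_of_skew (PoissonLie.twist_skew b C⁻¹)
  · have h0 := congrFun ((PoissonLie.satisfiesBracket_iff_eq_bracketDefect b hΘ hj hΓ _).1 h)
    have h1 := (PoissonLie.satisfiesBracket_iff_eq_bracketDefect (P := P) b hΘ hj
      (Γ := fun x => C * Γ x) (contMDiff_const.mul hΓ) fun _ => 0).2 (by
        ext1 x
        rw [PoissonLie.bracketDefect_mul_left b P hΘ hj hΓ]
        exact (PoissonLie.tensorSq_add_eq_zero _ (h0 x).symm).symm)
    simp only [PoissonLie.dualTensor, map_zero] at h1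
    exact h1
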